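/- **Theorem 5.2 (minimal products with constant $S$).** Let $n_1,\hat n_1\ge 1$, $n=n_1+\hat n_1$, $p_1,\hat p_1\ge 0$. Let $M_1$, $\hat M_1$ be closed (compact, without boundary) connected smooth manifolds of dimensions $n_1$, $\hat n_1$, and let $f_1:M_1\to S^{n_1+p_1}\subset\mathbb R^{n_1+p_1+1}$ and $\hat f_1:\hat M_1\to S^{\hat n_1+\hat p_1}\subset\mathbb R^{\hat n_1+\hat p_1+1}$ be minimal immersions into unit spheres. Let $c_1,\hat c_1\in\mathbb R$ with $c_1^2+\hat c_1^2=1$, $c_1\hat c_1\neq 0$ be such that the product $$f=(c_1f_1,\hat c_1\hat f_1):M_1\times\hat M_1\to S^{n+p_1+\hat p_1+1}$$ is a minimal immersion. Let $S,S_1,\hat S_1$ be the squared lengths of the second fundamental forms of $f,f_1,\hat f_1$ in the respective unit spheres, with respect to the induced metrics. Call a closed submanifold given by an immersion $F$ into a unit sphere *congruent* to one given by $F'$ if the image of $F$ is the image of $F'$ under a linear isometric embedding of the ambient Euclidean space of $F'$ into that of $F$. Then: 1. $S$ is constant if and only if both $S_1$ and $\hat S_1$ are constant. 2. If $S$ is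 constant, then $S\ge n$, with equality if and only if $f$ is congruent to the Clifford hypersurface $C_{n_1,\hat n_1}=\sqrt{\tfrac{n_1}{n}}\,S^{n_1}\times\sqrt{\tfrac{\hat n_1}{n}}\,S^{\hat n_1}\subset S^{n+1}$. 3. If $S$ is constant and $n<S\le\frac53 n$, then $S=\frac53 n$, $n\ge 3$, and $f$ is congruent to the minimal product $\left(\sqrt{\tfrac{n-2}{n}}\,\iota,\sqrt{\tfrac2n}\,v\right)$ in $S^{n+3}$ of the inclusion $\iota:S^{n-2}\to\mathbb R^{n-1}$ of the $(n-2)$-dimensional great sphere and the Veronese surface $v:S^2\to S^4\subset\mathbb R^5$, $$v(x,y,z)=\left(\sqrt3\,xy,\ \sqrt3\,xz,\ \sqrt3\,yz,\ \tfrac{\sqrt3}{2}(x^2-y^2),\ \tfrac12(x^2+y^2-2z^2)\right),\qquad x^2+y^2+z^2=1 .$$ -/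

import Mathlib

open scoped Manifold ContDiff

noncomputable section

namespace MinimalProducts

section Extrinsic

variable {V : Type*} [NormedAddCommGroup V] [NormedSpace ℝ V]
  {H : Type*} [TopologicalSpace H] (I : ModelWithCorners ℝ V H)
  {M : Type*} [TopologicalSpace M] [ChartedSpace H M]
  {E : Type*} [NormedAddCommGroup E] [InnerProductSpace ℝ E] [FiniteDimensional ℝ E]

/-- The tangent space of `F : M → E` at `x`: the subspace `dF (T_x M)` of the ambient space. -/
def tangentSubspace (F : M → E) (x : M) : Submodule ℝ E :=
  LinearMap.range (mvfderiv I F x : TangentSpace I x →ₗ[ℝ] E)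

/-- For `F` with values in the unit sphere, the normal space at `x` of `F` inside the sphere: the
vectors of `E` orthogonal to `dF (T_x M)` and to the position vector `F x`. -/
def normalSubspace (F : M → E) (x : M) : Submodule ℝ E :=
  (tangentSubspace I F x ⊔ Submodule.span ℝ {F x})ᗮ

/-- A tangent vector of `M` at `x`, as an element of the model space `V` (its coordinates in the
preferred chart at `x`), that `dF` maps to the given `ξ` in the tangent space of `F`. It is the
only one if `F` is an immersion. -/
def tangentLift (F : M → E) (x : M) (ξ : tangentSubspace I F x) : V :=
  Classical.choose (show ∃ v : TangentSpace I x, mvfderiv I F x v = ξ.1 from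
    LinearMap.mem_range.mp ξ.2)

/-- The second derivative at `x` of the local parametrization `F ∘ φ⁻¹`, where `φ` is the preferred
chart at `x` (for manifolds without boundary). -/
def secondDerivative (F : M → E) (x : M) : V →L[ℝ] V →L[ℝ] E :=
  fderiv ℝ (fderiv ℝ (F ∘ (extChartAt I x).symm)) (extChartAt I x x)

/-- The second fundamental form at `x` of the immersion `F` into the unit sphere of `E`: the
component normal to `F` and tangent to the sphere of the second derivative of `F` (Gauss formula).
The component does not depend on the chart, because a change of chart alters the second derivative
by tangent vectors only. -/
def secondFundamentalForm (F : M → E) (x : M) (ξ ζ : tangentSubspace I F x) : E :=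
  (normalSubspace I F x).starProjection
    (secondDerivative I F x (tangentLift I F x ξ) (tangentLift I F x ζ))

/-- The mean curvature vector at `x` of the immersion `F` into the unit sphere: the trace of the
second fundamental form with respect to the induced metric, divided by the dimension. -/
def meanCurvature (F : M → E) (x : M) : E :=
  (Module.finrank ℝ (tangentSubspace I F x) : ℝ)⁻¹ •
    ∑ i, secondFundamentalForm I F x
      (stdOrthonormalBasis ℝ (tangentSubspace I F x) i)
      (stdOrthonormalBasis ℝ (tangentSubspace I F x) i)

/-- The squared length `S` at `x` of the second fundamental form of the immersion `F` into the unit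
sphere, with respect to the induced metric. -/
def squaredLength (F : M → E) (x : M) : ℝ :=
  ∑ i, ∑ j, ‖secondFundamentalForm I F x
      (stdOrthonormalBasis ℝ (tangentSubspace I F x) i)
      (stdOrthonormalBasis ℝ (tangentSubspace I F x) j)‖ ^ 2

/-- `F` is a minimal submanifold of the unit sphere of `E`: a smooth immersion of `M` into that
sphere whose mean curvature vector vanishes identically. -/
structure IsMinimalSubmanifold (F : M → E) : Prop where
  contMDiff : ContMDiff I 𝓘(ℝ, E) ∞ F
  norm_eq_one : ∀ x, ‖F x‖ = 1
  immersion : ∀ x, Function.Injective (mvfderiv I F x)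
  meanCurvature_eq_zero : ∀ x, meanCurvature I F x = 0

end Extrinsic

/-- The product `(c f, d g) : M × N → E × E'` of `f` and `g` with weights `c` and `d`; the target
carries the Euclidean inner product. -/
def productMap {M N E E' : Type*} [SMul ℝ E] [SMul ℝ E'] (c d : ℝ) (f : M → E) (g : N → E') :
    M × N → WithLp 2 (E × E') :=
  fun z => WithLp.toLp 2 (c • f z.1, d • g z.2)

/-- Congruence of two closed submanifolds of unit spheres, given by maps `F` and `F'`: up to a
linear isometry of the ambient Euclidean spaces they are the same submanifold. (The ambient space
of `F` may be larger, so that the second submanifold lies in a great subsphere; the first one may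
be parametrized by a covering.) -/
def IsCongruentTo {M M' E E' : Type*} [NormedAddCommGroup E] [InnerProductSpace ℝ E]
    [NormedAddCommGroup E'] [InnerProductSpace ℝ E'] (F : M → E) (F' : M' → E') : Prop :=
  ∃ A : E' →ₗᵢ[ℝ] E, Set.range F = A '' Set.range F'

/-- The standard sphere `S^m`, as a submanifold of itself: the inclusion in `ℝ^(m+1)`. -/
def standardSphere (m : ℕ) :
    Metric.sphere (0 : EuclideanSpace ℝ (Fin (m + 1))) 1 → EuclideanSpace ℝ (Fin (m + 1)) :=
  Subtype.val

/-- The Veronese surface in `S^4`, parametrized (homothetically) by the unit two-sphere. -/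
def veroneseSurface :
    Metric.sphere (0 : EuclideanSpace ℝ (Fin 3)) 1 → EuclideanSpace ℝ (Fin 5) :=
  fun y => !₂[√3 * (y.1 0 * y.1 1), √3 * (y.1 0 * y.1 2), √3 * (y.1 1 * y.1 2),
    √3 / 2 * (y.1 0 ^ 2 - y.1 1 ^ 2), (y.1 0 ^ 2 + y.1 1 ^ 2 - 2 * y.1 2 ^ 2) / 2]

/-- The Clifford hypersurface `√(k/(k+l)) S^k × √(l/(k+l)) S^l` in `S^(k+l+1)`. -/
def cliffordHypersurface (k l : ℕ) :
    Metric.sphere (0 : EuclideanSpace ℝ (Fin (k + 1))) 1 ×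
      Metric.sphere (0 : EuclideanSpace ℝ (Fin (l + 1))) 1 →
    WithLp 2 (EuclideanSpace ℝ (Fin (k + 1)) × EuclideanSpace ℝ (Fin (l + 1))) :=
  productMap √((k : ℝ) / ((k : ℝ) + l)) √((l : ℝ) / ((k : ℝ) + l))
    (standardSphere k) (standardSphere l)

/-- The minimal product `(√(m/(m+2)) S^m, √(2/(m+2)) Veronese)` of an `m`-dimensional great sphere
and the Veronese surface, in `S^(m+5)`. -/
def sphereVeroneseProduct (m : ℕ) :
    Metric.sphere (0 : EuclideanSpace ℝ (Fin (m + 1))) 1 ×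
      Metric.sphere (0 : EuclideanSpace ℝ (Fin 3)) 1 →
    WithLp 2 (EuclideanSpace ℝ (Fin (m + 1)) × EuclideanSpace ℝ (Fin 5)) :=
  productMap √((m : ℝ) / ((m : ℝ) + 2)) √(2 / ((m : ℝ) + 2))
    (standardSphere m) veroneseSurface

end MinimalProducts

end

/-! Write n₁, n₂ for the dimensions of the factors and n for their sum. The trace of the second
fundamental form of the product, tested against each position vector, forces c₁² = n₁/n and c₂² =
n₂/n (`weight_sq`). Summing squares instead of taking the trace (`squaredLength_productMap`) then
gives S = n (1 + S₁/n₁ + S₂/n₂). The variables separate, so S is constant exactly when S₁ and S₂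
are. Moreover S ≥ n, with equality exactly when both factors are totally geodesic. In that case they
are great spheres, because the span of position and tangent space does not move
(`isCongruentTo_standardSphere`). The converse in the equality case is a dimension count: a product
lying in a linear space of dimension n + 2 has totally geodesic factors
(`sff_eq_zero_of_finrank_le`).

If n < S ≤ 5n/3, then Sᵢ ≤ 2nᵢ/3 for both factors, so everything rests on `eq_zero_or_eq_of_le`: a
closed minimal n-dimensional submanifold with constant S ≤ 2n/3 is a great sphere or the Veronese
surface. For constant S, Simons' identity holds pointwise, without integration: |∇h|² + nS = ∑ ⟨A_c,
A_d⟩² + ∑ |[A_c, A_d]|², where the A_c are the shape operators of a normal frame. The matrix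
inequality `liLi` bounds the right side by 3S²/2. If S > 0, this leaves only S = 2n/3, with ∇h = 0
and, in a suitable normal frame, just two nonzero shape operators of maximal commutator. Those have
a common kernel of codimension two, whereas a nonzero parallel second fundamental form admits no
nullity direction (`t_eq_zero_of_nullity`). Hence n = 2, and h satisfies the Veronese relation.

Such a surface is then recognized globally by first integrals. The span of position, tangent space
and first normal space is constant, and so is a cubic form built from the same data, which is
Cartan's cubic (`D_osculating_eq_zero`, `D_cubic`). The gradient of this cubic is radial at every
point of the surface, and on the unit sphere this equation cuts out exactly the Veronese surface
(`exists_veronesePoly_eq`). An open-and-closed argument on the sphere shows that the whole Veronese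
surface is covered. Two Veronese factors would give S₁/n₁ + S₂/n₂ = 4/3, which is too large, so
exactly one factor is Veronese and the other a great sphere.

The local geometry uses neither moving frames nor a connection. `SphereCalculus` records the algebra
of smooth functions with its derivations along the tangential parts of fixed ambient vectors.
Tensors become multilinear functions on the ambient space, and covariant derivatives become ordinary
ones with explicit corrections. -/

open scoped Manifold ContDiff RealInnerProductSpace Topology

noncomputable section

namespace MinimalProducts

/-! ### Contractions in orthonormal bases -/

section Contraction

variable {E W : Type*} [NormedAddCommGroup E] [InnerProductSpace ℝ E]
  [AddCommGroup W] [Module ℝ W] {ι ι' : Type*} [Fintype ι] [Fintype ι']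

/-- The contraction of a bilinear map does not depend on the orthonormal basis. -/
theorem sum_bilin_eq (b : OrthonormalBasis ι ℝ E) (b' : OrthonormalBasis ι' ℝ E)
    (B : E →ₗ[ℝ] E →ₗ[ℝ] W) : ∑ i, B (b i) (b i) = ∑ j, B (b' j) (b' j) := by
  have h1 : ∀ i, B (b i) (b i) = ∑ j, ∑ k, (⟪b' j, b i⟫ * ⟪b i, b' k⟫) • B (b' j) (b' k) := by
    intro i
    conv_lhs => rw [← b'.sum_repr' (b i)]
    simp only [map_sum, map_smul, LinearMap.sum_apply, LinearMap.smul_apply, Finset.smul_sum,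
      smul_smul]
    rw [Finset.sum_comm]
    refine Finset.sum_congr rfl fun j _ => Finset.sum_congr rfl fun k _ => ?_
    rw [real_inner_comm (b i) (b' k), mul_comm]
  simp_rw [h1]
  rw [Finset.sum_comm]
  refine Finset.sum_congr rfl fun j _ => ?_
  rw [Finset.sum_comm]
  classical
  have h2 : ∀ k, ∑ i, (⟪b' j, b i⟫ * ⟪b i, b' k⟫) • B (b' j) (b' k)
      = if j = k then B (b' j) (b' k) else 0 := by
    intro k
    rw [← Finset.sum_smul, b.sum_inner_mul_inner, orthonormal_iff_ite.mp b'.orthonormal j k]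
    split_ifs <;> simp
  simp [h2]

theorem sum_inner_smul_apply (b : OrthonormalBasis ι ℝ E) (φ : E →ₗ[ℝ] W) (a : E) :
    ∑ i, ⟪a, b i⟫ • φ (b i) = φ a := by
  conv_rhs => rw [← b.sum_repr' a]
  simp [real_inner_comm]

theorem sum_mul_eq {A : Type*} [CommRing A] [Algebra ℝ A] (b : OrthonormalBasis ι ℝ E)
    (b' : OrthonormalBasis ι' ℝ E) (φ ψ : E →ₗ[ℝ] A) :
    ∑ d, φ (b d) * ψ (b d) = ∑ d, φ (b' d) * ψ (b' d) := by
  simpa using sum_bilin_eq b b' ((LinearMap.mul ℝ A).compl₁₂ φ ψ)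

end Contraction

/-- The differential calculus of an `n`-dimensional minimal submanifold of the unit sphere of `E`,
expressed in ambient terms: `A` is the algebra of functions on `M`, `D a` the derivative in the
direction of the tangential part of `a`, `F` and `p` the components of the position vector and
of the projection to the tangent space, and `t` those of the second fundamental form. -/
structure SphereCalculus (E : Type*) [NormedAddCommGroup E] [InnerProductSpace ℝ E]
    [FiniteDimensional ℝ E] (n : ℕ) (M A : Type*) [CommRing A] [Algebra ℝ A] where
  ev : M → A →ₐ[ℝ] ℝ
  ext : ∀ φ ψ : A, (∀ x, ev x φ = ev x ψ) → φ = ψ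
  D : E →ₗ[ℝ] Derivation ℝ A A
  F : E →ₗ[ℝ] A
  p : E →ₗ[ℝ] E →ₗ[ℝ] A
  t : E →ₗ[ℝ] E →ₗ[ℝ] E →ₗ[ℝ] A
  pt : M → E
  T : M → Submodule ℝ E
  norm_pt : ∀ x, ‖pt x‖ = 1
  pt_mem : ∀ x, pt x ∈ (T x)ᗮ
  finrank_T : ∀ x, Module.finrank ℝ (T x) = n
  ev_F : ∀ x a, ev x (F a) = ⟪pt x, a⟫
  ev_p : ∀ x a b, ev x (p a b) = ⟪(T x).starProjection a, b⟫
  D_orth : ∀ x, ∀ a ∈ (T x)ᗮ, ∀ φ, ev x (D a φ) = 0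
  t_symm : ∀ a b c, t a b c = t b a c
  t_orth : ∀ x, ∀ a ∈ (T x)ᗮ, ∀ b c, ev x (t a b c) = 0
  t_tan : ∀ x, ∀ c ∈ T x, ∀ a b, ev x (t a b c) = 0
  t_pt : ∀ x a b, ev x (t a b (pt x)) = 0
  D_F : ∀ v a, D v (F a) = p v a
  D_p : ∀ v a b, D v (p a b) = t v a b + t v b a - F b * p v a - F a * p v b
  comm : ∀ x v w φ z, (∀ d, ⟪z, d⟫ = ev x (D v (p w d) - D w (p v d))) →
    ev x (D v (D w φ)) - ev x (D w (D v φ)) = ev x (D z φ)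
  trace : ∀ c, ∑ i, t (stdOrthonormalBasis ℝ E i) (stdOrthonormalBasis ℝ E i) c = 0

/-! ### Contractions and the covariant derivative in ambient terms -/

namespace SphereCalculus

variable {E : Type*} [NormedAddCommGroup E] [InnerProductSpace ℝ E]
    [FiniteDimensional ℝ E] {n : ℕ} {M A : Type*} [CommRing A] [Algebra ℝ A]
    (C : SphereCalculus E n M A) {ι : Type*} [Fintype ι] (b : OrthonormalBasis ι ℝ E)

/-- The derivatives of a function, as a linear map in the direction. -/
def grad (φ : A) : E →ₗ[ℝ] A where
  toFun v := C.D v φ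
  map_add' := by simp
  map_smul' := by simp

@[simp] theorem grad_apply (φ : A) (v : E) : C.grad φ v = C.D v φ := rfl

theorem trace_basis (c : E) : ∑ i, C.t (b i) (b i) c = 0 := by
  have h := sum_bilin_eq b (stdOrthonormalBasis ℝ E) (C.t.compr₂ (LinearMap.applyₗ c))
  simpa [C.trace] using h

theorem t_proj (x : M) (a u c : E) :
    C.ev x (C.t ((C.T x).starProjection a) u c) = C.ev x (C.t a u c) := by
  have h := C.t_orth x _ (Submodule.sub_starProjection_mem_orthogonal (K := C.T x) a) u c
  rw [map_sub, LinearMap.sub_apply, LinearMap.sub_apply, map_sub] at h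
  linarith

theorem t_orth' (x : M) (a : E) (ha : a ∈ (C.T x)ᗮ) (u c : E) : C.ev x (C.t u a c) = 0 := by
  rw [C.t_symm, C.t_orth x a ha]

theorem p_orth (x : M) (a : E) (ha : a ∈ (C.T x)ᗮ) (u : E) : C.ev x (C.p a u) = 0 := by
  rw [C.ev_p, (Submodule.starProjection_apply_eq_zero_iff _).2 ha, inner_zero_left]

theorem p_symm (a u : E) : C.p a u = C.p u a := by
  refine C.ext _ _ fun x => ?_
  rw [C.ev_p, C.ev_p, Submodule.inner_starProjection_left_eq_right, real_inner_comm]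

theorem p_tan (x : M) (a : E) (ha : a ∈ C.T x) (u : E) : C.ev x (C.p a u) = ⟪a, u⟫ := by
  rw [C.ev_p, Submodule.starProjection_eq_self_iff.2 ha]

theorem F_tan (x : M) (a : E) (ha : a ∈ C.T x) : C.ev x (C.F a) = 0 := by
  rw [C.ev_F, real_inner_comm]
  exact (Submodule.mem_orthogonal _ _).1 (C.pt_mem x) a ha

theorem sum_inner_mul_ev (x : M) (φ : E →ₗ[ℝ] A) (a : E) :
    ∑ i, ⟪a, b i⟫ * C.ev x (φ (b i)) = C.ev x (φ a) := by
  have h := sum_inner_smul_apply b ((C.ev x).toLinearMap ∘ₗ φ) a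
  simpa using h

theorem sum_p_mul_t (a u c : E) : ∑ d, C.p a (b d) * C.t (b d) u c = C.t a u c := by
  refine C.ext _ _ fun x => ?_
  have h := C.sum_inner_mul_ev b x (C.t.flip u |>.flip c) ((C.T x).starProjection a)
  simpa [C.ev_p, C.t_proj] using h

theorem sum_p_mul_t_last (a u c : E) : ∑ d, C.p c (b d) * C.t a u (b d) = 0 := by
  refine C.ext _ _ fun x => ?_
  have h := C.sum_inner_mul_ev b x (C.t a u) ((C.T x).starProjection c)
  rw [C.t_tan x _ (Submodule.starProjection_apply_mem _ _)] at h
  simpa [C.ev_p] using h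

theorem sum_F_mul_t_last (a u : E) : ∑ d, C.F (b d) * C.t a u (b d) = 0 := by
  refine C.ext _ _ fun x => ?_
  have h := C.sum_inner_mul_ev b x (C.t a u) (C.pt x)
  rw [C.t_pt] at h
  simpa [C.ev_F] using h

theorem sum_F_mul_t (u c : E) : ∑ d, C.F (b d) * C.t (b d) u c = 0 := by
  refine C.ext _ _ fun x => ?_
  have h := C.sum_inner_mul_ev b x (C.t.flip u |>.flip c) (C.pt x)
  simp only [LinearMap.flip_apply] at h
  rw [C.t_orth x _ (C.pt_mem x)] at h
  simpa [C.ev_F] using h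

/-- The normal component of the second fundamental form at a point, as a vector. -/
def H (x : M) (a u : E) : E := ∑ i, C.ev x (C.t a u (stdOrthonormalBasis ℝ E i)) •
  stdOrthonormalBasis ℝ E i

theorem inner_H (x : M) (a u c : E) : ⟪C.H x a u, c⟫ = C.ev x (C.t a u c) := by
  have h := C.sum_inner_mul_ev (stdOrthonormalBasis ℝ E) x (C.t a u) c
  rw [← h, H, sum_inner]
  refine Finset.sum_congr rfl fun i _ => ?_
  rw [real_inner_smul_left, real_inner_comm c, mul_comm]

theorem H_mem (x : M) (a u : E) : C.H x a u ∈ (C.T x)ᗮ := by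
  rw [Submodule.mem_orthogonal']
  intro c hc
  rw [inner_H, C.t_tan x c hc]

theorem sum_t_mul (x : M) (a u : E) (φ : E →ₗ[ℝ] A) :
    ∑ i, C.ev x (C.t a u (b i)) * C.ev x (φ (b i)) = C.ev x (φ (C.H x a u)) := by
  simp_rw [← C.inner_H, C.sum_inner_mul_ev]

/-- The last slot of `t` sees only normal vectors and the first two only tangent ones, so a
contraction across the two kinds vanishes. Most correction terms below disappear for this reason. -/
theorem sum_t_mul_t (a u w c : E) : ∑ d, C.t a u (b d) * C.t (b d) w c = 0 := by
  refine C.ext _ _ fun x => ?_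
  have h := C.sum_t_mul b x a u (C.t.flip w |>.flip c)
  simp only [LinearMap.flip_apply] at h
  rw [C.t_orth x _ (C.H_mem x a u)] at h
  simpa using h

/-- The covariant derivative of the second fundamental form. -/
def gam (v a u c : E) : A :=
  C.D v (C.t a u c) + C.F a * C.t v u c
    - ∑ d, C.t v (stdOrthonormalBasis ℝ E d) a * C.t (stdOrthonormalBasis ℝ E d) u c
    + C.F u * C.t a v c
    - ∑ d, C.t v (stdOrthonormalBasis ℝ E d) u * C.t a (stdOrthonormalBasis ℝ E d) c
    + ∑ d, C.t v c (stdOrthonormalBasis ℝ E d) * C.t a u (stdOrthonormalBasis ℝ E d)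

theorem gam_eq (v a u c : E) : C.gam v a u c =
    C.D v (C.t a u c) + C.F a * C.t v u c - ∑ d, C.t v (b d) a * C.t (b d) u c
    + C.F u * C.t a v c - ∑ d, C.t v (b d) u * C.t a (b d) c
    + ∑ d, C.t v c (b d) * C.t a u (b d) := by
  unfold gam
  have h1 := sum_mul_eq b (stdOrthonormalBasis ℝ E) ((C.t v).flip a) (C.t.flip u |>.flip c)
  have h2 := sum_mul_eq b (stdOrthonormalBasis ℝ E) ((C.t v).flip u) ((C.t a).flip c)
  have h3 := sum_mul_eq b (stdOrthonormalBasis ℝ E) (C.t v c) (C.t a u)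
  simp only [LinearMap.flip_apply] at h1 h2 h3
  rw [h1, h2, h3]

/-- The Gauss and Weingarten formulas for constant ambient vectors. The tangential part of `a` has
covariant derivative `∑ t v e a • e - F a • v` along `v`, tangential parts understood, and likewise
for `u`. The normal part of `c` has normal derivative `-h(v, c)`. The terms next to `gam` are these
derivatives inserted into the slots of `t`. -/
theorem D_t (v a u c : E) : C.D v (C.t a u c) = C.gam v a u c - C.F a * C.t v u c
    + ∑ d, C.t v (b d) a * C.t (b d) u c
    - C.F u * C.t a v c + ∑ d, C.t v (b d) u * C.t a (b d) c
    - ∑ d, C.t v c (b d) * C.t a u (b d) := by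
  rw [C.gam_eq b]; ring

theorem gam_add₁ (v v' a u c : E) : C.gam (v + v') a u c = C.gam v a u c + C.gam v' a u c := by
  simp only [gam, map_add, LinearMap.add_apply, Derivation.add_apply, mul_add, add_mul,
    Finset.sum_add_distrib]
  ring

theorem gam_add₂ (v a a' u c : E) : C.gam v (a + a') u c = C.gam v a u c + C.gam v a' u c := by
  simp only [gam, map_add, LinearMap.add_apply, mul_add, add_mul, Finset.sum_add_distrib]
  ring

theorem gam_add₄ (v a u c c' : E) : C.gam v a u (c + c') = C.gam v a u c + C.gam v a u c' := by
  simp only [gam, map_add, LinearMap.add_apply, mul_add, add_mul, Finset.sum_add_distrib]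
  ring

theorem gam_smul₄ (v a u : E) (r : ℝ) (c : E) : C.gam v a u (r • c) = r • C.gam v a u c := by
  simp only [gam, map_smul, LinearMap.smul_apply, mul_smul_comm, smul_mul_assoc, ← Finset.smul_sum,
    Derivation.map_smul, smul_add, smul_sub]

theorem gam_symm (v a u c : E) : C.gam v a u c = C.gam v u a c := by
  simp only [gam]
  simp_rw [C.t_symm u v, C.t_symm u a, C.t_symm a v, C.t_symm u (stdOrthonormalBasis ℝ E _),
    C.t_symm a (stdOrthonormalBasis ℝ E _)]
  ring

theorem gam_orth₁ (x : M) (v : E) (hv : v ∈ (C.T x)ᗮ) (a u c : E) :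
    C.ev x (C.gam v a u c) = 0 := by
  simp [gam, C.t_orth x v hv, C.t_orth' x v hv, C.D_orth x v hv]

/-- Differentiating `∑ p a d * t d u c = t a u c` where `a` is normal, only the derivative of `p`
survives on the left, and it produces exactly the corrections in `gam`. This and its companions say
that `gam` is a tensor. -/
theorem gam_orth₂ (x : M) (v a : E) (ha : a ∈ (C.T x)ᗮ) (u c : E) :
    C.ev x (C.gam v a u c) = 0 := by
  have h := congrArg (fun φ => C.ev x (C.D v φ)) (C.sum_p_mul_t (stdOrthonormalBasis ℝ E) a u c)
  have h2 : C.ev x (∑ d, C.F (stdOrthonormalBasis ℝ E d) * C.t (stdOrthonormalBasis ℝ E d) u c) = 0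
    := by rw [C.sum_F_mul_t]; simp
  have h3 := congrArg (C.ev x) (C.sum_p_mul_t (stdOrthonormalBasis ℝ E) v u c)
  simp only [map_sum, Derivation.leibniz, C.D_p, smul_eq_mul, map_add, map_mul, map_sub,
    C.p_orth x a ha, C.p_symm v a, zero_mul, zero_add, C.t_orth' x a ha, mul_zero,
    sub_zero, mul_sub] at h h2 h3
  simp only [gam, map_add, map_sub, map_mul, map_sum, C.t_orth x a ha, mul_zero,
    Finset.sum_const_zero, add_zero, sub_zero, ← h, ← h3, Finset.mul_sum, Finset.sum_sub_distrib]
  rw [← sub_eq_zero]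
  ring_nf
  rw [← sub_eq_zero]
  simp_rw [mul_comm]
  simp [mul_left_comm, mul_comm]

theorem gam_orth₃ (x : M) (v a u : E) (hu : u ∈ (C.T x)ᗮ) (c : E) :
    C.ev x (C.gam v a u c) = 0 := by
  rw [gam_symm, C.gam_orth₂ x v u hu]

theorem gam_tan (x : M) (v a u c : E) (hc : c ∈ C.T x) :
    C.ev x (C.gam v a u c) = 0 := by
  have h := congrArg (fun φ => C.ev x (C.D v φ))
    (C.sum_p_mul_t_last (stdOrthonormalBasis ℝ E) a u c)
  have h2 : C.ev x (∑ d, C.F (stdOrthonormalBasis ℝ E d) * C.t a u (stdOrthonormalBasis ℝ E d)) = 0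
    := by rw [C.sum_F_mul_t_last]; simp
  have h3 := C.sum_inner_mul_ev (stdOrthonormalBasis ℝ E) x ((C.D v : A →ₗ[ℝ] A) ∘ₗ C.t a u) c
  simp only [map_sum, Derivation.leibniz, C.D_p, smul_eq_mul, map_add, map_mul, map_sub,
    C.p_tan x c hc, C.F_tan x c hc, zero_mul, C.t_tan x c hc, mul_zero, map_zero,
    mul_sub, mul_add, Finset.sum_add_distrib, Finset.sum_sub_distrib] at h h2 h3
  simp only [LinearMap.comp_apply, Derivation.coeFn_coe] at h3
  simp only [gam, map_add, map_sub, map_mul, map_sum, C.t_tan x c hc, mul_zero,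
    Finset.sum_const_zero, add_zero, sub_zero]
  have h4 : ∑ d, C.ev x (C.t a u (stdOrthonormalBasis ℝ E d)) *
      (C.ev x (C.F (stdOrthonormalBasis ℝ E d)) * C.ev x (C.p v c)) = 0 := by
    rw [← zero_mul (C.ev x (C.p v c)), ← h2, Finset.sum_mul]
    exact Finset.sum_congr rfl fun i _ => by ring
  rw [h3, h4] at h
  rw [← h]
  simp [mul_comm]

theorem gam_pt (x : M) (v a u : E) : C.ev x (C.gam v a u (C.pt x)) = 0 := by
  have h := congrArg (fun φ => C.ev x (C.D v φ))
    (C.sum_F_mul_t_last (stdOrthonormalBasis ℝ E) a u)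
  have h2 := congrArg (C.ev x) (C.sum_p_mul_t_last (stdOrthonormalBasis ℝ E) a u v)
  have h3 := C.sum_inner_mul_ev (stdOrthonormalBasis ℝ E) x ((C.D v : A →ₗ[ℝ] A) ∘ₗ C.t a u)
    (C.pt x)
  simp only [map_sum, Derivation.leibniz, C.D_F, smul_eq_mul, map_add, map_mul, map_zero,
    Finset.sum_add_distrib] at h h2
  simp only [LinearMap.comp_apply, Derivation.coeFn_coe,
    ← C.ev_F] at h3
  simp_rw [mul_comm (C.ev x (C.p v _))] at h2
  rw [h2, h3, add_zero] at h
  simp [gam, C.t_pt, h, C.t_orth' x _ (C.pt_mem x)]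

/-- The derivative of minimality: every correction is either a multiple of a trace of `t`, or pairs
a tangential slot with a normal slot or with the position vector. -/
theorem trace_gam (v c : E) : ∑ i, C.gam v (b i) (b i) c = 0 := by
  simp_rw [C.gam_eq b]
  have h1 := congrArg (C.D v) (C.trace_basis b c)
  have h2 := C.sum_F_mul_t b v c
  have h4 : ∑ i, ∑ d, C.t v c (b d) * C.t (b i) (b i) (b d) = 0 := by
    rw [Finset.sum_comm]
    simp [← Finset.mul_sum, C.trace_basis]
  have h3 : ∑ i, ∑ d, C.t v (b d) (b i) * C.t (b d) (b i) c = 0 := by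
    rw [Finset.sum_comm]
    refine Finset.sum_eq_zero fun d _ => ?_
    simp_rw [C.t_symm (b d)]
    exact C.sum_t_mul_t b _ _ _ _
  have h3' : ∑ i, ∑ d, C.t v (b d) (b i) * C.t (b i) (b d) c = 0 := by
    rw [← h3]
    exact Finset.sum_congr rfl fun i _ => Finset.sum_congr rfl fun d _ => by
      rw [C.t_symm (b i) (b d)]
  simp only [map_sum, map_zero] at h1
  have h5 : ∀ i, C.t v (b i) c = C.t (b i) v c := fun i => C.t_symm _ _ _
  simp only [Finset.sum_add_distrib, Finset.sum_sub_distrib, h1, h3, h3', h4, h5, h2]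
  simp

end SphereCalculus

/-! ### Commutation of derivatives and the Codazzi equation -/

namespace SphereCalculus

variable {E : Type*} [NormedAddCommGroup E] [InnerProductSpace ℝ E]
    [FiniteDimensional ℝ E] {n : ℕ} {M A : Type*} [CommRing A] [Algebra ℝ A]
    (C : SphereCalculus E n M A) {ι : Type*} [Fintype ι] (b : OrthonormalBasis ι ℝ E)

theorem comm_eq_of_bracket_zero (x : M) (v w : E) (φ : A)
    (h : ∀ d, C.ev x (C.D v (C.p w d)) = C.ev x (C.D w (C.p v d))) :
    C.ev x (C.D v (C.D w φ)) = C.ev x (C.D w (C.D v φ)) := by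
  have := C.comm x v w φ 0 fun d => by rw [map_sub, h, sub_self, inner_zero_left]
  simpa [sub_eq_zero] using this

theorem ev_D_p_tan (x : M) (v a : E) (hv : v ∈ C.T x) (ha : a ∈ C.T x) (d : E) :
    C.ev x (C.D v (C.p a d)) = C.ev x (C.t v a d) - C.ev x (C.F d) * ⟪v, a⟫ := by
  simp [C.D_p, C.t_tan x a ha, C.F_tan x a ha, C.p_tan x v hv]

/-- For `v`, `w` tangent at `x`, the fields of their tangential parts have vanishing bracket at `x`:
the derivative of one along the other there is `h(v, w) - ⟪v, w⟫ • pt`, which is symmetric. -/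
theorem comm_tan (x : M) (v w : E) (hv : v ∈ C.T x) (hw : w ∈ C.T x) (φ : A) :
    C.ev x (C.D v (C.D w φ)) = C.ev x (C.D w (C.D v φ)) := by
  refine C.comm_eq_of_bracket_zero x v w φ fun d => ?_
  rw [C.ev_D_p_tan x v w hv hw, C.ev_D_p_tan x w v hw hv, C.t_symm v w, real_inner_comm]

/-- Since `p u c` is `D u (F c)`, the left side is a third derivative of the position vector. Its
normal component is the covariant derivative of `h`, so commuting derivatives will permute the slots
of `gam`. -/
theorem codazzi_aux (x : M) (v a u c : E) (ha : a ∈ C.T x) (hu : u ∈ C.T x)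
    (hc : c ∈ (C.T x)ᗮ) (hc' : ⟪C.pt x, c⟫ = 0) :
    C.ev x (C.D v (C.D a (C.p u c))) = C.ev x (C.gam v a u c) := by
  have hF : C.ev x (C.F c) = 0 := by rw [C.ev_F, hc']
  have hpc : ∀ w, C.ev x (C.p w c) = 0 := fun w => by rw [C.p_symm, C.p_orth x c hc]
  have e1 : C.ev x (C.D v (C.t a c u)) = 0 := by
    rw [C.D_t (stdOrthonormalBasis ℝ E)]
    simp [C.gam_tan x v a c u hu, C.t_tan x u hu, hF, C.t_orth' x c hc]
  have e2 : C.ev x (C.D v (C.t a u c)) = C.ev x (C.gam v a u c) := by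
    rw [C.D_t (stdOrthonormalBasis ℝ E)]
    simp [C.t_tan x u hu, C.t_tan x a ha, C.F_tan x _ ha, C.F_tan x _ hu, C.t_orth' x c hc]
  simp [C.D_p, C.D_F, e1, e2, hF, hpc, C.F_tan x u hu, Derivation.leibniz]

theorem gam_proj (x : M) (v a u c : E) : C.ev x (C.gam v a u c) =
    C.ev x (C.gam ((C.T x).starProjection v) ((C.T x).starProjection a)
      ((C.T x).starProjection u) (c - (C.T x).starProjection c - ⟪C.pt x, c⟫ • C.pt x)) := by
  have o : ∀ w, w - (C.T x).starProjection w ∈ (C.T x)ᗮ := fun w =>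
    Submodule.sub_starProjection_mem_orthogonal _
  have h1 : ∀ v a u c, C.ev x (C.gam v a u c) =
      C.ev x (C.gam ((C.T x).starProjection v) a u c) := by
    intro v a u c
    have := C.gam_add₁ ((C.T x).starProjection v) (v - (C.T x).starProjection v) a u c
    rw [add_sub_cancel] at this
    rw [this, map_add, C.gam_orth₁ x _ (o v), add_zero]
  have h2 : ∀ v a u c, C.ev x (C.gam v a u c) =
      C.ev x (C.gam v ((C.T x).starProjection a) u c) := by
    intro v a u c
    have := C.gam_add₂ v ((C.T x).starProjection a) (a - (C.T x).starProjection a) u c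
    rw [add_sub_cancel] at this
    rw [this, map_add, C.gam_orth₂ x _ _ (o a), add_zero]
  have h3 : ∀ v a u c, C.ev x (C.gam v a u c) =
      C.ev x (C.gam v a ((C.T x).starProjection u) c) := by
    intro v a u c
    rw [C.gam_symm, h2, C.gam_symm]
  have h4 : ∀ v a u c, C.ev x (C.gam v a u c) =
      C.ev x (C.gam v a u (c - (C.T x).starProjection c - ⟪C.pt x, c⟫ • C.pt x)) := by
    intro v a u c
    have e : c = (c - (C.T x).starProjection c - ⟪C.pt x, c⟫ • C.pt x)
      + ((C.T x).starProjection c + ⟪C.pt x, c⟫ • C.pt x) := by abel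
    conv_lhs => rw [e, C.gam_add₄, C.gam_add₄, C.gam_smul₄]
    simp [C.gam_pt, C.gam_tan x v a u _ (Submodule.starProjection_apply_mem (C.T x) c)]
  rw [h1, h2, h3, h4]

/-- By tensoriality the arguments may be replaced by their tangential and normal parts at `x`. There
both sides are third derivatives of the position, and the two outer derivatives commute. -/
theorem codazzi (v a u c : E) : C.gam v a u c = C.gam a v u c := by
  refine C.ext _ _ fun x => ?_
  rw [C.gam_proj x v, C.gam_proj x a]
  have m := fun w => Submodule.starProjection_apply_mem (C.T x) w
  have hp : ⟪C.pt x, C.pt x⟫ = 1 := by rw [real_inner_self_eq_norm_sq, C.norm_pt]; norm_num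
  have hc : c - (C.T x).starProjection c - ⟪C.pt x, c⟫ • C.pt x ∈ (C.T x)ᗮ :=
    Submodule.sub_mem _ (Submodule.sub_starProjection_mem_orthogonal _)
      (Submodule.smul_mem _ _ (C.pt_mem x))
  have hc' : ⟪C.pt x, c - (C.T x).starProjection c - ⟪C.pt x, c⟫ • C.pt x⟫ = 0 := by
    rw [inner_sub_right, inner_sub_right, inner_smul_right, hp,
      (Submodule.mem_orthogonal' _ _).1 (C.pt_mem x) _ (m c)]
    ring
  rw [← C.codazzi_aux x _ _ _ _ (m a) (m u) hc hc',
    ← C.codazzi_aux x _ _ _ _ (m v) (m u) hc hc', C.comm_tan x _ _ (m v) (m a)]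

theorem ev_D_t_normal (x : M) (v a u c : E) (ha : a ∈ C.T x) (hu : u ∈ C.T x)
    (hc : c ∈ (C.T x)ᗮ) : C.ev x (C.D v (C.t a u c)) = C.ev x (C.gam v a u c) := by
  rw [C.D_t (stdOrthonormalBasis ℝ E)]
  simp [C.t_tan x u hu, C.t_tan x a ha, C.F_tan x _ ha, C.F_tan x _ hu, C.t_orth' x c hc]

theorem ev_D_t_tan (x : M) (v a d u : E) (hu : u ∈ C.T x) :
    C.ev x (C.D v (C.t a d u)) = -∑ e, C.ev x (C.t v u (b e)) * C.ev x (C.t a d (b e)) := by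
  rw [C.D_t b]
  simp [C.t_tan x u hu, C.gam_tan x _ _ _ u hu]

theorem ev_D_t_orth (x : M) (v a c d : E) (hc : c ∈ (C.T x)ᗮ) :
    C.ev x (C.D v (C.t a c d)) = -(C.ev x (C.F c) * C.ev x (C.t a v d)) +
      ∑ e, C.ev x (C.t v (b e) c) * C.ev x (C.t a (b e) d) := by
  rw [C.D_t b]
  simp [C.t_orth' x c hc, C.gam_orth₃ x _ _ c hc]

theorem sum_F_mul_D (φ : A) : ∑ i, C.F (b i) * C.D (b i) φ = 0 := by
  refine C.ext _ _ fun x => ?_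
  have h := C.sum_inner_mul_ev b x (C.grad φ) (C.pt x)
  simp only [grad_apply, C.D_orth x _ (C.pt_mem x)] at h
  simpa [C.ev_F] using h

theorem sum_t_mul_D (a u : E) (φ : A) : ∑ i, C.t a u (b i) * C.D (b i) φ = 0 := by
  refine C.ext _ _ fun x => ?_
  have h := C.sum_t_mul b x a u (C.grad φ)
  simp only [grad_apply, C.D_orth x _ (C.H_mem x a u)] at h
  simpa using h

theorem sum_t_diag (u : E) : ∑ i, C.t (b i) u (b i) = 0 := by
  have h : ∀ i, C.t (b i) u (b i) = ∑ e, C.p (b i) (b e) * C.t (b e) u (b i) := fun i => by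
    rw [C.sum_p_mul_t]
  simp_rw [h]
  rw [Finset.sum_comm]
  refine Finset.sum_eq_zero fun e _ => ?_
  simp_rw [fun i => C.p_symm (b i) (b e)]
  exact C.sum_p_mul_t_last b _ _ _

theorem sum_p_diag : ∑ i, C.p (b i) (b i) = algebraMap ℝ A n := by
  refine C.ext _ _ fun x => ?_
  simp only [map_sum, C.ev_p, AlgHom.commutes, Algebra.algebraMap_self, RingHom.id_apply]
  have h := LinearMap.trace_eq_sum_inner
    ((C.T x).starProjection : E →ₗ[ℝ] E) b
  have h' : LinearMap.IsProj (C.T x) ((C.T x).starProjection : E →ₗ[ℝ] E) :=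
    ⟨fun a => Submodule.starProjection_apply_mem _ a,
      fun a ha => Submodule.starProjection_eq_self_iff.2 ha⟩
  rw [h'.trace, C.finrank_T] at h
  rw [h]
  exact Finset.sum_congr rfl fun i _ => real_inner_comm _ _

/-- The Codazzi equation turns the divergence of `h` into the derivative of its trace, which
vanishes. What remains are the quadratic corrections of `D_t`. -/
theorem sum_D_t (u c : E) : ∑ i, C.D (b i) (C.t (b i) u c) =
    ∑ i, ∑ d, C.t (b i) (b d) u * C.t (b i) (b d) c
      - ∑ i, ∑ d, C.t (b i) c (b d) * C.t (b i) u (b d) := by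
  simp_rw [fun i => C.D_t b (b i) (b i) u c]
  have h1 : ∑ i, C.gam (b i) (b i) u c = 0 := by
    simp_rw [C.gam_symm (b _) (b _) u c, C.codazzi (b _) u]
    exact C.trace_gam b u c
  have h2 : ∑ i, ∑ d, C.t (b i) (b d) (b i) * C.t (b d) u c = 0 := by
    rw [Finset.sum_comm]
    simp [← Finset.sum_mul, C.sum_t_diag]
  simp only [Finset.sum_add_distrib, Finset.sum_sub_distrib, h1, h2, C.sum_F_mul_t,
    ← Finset.mul_sum, C.trace_basis]
  ring

/-- Adapted orthonormal bases: each vector is tangent, the position vector, or normal. -/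
def Adapted (x : M) : Prop :=
  ∀ i, b i ∈ C.T x ∨ b i = C.pt x ∨ (b i ∈ (C.T x)ᗮ ∧ ⟪C.pt x, b i⟫ = 0)

variable {b}

theorem Adapted.tan_or_orth {C : SphereCalculus E n M A} {x : M} (hb : C.Adapted b x) (i : ι) :
    b i ∈ C.T x ∨ b i ∈ (C.T x)ᗮ := by
  rcases hb i with h | h | h
  · exact .inl h
  · exact .inr (h ▸ C.pt_mem x)
  · exact .inr h.1

theorem sum_D_t_last (x : M) (hb : C.Adapted b x) (a d : E) :
    ∑ i, C.ev x (C.D (b i) (C.t a d (b i))) = 0 := by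
  have h0 : ∀ i, C.ev x (C.gam (b i) a d (b i)) = 0 := fun i => by
    rcases hb.tan_or_orth i with h | h
    · exact C.gam_tan x _ _ _ _ h
    · exact C.gam_orth₁ x _ h _ _ _
  simp_rw [fun i => C.D_t b (b i) a d (b i)]
  have e1 := congrArg (C.ev x) (C.sum_t_diag b d)
  have e2 : ∑ i, C.t (b i) a (b i) = 0 := C.sum_t_diag b a
  have e3 : ∀ a d, ∑ i, ∑ e, C.t (b i) (b e) a * C.t (b e) d (b i) = 0 := fun a d => by
    rw [Finset.sum_comm]
    refine Finset.sum_eq_zero fun e _ => ?_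
    simp_rw [mul_comm (C.t (b _) (b e) a)]
    exact C.sum_t_mul_t b _ _ _ _
  have e4 : ∑ i, ∑ e, C.t (b i) (b i) (b e) * C.t a d (b e) = 0 := by
    rw [Finset.sum_comm]
    simp [← Finset.sum_mul, C.trace_basis]
  have e5 : ∀ i, C.t a (b i) (b i) = C.t (b i) a (b i) := fun i => C.t_symm _ _ _
  have e6 : ∀ i e, C.t a (b e) (b i) = C.t (b e) a (b i) := fun i e => C.t_symm _ _ _
  rw [← map_sum]
  simp only [Finset.sum_add_distrib, Finset.sum_sub_distrib, e2, e3, e4, ← Finset.mul_sum, e5, e6,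
    C.sum_t_diag, map_add, map_sub, map_zero, mul_zero]
  rw [map_sum, Finset.sum_eq_zero fun i _ => h0 i]
  ring

end SphereCalculus

/-! ### Simons' identity -/

namespace SphereCalculus

variable {E : Type*} [NormedAddCommGroup E] [InnerProductSpace ℝ E]
    [FiniteDimensional ℝ E] {n : ℕ} {M A : Type*} [CommRing A] [Algebra ℝ A]
    (C : SphereCalculus E n M A) {ι : Type*} [Fintype ι] {b : OrthonormalBasis ι ℝ E}

/-- Unlike in `comm_tan`, a basis vector may be normal at `x`. Its tangential part then vanishes at
`x` but not to first order, and its derivative contributes the bracket on the right. These terms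
carry the curvature in what follows. -/
theorem comm_frame (x : M) (a : E) (ha : a ∈ C.T x) (i : ι) (φ : A) : C.ev x (C.D (b i) (C.D a φ)) = C.ev x (C.D a (C.D (b i) φ))
      + C.ev x (C.F (b i)) * C.ev x (C.D a φ)
      - ∑ d, C.ev x (C.t a (b d) (b i)) * C.ev x (C.D (b d) φ) := by
  have h := C.comm x (b i) a φ
    (C.ev x (C.F (b i)) • a - ∑ d, C.ev x (C.t a (b d) (b i)) • b d) fun d => by
      have h1 := C.sum_inner_mul_ev b x ((C.t a).flip (b i)) d
      simp only [LinearMap.flip_apply] at h1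
      rw [inner_sub_left, sum_inner, real_inner_smul_left]
      simp_rw [real_inner_smul_left, real_inner_comm d, mul_comm _ ⟪d, b _⟫]
      rw [h1]
      simp only [map_sub, C.D_p, map_add, map_mul, C.t_tan x a ha, C.F_tan x a ha,
        C.p_tan x a ha, C.p_symm (b i) a]
      rw [C.t_symm (b i) a, real_inner_comm d a]
      ring
  rw [eq_add_of_sub_eq h]
  rw [← C.grad_apply φ (_ - _)]
  simp only [map_sub, map_smul, map_sum, grad_apply, smul_eq_mul]
  ring

/-- In each product of `sum_D_t` one factor has `u` or `c` in a slot where it vanishes at `x`, so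
the Leibniz rule keeps only the derivative of that factor. -/
theorem ev_D_sum_D_t (x : M) (a u c : E) (hu : u ∈ C.T x)
    (hc : c ∈ (C.T x)ᗮ) (hc' : ⟪C.pt x, c⟫ = 0) :
    ∑ i, C.ev x (C.D a (C.D (b i) (C.t (b i) u c))) =
    - ∑ i, ∑ d, ∑ e, C.ev x (C.t a u (b e)) * C.ev x (C.t (b i) (b d) (b e)) *
        C.ev x (C.t (b i) (b d) c)
      - ∑ i, ∑ d, ∑ e, C.ev x (C.t a (b e) c) * C.ev x (C.t (b i) (b e) (b d)) *
        C.ev x (C.t (b i) u (b d)) := by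
  have hF : C.ev x (C.F c) = 0 := by rw [C.ev_F, hc']
  rw [← map_sum, ← map_sum, C.sum_D_t]
  simp only [map_sub, map_sum, Derivation.leibniz, smul_eq_mul, map_add, map_mul,
    C.t_tan x u hu, C.t_orth' x c hc, zero_mul, zero_add,
    fun i d => C.ev_D_t_tan b x a (b i) (b d) u hu,
    fun i d => C.ev_D_t_orth b x a (b i) c (b d) hc, hF, neg_zero]
  simp only [Finset.mul_sum, mul_neg, Finset.sum_neg_distrib]
  congr 1
  · congr 1
    refine Finset.sum_congr rfl fun i _ => Finset.sum_congr rfl fun d _ =>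
      Finset.sum_congr rfl fun e _ => by ring
  · refine Finset.sum_congr rfl fun i _ => Finset.sum_congr rfl fun d _ =>
      Finset.sum_congr rfl fun e _ => by ring

theorem ev_sum_D_D_t (x : M) (hb : C.Adapted b x) (a u c : E) (ha : a ∈ C.T x) (hu : u ∈ C.T x)
    (hc : c ∈ (C.T x)ᗮ) (hc' : ⟪C.pt x, c⟫ = 0) :
    ∑ i, C.ev x (C.D (b i) (C.D a (C.t (b i) u c))) =
    - ∑ i, ∑ d, ∑ e, C.ev x (C.t a u (b e)) * C.ev x (C.t (b i) (b d) (b e)) *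
        C.ev x (C.t (b i) (b d) c)
      - ∑ i, ∑ d, ∑ e, C.ev x (C.t a (b e) c) * C.ev x (C.t (b i) (b e) (b d)) *
        C.ev x (C.t (b i) u (b d))
      - C.ev x (C.t a u c)
      - ∑ i, ∑ d, ∑ e, C.ev x (C.t a (b d) (b i)) * C.ev x (C.t (b d) (b e) (b i)) *
        C.ev x (C.t (b e) u c) := by
  simp_rw [fun i => C.comm_frame (b := b) x a ha i (C.t (b i) u c), Finset.sum_sub_distrib,
    Finset.sum_add_distrib]
  rw [C.ev_D_sum_D_t x a u c hu hc hc']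
  have h1 : ∑ i, C.ev x (C.F (b i)) * C.ev x (C.D a (C.t (b i) u c)) = - C.ev x (C.t a u c) := by
    have h := congrArg (fun φ => C.ev x (C.D a φ)) (C.sum_F_mul_t b u c)
    have h' := congrArg (C.ev x) (C.sum_p_mul_t b a u c)
    simp only [map_sum, Derivation.leibniz, smul_eq_mul, map_add, map_mul, map_zero, C.D_F,
      Finset.sum_add_distrib] at h h'
    simp_rw [mul_comm (C.ev x (C.p a _))] at h'
    linarith
  have h2 : ∑ i, ∑ d, C.ev x (C.t a (b d) (b i)) * C.ev x (C.D (b d) (C.t (b i) u c)) =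
      ∑ i, ∑ d, ∑ e, C.ev x (C.t a (b d) (b i)) * C.ev x (C.t (b d) (b e) (b i)) *
        C.ev x (C.t (b e) u c) := by
    have h3 : ∀ i d, C.ev x (C.t a (b d) (b i)) * C.ev x (C.D (b d) (C.t (b i) u c)) =
        -(C.ev x (C.F (b i)) * C.ev x (C.t a (b d) (b i))) * C.ev x (C.t u (b d) c) +
        ∑ e, C.ev x (C.t a (b d) (b i)) * C.ev x (C.t (b d) (b e) (b i)) *
        C.ev x (C.t (b e) u c) := fun i d => by
      rcases hb.tan_or_orth i with h | h
      · simp [C.t_tan x _ h]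
      · rw [C.t_symm (b i) u, C.ev_D_t_orth b x _ _ _ _ h, mul_add, Finset.mul_sum]
        simp_rw [fun e => C.t_symm (b e) u c, mul_assoc]
        ring
    have h4 : ∑ i, ∑ d, -(C.ev x (C.F (b i)) * C.ev x (C.t a (b d) (b i))) *
        C.ev x (C.t u (b d) c) = 0 := by
      rw [Finset.sum_comm]
      refine Finset.sum_eq_zero fun d _ => ?_
      have := congrArg (C.ev x) (C.sum_F_mul_t_last b a (b d))
      simp only [map_sum, map_mul, map_zero] at this
      rw [← Finset.sum_mul, Finset.sum_neg_distrib, this]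
      simp
    simp_rw [h3, Finset.sum_add_distrib, h4, zero_add]
  rw [h1, h2]
  ring

/-- The Laplacian of `h`: Codazzi moves `a` to the front, and then `D a` is commuted past the frame
derivatives. The coefficient `n` of the linear term is `n + 1 - 1`, from the correction with `F (b
i)`, the correction with `F u`, and the commutator, respectively. -/
theorem ev_sum_D_gam (x : M) (hb : C.Adapted b x) (a u c : E) (ha : a ∈ C.T x) (hu : u ∈ C.T x)
    (hc : c ∈ (C.T x)ᗮ) (hc' : ⟪C.pt x, c⟫ = 0) :
    ∑ i, C.ev x (C.D (b i) (C.gam (b i) a u c)) = n * C.ev x (C.t a u c)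
    - ∑ i, ∑ d, ∑ e, C.ev x (C.t a u (b e)) * C.ev x (C.t (b i) (b d) (b e)) *
        C.ev x (C.t (b i) (b d) c)
      - ∑ i, ∑ d, ∑ e, C.ev x (C.t a (b e) c) * C.ev x (C.t (b i) (b e) (b d)) *
        C.ev x (C.t (b i) u (b d))
      - ∑ i, ∑ d, ∑ e, C.ev x (C.t a (b d) (b i)) * C.ev x (C.t (b d) (b e) (b i)) *
        C.ev x (C.t (b e) u c)
      + ∑ i, ∑ d, ∑ e, C.ev x (C.t (b i) u (b e)) * C.ev x (C.t a (b d) (b e)) *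
        C.ev x (C.t (b i) (b d) c)
      + ∑ i, ∑ d, ∑ e, C.ev x (C.t (b i) (b e) c) * C.ev x (C.t a (b e) (b d)) *
        C.ev x (C.t (b i) u (b d)) := by
  have hF : C.ev x (C.F c) = 0 := by rw [C.ev_F, hc']
  have e1 : C.ev x (∑ i, C.D (b i) (C.F (b i) * C.t a u c)) = n * C.ev x (C.t a u c) := by
    simp only [Derivation.leibniz, smul_eq_mul, C.D_F, Finset.sum_add_distrib, C.sum_F_mul_D,
      ← Finset.mul_sum, C.sum_p_diag, zero_add, map_mul]
    simp [mul_comm]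
  have e2 : C.ev x (∑ i, C.D (b i) (∑ d, C.t a (b d) (b i) * C.t (b d) u c)) = 0 := by
    simp only [map_sum, Derivation.leibniz, smul_eq_mul, map_add, map_mul]
    rw [Finset.sum_comm]
    refine Finset.sum_eq_zero fun d _ => ?_
    have := congrArg (C.ev x) (C.sum_t_mul_D b a (b d) (C.t (b d) u c))
    simp only [map_sum, map_mul, map_zero] at this
    rw [Finset.sum_add_distrib, this, ← Finset.mul_sum, C.sum_D_t_last x hb]
    simp
  have e3 : C.ev x (∑ i, C.D (b i) (C.F u * C.t (b i) a c)) = C.ev x (C.t a u c) := by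
    have := congrArg (C.ev x) (C.sum_p_mul_t b u a c)
    simp only [map_sum, map_mul, C.t_symm u a] at this
    simp only [map_sum, Derivation.leibniz, smul_eq_mul, map_add, map_mul, C.F_tan x u hu,
      C.D_F, zero_mul, zero_add, ← this]
    exact Finset.sum_congr rfl fun i _ => by rw [C.p_symm]; ring
  have e4 : C.ev x (∑ i, C.D (b i) (∑ d, C.t a (b d) u * C.t (b i) (b d) c)) =
      - ∑ i, ∑ d, ∑ e, C.ev x (C.t (b i) u (b e)) * C.ev x (C.t a (b d) (b e)) *
        C.ev x (C.t (b i) (b d) c) := by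
    simp only [map_sum, Derivation.leibniz, smul_eq_mul, map_add, map_mul, C.t_tan x u hu,
      zero_mul, zero_add, fun i d => C.ev_D_t_tan b x (b i) a (b d) u hu]
    simp only [Finset.mul_sum, mul_neg, Finset.sum_neg_distrib]
    congr 1
    exact Finset.sum_congr rfl fun i _ => Finset.sum_congr rfl fun d _ =>
      Finset.sum_congr rfl fun e _ => by ring
  have e5 : C.ev x (∑ i, C.D (b i) (∑ d, C.t a c (b d) * C.t (b i) u (b d))) =
      ∑ i, ∑ d, ∑ e, C.ev x (C.t (b i) (b e) c) * C.ev x (C.t a (b e) (b d)) *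
        C.ev x (C.t (b i) u (b d)) := by
    simp only [map_sum, Derivation.leibniz, smul_eq_mul, map_add, map_mul, C.t_orth' x c hc,
      zero_mul, zero_add, fun i d => C.ev_D_t_orth b x (b i) a c (b d) hc, hF, neg_zero]
    simp only [Finset.mul_sum]
    exact Finset.sum_congr rfl fun i _ => Finset.sum_congr rfl fun d _ =>
      Finset.sum_congr rfl fun e _ => by ring
  simp_rw [C.codazzi _ a, fun i => C.gam_eq b a (b i) u c]
  simp only [map_add, map_sub, Finset.sum_add_distrib, Finset.sum_sub_distrib]
  simp only [← map_sum (C.ev x)] at *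
  rw [e1, e2, e3, e4, e5]
  simp only [map_sum (C.ev x)]
  rw [C.ev_sum_D_D_t x hb a u c ha hu hc hc']
  ring

/-- Half the derivative of the constant `|h|²`. Each correction in `gam` drops out against `t`,
because it pairs a tangential slot with a normal one or with the position vector. -/
theorem sum_t_mul_gam {s : ℝ}
    (hs : ∑ i, ∑ j, ∑ k, C.t (b i) (b j) (b k) ^ 2 = algebraMap ℝ A s) (v : E) :
    ∑ i, ∑ j, ∑ k, C.t (b i) (b j) (b k) * C.gam v (b i) (b j) (b k) = 0 := by
  have h := congrArg (C.D v) hs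
  simp only [map_sum, Derivation.leibniz_pow, Derivation.map_algebraMap] at h
  have e1 : ∑ i, ∑ j, ∑ k, C.t (b i) (b j) (b k) * (C.F (b i) * C.t v (b j) (b k)) = 0 := by
    rw [Finset.sum_comm]
    refine Finset.sum_eq_zero fun j _ => ?_
    rw [Finset.sum_comm]
    refine Finset.sum_eq_zero fun k _ => ?_
    simp_rw [← mul_assoc, ← Finset.sum_mul, mul_comm (C.t (b _) (b j) (b k)), C.sum_F_mul_t,
      zero_mul]
  have e1' : ∑ i, ∑ j, ∑ k, C.t (b i) (b j) (b k) * (C.F (b j) * C.t (b i) v (b k)) = 0 := by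
    rw [Finset.sum_comm, ← e1]
    exact Finset.sum_congr rfl fun i _ => Finset.sum_congr rfl fun j _ =>
      Finset.sum_congr rfl fun k _ => by rw [C.t_symm (b i) (b j), C.t_symm v (b j)]
  have e2 : ∑ i, ∑ j, ∑ k, C.t (b i) (b j) (b k) *
      ∑ d, C.t v (b d) (b i) * C.t (b d) (b j) (b k) = 0 := by
    rw [Finset.sum_comm]
    refine Finset.sum_eq_zero fun j _ => ?_
    rw [Finset.sum_comm]
    refine Finset.sum_eq_zero fun k _ => ?_
    simp_rw [Finset.mul_sum]
    rw [Finset.sum_comm]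
    refine Finset.sum_eq_zero fun d _ => ?_
    have := C.sum_t_mul_t b v (b d) (b j) (b k)
    simp_rw [mul_left_comm (C.t (b _) (b j) (b k)), ← mul_assoc]
    rw [← Finset.sum_mul]
    simp_rw [mul_comm (C.t v _ _)] at this
    simp_rw [mul_comm (C.t v _ _), this, zero_mul]
  have e2' : ∑ i, ∑ j, ∑ k, C.t (b i) (b j) (b k) *
      ∑ d, C.t v (b d) (b j) * C.t (b i) (b d) (b k) = 0 := by
    rw [Finset.sum_comm, ← e2]
    refine Finset.sum_congr rfl fun i _ => Finset.sum_congr rfl fun j _ =>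
      Finset.sum_congr rfl fun k _ => ?_
    simp_rw [C.t_symm (b i) (b j), C.t_symm (b j) (b _)]
  have e3 : ∑ i, ∑ j, ∑ k, C.t (b i) (b j) (b k) *
      ∑ d, C.t v (b k) (b d) * C.t (b i) (b j) (b d) = 0 := by
    refine Finset.sum_eq_zero fun i _ => Finset.sum_eq_zero fun j _ => ?_
    simp_rw [Finset.mul_sum]
    rw [Finset.sum_comm]
    refine Finset.sum_eq_zero fun d _ => ?_
    have := C.sum_t_mul_t b (b i) (b j) v (b d)
    simp_rw [← mul_assoc, ← Finset.sum_mul, fun k => C.t_symm v (b k), this, zero_mul]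
  have h' : ∑ i, ∑ j, ∑ k, C.t (b i) (b j) (b k) * C.D v (C.t (b i) (b j) (b k)) = 0 := by
    have h2 : (2 : ℝ) • ∑ i, ∑ j, ∑ k, C.t (b i) (b j) (b k) * C.D v (C.t (b i) (b j) (b k)) = 0 := by
      rw [← h]
      simp only [Finset.smul_sum]
      refine Finset.sum_congr rfl fun i _ => Finset.sum_congr rfl fun j _ =>
        Finset.sum_congr rfl fun k _ => ?_
      simp [two_smul]
    exact (smul_eq_zero_iff_right (two_ne_zero)).1 h2
  simp_rw [C.gam_eq b, mul_add, mul_sub, mul_add, mul_sub, mul_add, Finset.sum_add_distrib,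
    Finset.sum_sub_distrib, Finset.sum_add_distrib, Finset.sum_sub_distrib, Finset.sum_add_distrib,
    h', e1, e1', e2, e2', e3]
  ring

/-- **Simons' identity** for a minimal submanifold with second fundamental form of constant
length. -/
theorem simons (x : M) (hb : C.Adapted b x) {s : ℝ}
    (hs : ∑ i, ∑ j, ∑ k, C.t (b i) (b j) (b k) ^ 2 = algebraMap ℝ A s)
    (τ : ι → ι → ι → ℝ) (hτ : ∀ i j k, τ i j k = C.ev x (C.t (b i) (b j) (b k))) :
    ∑ v, ∑ i, ∑ j, ∑ k, C.ev x (C.gam (b v) (b i) (b j) (b k)) ^ 2 + n * s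
      - ∑ a, ∑ u, ∑ c, ∑ i, ∑ d, ∑ e, τ a u c * (τ a u e * τ i d e * τ i d c)
      - ∑ a, ∑ u, ∑ c, ∑ i, ∑ d, ∑ e, τ a u c * (τ a e c * τ i e d * τ i u d)
      - ∑ a, ∑ u, ∑ c, ∑ i, ∑ d, ∑ e, τ a u c * (τ a d i * τ d e i * τ e u c)
      + ∑ a, ∑ u, ∑ c, ∑ i, ∑ d, ∑ e, τ a u c * (τ i u e * τ a d e * τ i d c)
      + ∑ a, ∑ u, ∑ c, ∑ i, ∑ d, ∑ e, τ a u c * (τ i e c * τ a e d * τ i u d) = 0 := by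
  have hs' : ∑ i, ∑ j, ∑ k, τ i j k * (n * τ i j k) = n * s := by
    have := congrArg (C.ev x) hs
    simp only [map_sum, map_pow, AlgHom.commutes, Algebra.algebraMap_self, RingHom.id_apply] at this
    rw [← this]
    simp only [Finset.mul_sum, hτ]
    exact Finset.sum_congr rfl fun i _ => Finset.sum_congr rfl fun j _ =>
      Finset.sum_congr rfl fun k _ => by ring
  -- The divergence of `sum_t_mul_gam`. The Leibniz rule splits it into `|∇h|²` and the product of
  -- `h` with its Laplacian.
  have h0 : ∑ v, C.ev x (C.D (b v)
      (∑ i, ∑ j, ∑ k, C.t (b i) (b j) (b k) * C.gam (b v) (b i) (b j) (b k))) = 0 := by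
    simp [C.sum_t_mul_gam hs]
  simp only [map_sum, Derivation.leibniz, smul_eq_mul, map_add, map_mul,
    Finset.sum_add_distrib] at h0
  -- In an adapted basis only triples of type tangent, tangent, normal contribute, and on these the
  -- preceding pointwise formulas apply.
  have trich : ∀ i j k, (b i ∈ C.T x ∧ b j ∈ C.T x ∧ b k ∈ (C.T x)ᗮ ∧ ⟪C.pt x, b k⟫ = 0) ∨
      (τ i j k = 0 ∧ ∀ v, C.ev x (C.gam v (b i) (b j) (b k)) = 0) := by
    intro i j k
    simp only [hτ]
    rcases hb.tan_or_orth i with h | h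
    · rcases hb.tan_or_orth j with h' | h'
      · rcases hb k with h'' | h'' | h''
        · exact .inr ⟨C.t_tan x _ h'' _ _, fun v => C.gam_tan x _ _ _ _ h''⟩
        · rw [h'']
          exact .inr ⟨C.t_pt x _ _, fun v => C.gam_pt x _ _ _⟩
        · exact .inl ⟨h, h', h''⟩
      · exact .inr ⟨C.t_orth' x _ h' _ _, fun v => C.gam_orth₃ x _ _ _ h' _⟩
    · exact .inr ⟨C.t_orth x _ h _ _, fun v => C.gam_orth₂ x _ _ h _ _⟩
  have A1 : ∑ v, ∑ i, ∑ j, ∑ k, C.ev x (C.gam (b v) (b i) (b j) (b k)) *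
      C.ev x (C.D (b v) (C.t (b i) (b j) (b k))) =
      ∑ v, ∑ i, ∑ j, ∑ k, C.ev x (C.gam (b v) (b i) (b j) (b k)) ^ 2 := by
    refine Finset.sum_congr rfl fun v _ => Finset.sum_congr rfl fun i _ =>
      Finset.sum_congr rfl fun j _ => Finset.sum_congr rfl fun k _ => ?_
    rcases trich i j k with ⟨hi, hj, hk, -⟩ | ⟨-, h⟩
    · rw [C.ev_D_t_normal x _ _ _ _ hi hj hk, sq]
    · simp [h]
  have A2 : ∑ v, ∑ i, ∑ j, ∑ k, C.ev x (C.t (b i) (b j) (b k)) *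
      C.ev x (C.D (b v) (C.gam (b v) (b i) (b j) (b k))) =
      ∑ a, ∑ u, ∑ c, τ a u c * (n * τ a u c
        - ∑ i, ∑ d, ∑ e, τ a u e * τ i d e * τ i d c - ∑ i, ∑ d, ∑ e, τ a e c * τ i e d * τ i u d
        - ∑ i, ∑ d, ∑ e, τ a d i * τ d e i * τ e u c + ∑ i, ∑ d, ∑ e, τ i u e * τ a d e * τ i d c
        + ∑ i, ∑ d, ∑ e, τ i e c * τ a e d * τ i u d) := by
    rw [Finset.sum_comm]
    refine Finset.sum_congr rfl fun a _ => ?_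
    rw [Finset.sum_comm]
    refine Finset.sum_congr rfl fun u _ => ?_
    rw [Finset.sum_comm]
    refine Finset.sum_congr rfl fun c _ => ?_
    rw [← Finset.mul_sum, ← hτ]
    rcases trich a u c with ⟨hi, hj, hk, hk'⟩ | ⟨h, -⟩
    · rw [C.ev_sum_D_gam x hb _ _ _ hi hj hk hk']
      simp only [hτ]
    · rw [h, zero_mul, zero_mul]
  rw [A1, A2] at h0
  simp only [mul_add, mul_sub, Finset.sum_add_distrib, Finset.sum_sub_distrib, hs',
    Finset.mul_sum] at h0
  linarith

end SphereCalculus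

/-! ### Commutators of symmetric matrices -/

section Commutators

variable {ι : Type*} [Fintype ι]

/-- The squared Frobenius norm. -/
def normSq (A : Matrix ι ι ℝ) : ℝ := ∑ i, ∑ j, A i j ^ 2

theorem normSq_nonneg (A : Matrix ι ι ℝ) : 0 ≤ normSq A :=
  Finset.sum_nonneg fun _ _ => Finset.sum_nonneg fun _ _ => sq_nonneg _

theorem normSq_sub_comm (A B : Matrix ι ι ℝ) : normSq (A - B) = normSq (B - A) := by
  simp only [normSq, Matrix.sub_apply]
  exact Finset.sum_congr rfl fun i _ => Finset.sum_congr rfl fun j _ => sub_sq_comm _ _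

theorem normSq_eq_zero {A : Matrix ι ι ℝ} (h : normSq A = 0) : A = 0 := by
  ext i j
  have h1 := (Finset.sum_eq_zero_iff_of_nonneg
    (fun i _ => Finset.sum_nonneg fun j _ => sq_nonneg (A i j))).1 h i (Finset.mem_univ i)
  have h2 := (Finset.sum_eq_zero_iff_of_nonneg (fun j _ => sq_nonneg (A i j))).1 h1 j
    (Finset.mem_univ j)
  simpa using h2

theorem normSq_eq_trace (A : Matrix ι ι ℝ) : normSq A = (A.transpose * A).trace := by
  simp only [normSq, Matrix.trace, Matrix.diag, Matrix.mul_apply, Matrix.transpose_apply, ← sq]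
  exact Finset.sum_comm

/-- By Cauchy–Schwarz for `∑ y`, the right side minus the left is at least `(x + ∑ y)²`. -/
theorem star_ineq {κ : Type*} (J : Finset κ) (x : ℝ) (y : κ → ℝ) :
    ∑ l ∈ J, (x - y l) ^ 2 ≤ (J.card + 1) * (x ^ 2 + ∑ l ∈ J, y l ^ 2) := by
  have h := sq_sum_le_card_mul_sum_sq (s := J) (f := y)
  have e : ∑ l ∈ J, (x - y l) ^ 2 = J.card * x ^ 2 - 2 * x * ∑ l ∈ J, y l + ∑ l ∈ J, y l ^ 2 := by
    simp_rw [sub_sq, Finset.sum_add_distrib, Finset.sum_sub_distrib, ← Finset.mul_sum]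
    simp
  rw [e]
  nlinarith [sq_nonneg (x + ∑ l ∈ J, y l)]

theorem sum_sq_pair_le (l : ι → ℝ) (s : Finset ι) : ∑ i ∈ s, l i ^ 2 ≤ ∑ i, l i ^ 2 :=
  Finset.sum_le_sum_of_subset_of_nonneg (Finset.subset_univ s) fun _ _ _ => sq_nonneg _

theorem sum_star_le (l : ι → ℝ) (i : ι) (J : Finset ι) (hi : i ∉ J) :
    ∑ j ∈ J, ((l i - l j) ^ 2 - ∑ k, l k ^ 2) ≤ ∑ k, l k ^ 2 := by
  have h1 := star_ineq J (l i) l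
  classical
  have h2 := sum_sq_pair_le l (insert i J)
  rw [Finset.sum_insert hi] at h2
  rw [Finset.sum_sub_distrib, Finset.sum_const, nsmul_eq_mul]
  have : (0 : ℝ) ≤ J.card := Nat.cast_nonneg _
  nlinarith

/-- The differences of a family of numbers that exceed the length of the family form a star. -/
theorem gap_star [Nonempty ι] (l : ι → ℝ) (P : ι → ι → Prop)
    (hP : ∀ i j, P i j ↔ l j < l i ∧ ∑ k, l k ^ 2 < (l i - l j) ^ 2) :
    (∀ i j, P i j → 0 < l i ∧ l j < 0) ∧
    ((∃ i, ∀ k j, P k j → k = i) ∨ (∃ j, ∀ i k, P i k → k = j)) := by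
  classical
  -- If both numbers had the same sign, their squared difference would be at most the larger of the
  -- two squares.
  have hs : ∀ i j, P i j → 0 < l i ∧ l j < 0 := by
    intro i j h
    obtain ⟨h1, h2⟩ := (hP i j).1 h
    have hi := sum_sq_pair_le l {i}
    have hj := sum_sq_pair_le l {j}
    simp only [Finset.sum_singleton] at hi hj
    constructor
    · by_contra! h3
      nlinarith
    · by_contra! h3
      nlinarith
  -- Two disjoint pairs are impossible: the two squared differences add up to at most twice the sum
  -- of the four squares. By the signs, a shared index must play the same role in both pairs.
  have hd : ∀ i j k m, P i j → P k m → i = k ∨ j = m := by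
    intro i j k m h h'
    by_contra! hne
    obtain ⟨hik, hjm⟩ := hne
    have hij : i ≠ j := by rintro rfl; linarith [(hs _ _ h).1, (hs _ _ h).2]
    have him : i ≠ m := by rintro rfl; linarith [(hs _ _ h).1, (hs _ _ h').2]
    have hkj : k ≠ j := by rintro rfl; linarith [(hs _ _ h').1, (hs _ _ h).2]
    have hkm : k ≠ m := by rintro rfl; linarith [(hs _ _ h').1, (hs _ _ h').2]
    have h4 := sum_sq_pair_le l {i, j, k, m}
    rw [Finset.sum_insert (by simp [hij, hik, him]), Finset.sum_insert (by simp [hkj.symm, hjm]),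
      Finset.sum_pair hkm] at h4
    have h5 := ((hP i j).1 h).2
    have h6 := ((hP k m).1 h').2
    nlinarith [sq_nonneg (l i + l j), sq_nonneg (l k + l m)]
  refine ⟨hs, ?_⟩
  by_cases hne : ∃ i j, P i j
  · obtain ⟨i, j, h⟩ := hne
    by_cases hall : ∀ k m, P k m → k = i
    · exact .inl ⟨i, hall⟩
    · push Not at hall
      obtain ⟨k, m, hkm, hki⟩ := hall
      have hmj : j = m := (hd i j k m h hkm).resolve_left (Ne.symm hki)
      subst hmj
      refine .inr ⟨j, fun k' m' h' => ?_⟩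
      by_contra hne
      have e1 := (hd _ _ _ _ h h').resolve_right (Ne.symm hne)
      have e2 := (hd _ _ _ _ hkm h').resolve_right (Ne.symm hne)
      exact hki (e2.trans e1.symm)
  · push Not at hne
    exact .inl ⟨Classical.arbitrary ι, fun k j h => absurd h (hne k j)⟩

/-- Only pairs whose squared difference exceeds the squared length of `l` count. Oriented by sign
they form a star, whose total excess is at most one squared length; each pair occurs in both orders.
-/
theorem sum_gap_le (l : ι → ℝ) :
    ∑ i, ∑ j, max ((l i - l j) ^ 2 - ∑ k, l k ^ 2) 0 ≤ 2 * ∑ k, l k ^ 2 := by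
  classical
  rcases isEmpty_or_nonempty ι with hι | hι
  · simp
  set a := ∑ k, l k ^ 2 with ha
  have ha0 : 0 ≤ a := Finset.sum_nonneg fun _ _ => sq_nonneg _
  set P : ι → ι → Prop := fun i j => l j < l i ∧ a < (l i - l j) ^ 2 with hP
  obtain ⟨hs, hstar⟩ := gap_star l P (fun i j => Iff.rfl)
  set g : ι → ι → ℝ := fun i j => if P i j then (l i - l j) ^ 2 - a else 0 with hg
  have hmax : ∀ i j, max ((l i - l j) ^ 2 - a) 0 = g i j + g j i := by
    intro i j
    have e : (l j - l i) ^ 2 = (l i - l j) ^ 2 := by ring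
    by_cases h : a < (l i - l j) ^ 2
    · rw [max_eq_left (by linarith)]
      rcases lt_trichotomy (l i) (l j) with h1 | h1 | h1
      · simp [hg, hP, h1, h1.le, e, h]
      · rw [h1] at h
        nlinarith
      · simp [hg, hP, h1, h1.le, h]
    · rw [max_eq_right (by linarith)]
      simp [hg, hP, e, h]
  have hg1 : ∑ i, ∑ j, g i j ≤ a := by
    rcases hstar with ⟨i, hi⟩ | ⟨j, hj⟩
    · rw [Finset.sum_eq_single i]
      · rw [← Finset.sum_filter]
        exact sum_star_le l i _ (by simp [hP])
      · intro k _ hk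
        exact Finset.sum_eq_zero fun j _ => if_neg fun h => hk (hi _ _ h)
      · simp
    · rw [Finset.sum_comm, Finset.sum_eq_single j]
      · rw [← Finset.sum_filter]
        refine le_trans (le_of_eq ?_) (sum_star_le l j {k | P k j} (by simp [hP]))
        exact Finset.sum_congr rfl fun k _ => by ring
      · intro k _ hk
        exact Finset.sum_eq_zero fun i _ => if_neg fun h => hk (hj _ _ h)
      · simp
  simp_rw [hmax, Finset.sum_add_distrib]
  rw [Finset.sum_comm (f := fun i j => g j i)]
  linarith

/-- Take the combination `Y = ∑ X k i j • X k` and let `w` be the sum of the `X k i j ^ 2`. By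
symmetry `w` stands at both `(i, j)` and `(j, i)` in `Y`, so `2 w² ≤ |Y|²`; by orthogonality `|Y|² ≤
w m`. -/
theorem two_mul_sum_entry_sq_le {κ : Type*} (s : Finset κ) (X : κ → Matrix ι ι ℝ) {m : ℝ}
    (hsymm : ∀ k ∈ s, (X k).IsSymm)
    (horth : ∀ k ∈ s, ∀ k' ∈ s, k ≠ k' → ∑ i, ∑ j, X k i j * X k' i j = 0)
    (hm : ∀ k ∈ s, normSq (X k) ≤ m) {i j : ι} (hij : i ≠ j) :
    2 * ∑ k ∈ s, X k i j ^ 2 ≤ m ∨ ∑ k ∈ s, X k i j ^ 2 = 0 := by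
  classical
  set w := ∑ k ∈ s, X k i j ^ 2 with hw
  have hw0 : 0 ≤ w := Finset.sum_nonneg fun _ _ => sq_nonneg _
  set Y : ι → ι → ℝ := fun p q => ∑ k ∈ s, X k i j * X k p q with hY
  have hYij : Y i j = w := Finset.sum_congr rfl fun k _ => by ring
  have hYji : Y j i = w := Finset.sum_congr rfl fun k hk => by rw [(hsymm k hk).apply]; ring
  have hYn : ∑ p, ∑ q, Y p q ^ 2 = ∑ k ∈ s, X k i j ^ 2 * normSq (X k) := by
    have e1 : ∑ p, ∑ q, Y p q ^ 2 = ∑ k ∈ s, ∑ k' ∈ s,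
        X k i j * X k' i j * ∑ p, ∑ q, X k p q * X k' p q := by
      simp_rw [hY, sq, Finset.sum_mul_sum, Finset.mul_sum]
      calc _ = ∑ p, ∑ k ∈ s, ∑ q, ∑ k' ∈ s, X k i j * X k p q * (X k' i j * X k' p q) :=
            Finset.sum_congr rfl fun p _ => Finset.sum_comm
        _ = ∑ k ∈ s, ∑ p, ∑ q, ∑ k' ∈ s, X k i j * X k p q * (X k' i j * X k' p q) :=
            Finset.sum_comm
        _ = ∑ k ∈ s, ∑ p, ∑ k' ∈ s, ∑ q, X k i j * X k p q * (X k' i j * X k' p q) :=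
            Finset.sum_congr rfl fun k _ => Finset.sum_congr rfl fun p _ => Finset.sum_comm
        _ = ∑ k ∈ s, ∑ k' ∈ s, ∑ p, ∑ q, X k i j * X k p q * (X k' i j * X k' p q) :=
            Finset.sum_congr rfl fun k _ => Finset.sum_comm
        _ = _ := by
            refine Finset.sum_congr rfl fun k _ => Finset.sum_congr rfl fun k' _ =>
              Finset.sum_congr rfl fun p _ => Finset.sum_congr rfl fun q _ => by ring
    rw [e1]
    refine Finset.sum_congr rfl fun k hk => ?_
    rw [Finset.sum_eq_single k]
    · simp only [normSq, sq]
    · intro k' hk' hne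
      rw [horth k hk k' hk' hne.symm, mul_zero]
    · exact fun h => absurd hk h
  have h1 : Y i j ^ 2 + Y j i ^ 2 ≤ ∑ p, ∑ q, Y p q ^ 2 := by
    have hp : ∀ p q, Y p q ^ 2 ≤ ∑ q, Y p q ^ 2 := fun p q =>
      Finset.single_le_sum (f := fun q => Y p q ^ 2) (fun _ _ => sq_nonneg _) (Finset.mem_univ q)
    calc _ ≤ ∑ q, Y i q ^ 2 + ∑ q, Y j q ^ 2 := add_le_add (hp _ _) (hp _ _)
      _ = ∑ p ∈ {i, j}, ∑ q, Y p q ^ 2 := by rw [Finset.sum_pair hij]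
      _ ≤ _ := Finset.sum_le_sum_of_subset_of_nonneg (Finset.subset_univ _)
          fun _ _ _ => Finset.sum_nonneg fun _ _ => sq_nonneg _
  have h2 : ∑ k ∈ s, X k i j ^ 2 * normSq (X k) ≤ w * m := by
    rw [hw, Finset.sum_mul]
    exact Finset.sum_le_sum fun k hk => mul_le_mul_of_nonneg_left (hm k hk) (sq_nonneg _)
  rw [hYn, hYij, hYji] at h1
  rcases hw0.eq_or_lt with h | h
  · exact .inr h.symm
  · left
    by_contra! h3
    nlinarith

/-- The commutators of a diagonal matrix with an orthogonal family of symmetric matrices. -/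
theorem sum_commutator_diagonal_le (l : ι → ℝ) {κ : Type*} (s : Finset κ) (X : κ → Matrix ι ι ℝ)
    {m : ℝ} (hm0 : 0 ≤ m) (hsymm : ∀ k ∈ s, (X k).IsSymm)
    (horth : ∀ k ∈ s, ∀ k' ∈ s, k ≠ k' → ∑ i, ∑ j, X k i j * X k' i j = 0)
    (hm : ∀ k ∈ s, normSq (X k) ≤ m) :
    ∑ k ∈ s, ∑ i, ∑ j, (l i - l j) ^ 2 * X k i j ^ 2 ≤
      (∑ k, l k ^ 2) * (∑ k ∈ s, normSq (X k) + m) := by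
  set a := ∑ k, l k ^ 2 with ha
  have ha0 : 0 ≤ a := Finset.sum_nonneg fun _ _ => sq_nonneg _
  set w : ι → ι → ℝ := fun i j => ∑ k ∈ s, X k i j ^ 2 with hw
  have hwm : ∀ i j, i ≠ j → w i j ≤ m / 2 := fun i j hij => by
    rcases two_mul_sum_entry_sq_le s X hsymm horth hm hij with h | h
    · change 2 * w i j ≤ m at h
      linarith
    · change w i j = 0 at h
      rw [h]
      positivity
  have hw0 : ∀ i j, 0 ≤ w i j := fun i j => Finset.sum_nonneg fun _ _ => sq_nonneg _
  have swap : ∀ f : ι → ι → ℝ, ∑ k ∈ s, ∑ i, ∑ j, f i j * X k i j ^ 2 =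
      ∑ i, ∑ j, f i j * w i j := by
    intro f
    rw [Finset.sum_comm]
    refine Finset.sum_congr rfl fun i _ => ?_
    rw [Finset.sum_comm]
    exact Finset.sum_congr rfl fun j _ => by rw [hw, Finset.mul_sum]
  have hN : ∑ k ∈ s, normSq (X k) = ∑ i, ∑ j, w i j := by
    have := swap fun _ _ => 1
    simpa [normSq] using this
  rw [swap, hN]
  -- Only the excess of `(l i - l j)²` over `a` meets the bound `w i j ≤ m / 2`; the part up to `a`
  -- is summed exactly. As the total excess is at most `2 a`, a single extra term `a * m` results.
  have h1 : ∀ i j, (l i - l j) ^ 2 * w i j ≤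
      a * w i j + max ((l i - l j) ^ 2 - a) 0 * (m / 2) := by
    intro i j
    rcases eq_or_ne i j with rfl | hij
    · have := mul_nonneg ha0 (hw0 i i)
      have : 0 ≤ max ((l i - l i) ^ 2 - a) 0 * (m / 2) :=
        mul_nonneg (le_max_right _ _) (by positivity)
      simp only [sub_self] at this ⊢
      norm_num at this ⊢
      linarith
    · have e1 : ((l i - l j) ^ 2 - a) * w i j ≤ max ((l i - l j) ^ 2 - a) 0 * w i j :=
        mul_le_mul_of_nonneg_right (le_max_left _ _) (hw0 i j)
      have e2 : max ((l i - l j) ^ 2 - a) 0 * w i j ≤ max ((l i - l j) ^ 2 - a) 0 * (m / 2) :=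
        mul_le_mul_of_nonneg_left (hwm i j hij) (le_max_right _ _)
      linarith
  calc _ ≤ ∑ i, ∑ j, (a * w i j + max ((l i - l j) ^ 2 - a) 0 * (m / 2)) :=
        Finset.sum_le_sum fun i _ => Finset.sum_le_sum fun j _ => h1 i j
    _ = a * ∑ i, ∑ j, w i j + (∑ i, ∑ j, max ((l i - l j) ^ 2 - a) 0) * (m / 2) := by
        simp_rw [Finset.sum_add_distrib, Finset.mul_sum, Finset.sum_mul]
    _ ≤ a * ∑ i, ∑ j, w i j + (2 * a) * (m / 2) := by
        gcongr
        exact sum_gap_le l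
    _ = _ := by ring

/-- With `a` the squared length of `l`, always `(l i - l j)² ≤ 2 a`, so equality holds at every
nonzero entry of `X`. One such entry `(p, q)` exhausts the length, hence `l` is supported on `{p,
q}`. A nonzero entry in another column would give `l i ^ 2 = 2 a > a`. -/
theorem commutator_diagonal_eq (l : ι → ℝ) (X : Matrix ι ι ℝ) (hX : X ≠ 0) (hl : l ≠ 0)
    (h : ∑ i, ∑ j, (l i - l j) ^ 2 * X i j ^ 2 = 2 * (∑ k, l k ^ 2) * normSq X) :
    ∃ p q, ∀ w : ι → ℝ, w p = 0 → w q = 0 → (∀ i, l i * w i = 0) ∧ ∀ i, ∑ j, X i j * w j = 0 := by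
  classical
  set a := ∑ k, l k ^ 2 with ha
  have ha0 : 0 < a := by
    obtain ⟨k, hk⟩ := Function.ne_iff.1 hl
    have := sum_sq_pair_le l {k}
    rw [Finset.sum_singleton] at this
    have : 0 < l k ^ 2 := by positivity [show l k ≠ 0 from hk]
    linarith
  have hpair : ∀ p q, p ≠ q → l p ^ 2 + l q ^ 2 ≤ a := fun p q hpq => by
    simpa [Finset.sum_pair hpq] using sum_sq_pair_le l {p, q}
  have hle : ∀ i j, 0 ≤ (2 * a - (l i - l j) ^ 2) * X i j ^ 2 := fun i j => by
    refine mul_nonneg ?_ (sq_nonneg _)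
    rcases eq_or_ne i j with rfl | hij
    · simp [ha0.le]
    · nlinarith [hpair i j hij, sq_nonneg (l i + l j)]
  have h0 : ∑ i, ∑ j, (2 * a - (l i - l j) ^ 2) * X i j ^ 2 = 0 := by
    simp_rw [sub_mul, Finset.sum_sub_distrib, h, ← Finset.mul_sum]
    simp [normSq]
  have hz : ∀ i j, X i j ≠ 0 → (l i - l j) ^ 2 = 2 * a := by
    intro i j hij
    have h1 := (Finset.sum_eq_zero_iff_of_nonneg
      (fun i _ => Finset.sum_nonneg fun j _ => hle i j)).1 h0 i (Finset.mem_univ i)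
    have h2 := (Finset.sum_eq_zero_iff_of_nonneg (fun j _ => hle i j)).1 h1 j (Finset.mem_univ j)
    have := (mul_eq_zero.1 h2).resolve_right (pow_ne_zero 2 hij)
    linarith
  obtain ⟨p, q, hpq⟩ : ∃ p q, X p q ≠ 0 := by
    by_contra! hne
    exact hX (Matrix.ext hne)
  have h2 := hz p q hpq
  have hne : p ≠ q := by
    rintro rfl
    simp at h2
    linarith
  have hl0 : ∀ k, k ≠ p → k ≠ q → l k = 0 := by
    intro k hkp hkq
    have h3 := sum_sq_pair_le l {k, p, q}
    rw [Finset.sum_insert (by simp [hkp, hkq]), Finset.sum_pair hne] at h3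
    nlinarith [sq_nonneg (l p + l q)]
  refine ⟨p, q, fun w hp hq => ⟨fun i => ?_, fun i => Finset.sum_eq_zero fun j _ => ?_⟩⟩
  · by_cases hip : i = p
    · rw [hip, hp, mul_zero]
    · by_cases hiq : i = q
      · rw [hiq, hq, mul_zero]
      · rw [hl0 i hip hiq, zero_mul]
  · by_cases hjp : j = p
    · rw [hjp, hp, mul_zero]
    · by_cases hjq : j = q
      · rw [hjq, hq, mul_zero]
      · by_cases hX0 : X i j = 0
        · rw [hX0, zero_mul]
        · have h4 := hz i j hX0
          have h5 := sum_sq_pair_le l {i}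
          rw [Finset.sum_singleton] at h5
          rw [hl0 j hjp hjq] at h4
          nlinarith

theorem exists_diagonalization [DecidableEq ι] (B : Matrix ι ι ℝ) (hB : B.IsSymm) :
    ∃ (U : Matrix ι ι ℝ) (l : ι → ℝ), U.transpose * U = 1 ∧ U * U.transpose = 1 ∧
      U.transpose * B * U = Matrix.diagonal l := by
  have hH : B.IsHermitian := by
    rw [Matrix.IsHermitian, Matrix.conjTranspose_eq_transpose_of_trivial]
    exact hB
  have hU := hH.eigenvectorUnitary.2
  have e : star (hH.eigenvectorUnitary : Matrix ι ι ℝ) =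
      (hH.eigenvectorUnitary : Matrix ι ι ℝ).transpose := by
    rw [Matrix.star_eq_conjTranspose, Matrix.conjTranspose_eq_transpose_of_trivial]
  refine ⟨hH.eigenvectorUnitary, hH.eigenvalues, ?_, ?_, ?_⟩
  · rw [← e]; exact Unitary.star_mul_self_of_mem hU
  · rw [← e]; exact Unitary.mul_star_self_of_mem hU
  · have h1 := hH.conjStarAlgAut_star_eigenvectorUnitary
    rw [Unitary.conjStarAlgAut_star_apply, e] at h1
    rw [h1]
    rfl

section Conj

variable [DecidableEq ι] {U : Matrix ι ι ℝ}

theorem normSq_conj (hU : U * U.transpose = 1) (B : Matrix ι ι ℝ) :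
    normSq (U.transpose * B * U) = normSq B := by
  rw [normSq_eq_trace, normSq_eq_trace]
  simp only [Matrix.transpose_mul, Matrix.transpose_transpose]
  calc _ = (U.transpose * (B.transpose * (U * U.transpose) * B * U)).trace := by
        simp only [Matrix.mul_assoc]
    _ = (B.transpose * B * (U * U.transpose)).trace := by
        rw [hU, Matrix.trace_mul_comm, Matrix.mul_one]
        simp only [Matrix.mul_assoc, hU, Matrix.mul_one]
    _ = _ := by rw [hU, Matrix.mul_one]

theorem sum_mul_conj (hU : U * U.transpose = 1) (B B' : Matrix ι ι ℝ) :
    ∑ i, ∑ j, (U.transpose * B * U) i j * (U.transpose * B' * U) i j =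
      ∑ i, ∑ j, B i j * B' i j := by
  have h := normSq_conj hU (B + B')
  have h1 := normSq_conj hU B
  have h2 := normSq_conj hU B'
  rw [Matrix.mul_add, Matrix.add_mul] at h
  simp only [normSq, Matrix.add_apply, add_sq, Finset.sum_add_distrib, mul_assoc,
    ← Finset.mul_sum] at h h1 h2
  simp only [mul_assoc]
  linarith

theorem conj_commutator (hU : U * U.transpose = 1) (B X : Matrix ι ι ℝ) :
    U.transpose * (B * X - X * B) * U = (U.transpose * B * U) * (U.transpose * X * U) -
      (U.transpose * X * U) * (U.transpose * B * U) := by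
  have h : ∀ B X : Matrix ι ι ℝ, (U.transpose * B * U) * (U.transpose * X * U) =
      U.transpose * (B * X) * U := fun B X => by
    calc _ = U.transpose * B * (U * U.transpose) * X * U := by simp only [Matrix.mul_assoc]
      _ = _ := by rw [hU, Matrix.mul_one]; simp only [Matrix.mul_assoc]
  rw [h, h, Matrix.mul_sub, Matrix.sub_mul]

theorem normSq_commutator_diagonal (l : ι → ℝ) (X : Matrix ι ι ℝ) :
    normSq (Matrix.diagonal l * X - X * Matrix.diagonal l) =
      ∑ i, ∑ j, (l i - l j) ^ 2 * X i j ^ 2 := by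
  refine Finset.sum_congr rfl fun i _ => Finset.sum_congr rfl fun j _ => ?_
  rw [Matrix.sub_apply, Matrix.diagonal_mul, Matrix.mul_diagonal]
  ring

theorem normSq_diagonal (l : ι → ℝ) : normSq (Matrix.diagonal l) = ∑ k, l k ^ 2 := by
  refine Finset.sum_congr rfl fun i _ => ?_
  rw [Finset.sum_eq_single i] <;> simp +contextual [eq_comm]

theorem isSymm_conj {ι : Type*} [Fintype ι] {U B : Matrix ι ι ℝ}
    (hB : B.IsSymm) : (U.transpose * B * U).IsSymm := by
  simp only [Matrix.IsSymm, Matrix.transpose_mul, Matrix.transpose_transpose, hB.eq,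
    Matrix.mul_assoc]

end Conj

variable [DecidableEq ι]

/-- Orthogonal conjugation diagonalizes `B` and preserves every quantity involved. Estimating the
family jointly costs only one extra `m`, whereas the bound `2 |B|² |X|²` for each commutator alone
would double the whole sum. -/
theorem sum_commutator_le (B : Matrix ι ι ℝ) (hB : B.IsSymm) {κ : Type*} (s : Finset κ)
    (X : κ → Matrix ι ι ℝ) {m : ℝ} (hm0 : 0 ≤ m) (hsymm : ∀ k ∈ s, (X k).IsSymm)
    (horth : ∀ k ∈ s, ∀ k' ∈ s, k ≠ k' → ∑ i, ∑ j, X k i j * X k' i j = 0)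
    (hm : ∀ k ∈ s, normSq (X k) ≤ m) :
    ∑ k ∈ s, normSq (B * X k - X k * B) ≤ normSq B * (∑ k ∈ s, normSq (X k) + m) := by
  obtain ⟨U, l, -, hU, hl⟩ := exists_diagonalization B hB
  have h := sum_commutator_diagonal_le l s (fun k => U.transpose * X k * U) hm0
    (fun k hk => isSymm_conj (hsymm k hk))
    (fun k hk k' hk' hne => by rw [sum_mul_conj hU, horth k hk k' hk' hne])
    (fun k hk => by rw [normSq_conj hU]; exact hm k hk)
  simp_rw [normSq_conj hU, ← normSq_diagonal, ← hl, normSq_conj hU,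
    ← normSq_commutator_diagonal, ← hl, ← conj_commutator hU, normSq_conj hU] at h
  exact h

/-- The columns `p` and `q` of the diagonalizing matrix serve as `u` and `u'`. What matters later is
that the common kernel has codimension at most two. -/
theorem commutator_eq (B X : Matrix ι ι ℝ) (hB : B.IsSymm) (hB0 : B ≠ 0) (hX : X ≠ 0)
    (h : normSq (B * X - X * B) = 2 * normSq B * normSq X) :
    ∃ u u' : ι → ℝ, ∀ w : ι → ℝ, u ⬝ᵥ w = 0 → u' ⬝ᵥ w = 0 → B.mulVec w = 0 ∧ X.mulVec w = 0 := by
  obtain ⟨U, l, hU', hU, hl⟩ := exists_diagonalization B hB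
  have back : ∀ Y : Matrix ι ι ℝ, Y = U * (U.transpose * Y * U) * U.transpose := fun Y => by
    calc Y = (U * U.transpose) * Y * (U * U.transpose) := by rw [hU]; simp
      _ = _ := by simp only [Matrix.mul_assoc]
  have h1 : l ≠ 0 := by
    rintro rfl
    apply hB0
    rw [back B, hl]
    simp
  have h2 : U.transpose * X * U ≠ 0 := by
    intro h0
    apply hX
    rw [back X, h0]
    simp
  obtain ⟨p, q, hpq⟩ := commutator_diagonal_eq l _ h2 h1 (by
    rw [← normSq_commutator_diagonal, ← hl, ← conj_commutator hU, normSq_conj hU, h,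
      ← normSq_diagonal, ← hl, normSq_conj hU, normSq_conj hU])
  refine ⟨fun i => U i p, fun i => U i q, fun w hp hq => ?_⟩
  obtain ⟨e1, e2⟩ := hpq (U.transpose.mulVec w) hp hq
  have e1' : (Matrix.diagonal l).mulVec (U.transpose.mulVec w) = 0 := by
    ext i
    rw [Matrix.mulVec_diagonal]
    exact e1 i
  have e2' : (U.transpose * X * U).mulVec (U.transpose.mulVec w) = 0 := by
    ext i
    exact e2 i
  constructor
  · rw [back B, hl, ← Matrix.mulVec_mulVec, ← Matrix.mulVec_mulVec, e1', Matrix.mulVec_zero]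
  · rw [back X, ← Matrix.mulVec_mulVec, ← Matrix.mulVec_mulVec, e2', Matrix.mulVec_zero]

theorem sum_sum_eq_diag_add (g : ℕ → ℕ → ℝ) (hg : ∀ j k, g j k = g k j) (q : ℕ) :
    ∑ j ∈ Finset.range q, ∑ k ∈ Finset.range q, g j k =
      ∑ j ∈ Finset.range q, g j j + 2 * ∑ j ∈ Finset.range q, ∑ k ∈ Finset.Ico (j + 1) q, g j k := by
  induction q with
  | zero => simp
  | succ q ih =>
    have h1 : ∑ j ∈ Finset.range (q + 1), ∑ k ∈ Finset.Ico (j + 1) (q + 1), g j k =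
        ∑ j ∈ Finset.range q, ∑ k ∈ Finset.Ico (j + 1) q, g j k + ∑ j ∈ Finset.range q, g j q := by
      rw [Finset.sum_range_succ]
      simp only [Finset.Ico_self, Finset.sum_empty, add_zero]
      rw [← Finset.sum_add_distrib]
      refine Finset.sum_congr rfl fun j hj => ?_
      rw [Finset.sum_Ico_succ_top (by simpa using hj)]
    rw [h1, Finset.sum_range_succ, Finset.sum_range_succ (fun j => g j j)]
    simp_rw [Finset.sum_range_succ]
    rw [Finset.sum_add_distrib, ih]
    simp_rw [hg q]
    ring

/-- Each `X j` is compared with the later matrices only, whose largest norm is that of `X (j + 1)`.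
The products `a j * a k` and the squares on the left make up `s²`, and the extra terms satisfy `∑ a
j * a (j + 1) ≤ a 1 * (s - a 1)` because `a` decreases. -/
theorem liLi_aux (X : ℕ → Matrix ι ι ℝ) (r : ℕ) (hq : ∀ k, r + 2 ≤ k → X k = 0)
    (hsymm : ∀ k, (X k).IsSymm)
    (horth : ∀ k k', k ≠ k' → ∑ i, ∑ j, X k i j * X k' i j = 0)
    (hanti : Antitone fun k => normSq (X k)) {s : ℝ}
    (hs : ∑ k ∈ Finset.range (r + 2), normSq (X k) = s) :
    ∑ j ∈ Finset.range (r + 2), ∑ k ∈ Finset.range (r + 2), normSq (X j * X k - X k * X j) +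
      ∑ k ∈ Finset.range (r + 2), normSq (X k) ^ 2 ≤ s ^ 2 +
        2 * (normSq (X 1) * (s - normSq (X 1))) := by
  set a : ℕ → ℝ := fun k => normSq (X k) with ha
  have ha0 : ∀ k, 0 ≤ a k := fun k => normSq_nonneg _
  have hS : s ^ 2 = ∑ k ∈ Finset.range (r + 2), a k ^ 2 +
      2 * ∑ j ∈ Finset.range (r + 2), ∑ k ∈ Finset.Ico (j + 1) (r + 2), a j * a k := by
    rw [← hs, sq, Finset.sum_mul_sum, sum_sum_eq_diag_add _ (fun j k => mul_comm _ _)]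
    simp only [sq, ha]
  have hC : ∑ j ∈ Finset.range (r + 2), ∑ k ∈ Finset.range (r + 2),
      normSq (X j * X k - X k * X j) = 2 * ∑ j ∈ Finset.range (r + 2),
        ∑ k ∈ Finset.Ico (j + 1) (r + 2), normSq (X j * X k - X k * X j) := by
    rw [sum_sum_eq_diag_add]
    · simp [normSq]
    · intro j k
      exact normSq_sub_comm _ _
  have hL : ∀ j, ∑ k ∈ Finset.Ico (j + 1) (r + 2), normSq (X j * X k - X k * X j) ≤
      ∑ k ∈ Finset.Ico (j + 1) (r + 2), a j * a k + a j * a (j + 1) := fun j => by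
    rw [← Finset.mul_sum, ← mul_add]
    exact sum_commutator_le (X j) (hsymm j) _ X (ha0 _) (fun k _ => hsymm k)
      (fun k _ k' _ h => horth k k' h) (fun k hk => hanti (Finset.mem_Ico.1 hk).1)
  have hP : ∑ j ∈ Finset.range (r + 2), a j * a (j + 1) ≤ a 1 * (s - a 1) := by
    have hlast : a (r + 2) = 0 := by simp [ha, hq (r + 2) le_rfl, normSq]
    rw [← hs, Finset.sum_range_succ, hlast, Finset.sum_range_succ', Finset.sum_range_succ',
      Finset.sum_range_succ']
    have : ∑ k ∈ Finset.range r, a (k + 1) * a (k + 1 + 1) ≤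
        a 1 * ∑ k ∈ Finset.range r, a (k + 1 + 1) := by
      rw [Finset.mul_sum]
      exact Finset.sum_le_sum fun k _ => mul_le_mul_of_nonneg_right (hanti (by omega)) (ha0 _)
    simp only [zero_add]
    linarith
  have := Finset.sum_le_sum fun j (_ : j ∈ Finset.range (r + 2)) => hL j
  rw [Finset.sum_add_distrib] at this
  rw [hC, hS]
  linarith

/-- The inequality of Li and Li, with the case of equality. -/
theorem liLi (X : ℕ → Matrix ι ι ℝ) (q : ℕ) (hq : ∀ k, q ≤ k → X k = 0)
    (hsymm : ∀ k, (X k).IsSymm)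
    (horth : ∀ k k', k ≠ k' → ∑ i, ∑ j, X k i j * X k' i j = 0)
    (hanti : Antitone fun k => normSq (X k)) {s : ℝ}
    (hs : ∑ k ∈ Finset.range q, normSq (X k) = s) :
    ∑ j ∈ Finset.range q, ∑ k ∈ Finset.range q, normSq (X j * X k - X k * X j) +
      ∑ k ∈ Finset.range q, normSq (X k) ^ 2 ≤ 3 / 2 * s ^ 2 ∧
    (∑ j ∈ Finset.range q, ∑ k ∈ Finset.range q, normSq (X j * X k - X k * X j) +
      ∑ k ∈ Finset.range q, normSq (X k) ^ 2 = 3 / 2 * s ^ 2 →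
      normSq (X 0) = s / 2 ∧ normSq (X 1) = s / 2 ∧ (∀ k, 2 ≤ k → X k = 0) ∧
      normSq (X 0 * X 1 - X 1 * X 0) = 2 * normSq (X 0) * normSq (X 1)) := by
  -- Padding with two zero matrices makes `X 0` and `X 1` available even when `q < 2`.
  have ext : ∀ f : ℕ → ℝ, (∀ k, q ≤ k → f k = 0) →
      ∑ k ∈ Finset.range q, f k = ∑ k ∈ Finset.range (q + 2), f k := fun f hf => by
    rw [Finset.sum_range_succ, Finset.sum_range_succ, hf q le_rfl, hf (q + 1) (by omega)]
    ring
  have hn0 : normSq (0 : Matrix ι ι ℝ) = 0 := by simp [normSq]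
  have e1 : ∑ j ∈ Finset.range q, ∑ k ∈ Finset.range q, normSq (X j * X k - X k * X j) =
      ∑ j ∈ Finset.range (q + 2), ∑ k ∈ Finset.range (q + 2),
        normSq (X j * X k - X k * X j) := by
    rw [ext _ fun j hj => by simp [hq j hj, hn0]]
    exact Finset.sum_congr rfl fun j _ => ext _ fun k hk => by simp [hq k hk, hn0]
  rw [ext _ fun k hk => by rw [hq k hk, hn0]] at hs
  rw [e1, ext (fun k => normSq (X k) ^ 2) fun k hk => by simp [hq k hk, hn0]]
  have h := liLi_aux X q (fun k hk => hq k (by omega)) hsymm horth hanti hs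
  -- With `a` the squared norm of `X 1`, the excess `2 a (s - a)` is at most `s² / 2`, with equality
  -- only for `a = s / 2`. Since `X 0` is at least as long, these two then exhaust the total `s`.
  refine ⟨by nlinarith [sq_nonneg (normSq (X 1) - s / 2)], fun heq => ?_⟩
  have h1 : normSq (X 1) = s / 2 := by
    have : (normSq (X 1) - s / 2) ^ 2 ≤ 0 := by nlinarith
    have := pow_eq_zero_iff (two_ne_zero) |>.1 (le_antisymm this (sq_nonneg _))
    linarith
  have h01 : normSq (X 1) ≤ normSq (X 0) := hanti zero_le_one
  have hnn : ∀ k ∈ Finset.range q, 0 ≤ normSq (X (k + 1 + 1)) := fun k _ => normSq_nonneg _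
  have hsum := Finset.sum_nonneg hnn
  have hs' := hs
  rw [Finset.sum_range_succ', Finset.sum_range_succ'] at hs'
  simp only [zero_add] at hs'
  have h0 : normSq (X 0) = s / 2 := by linarith
  have hz : ∀ k, 2 ≤ k → X k = 0 := by
    intro k hk
    by_cases hkq : k < q + 2
    · have := (Finset.sum_eq_zero_iff_of_nonneg hnn).1 (by linarith) (k - 2) (by simp; omega)
      rw [show k - 2 + 1 + 1 = k by omega] at this
      exact normSq_eq_zero this
    · exact hq k (by omega)
  refine ⟨h0, h1, hz, ?_⟩
  have hz' : ∀ k, X (k + 1 + 1) = 0 := fun k => hz _ (by omega)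
  simp only [Finset.sum_range_succ' _ (q + 1), Finset.sum_range_succ' _ q, hz', zero_add,
    Matrix.mul_zero, Matrix.zero_mul, sub_self, hn0, Finset.sum_const_zero, h0, h1] at heq
  have hsw : normSq (X 1 * X 0 - X 0 * X 1) = normSq (X 0 * X 1 - X 1 * X 0) :=
    normSq_sub_comm _ _
  rw [hsw] at heq
  rw [h0, h1]
  norm_num at heq
  linarith

end Commutators

/-! ### Matrix form of the quartic terms -/

section Arrays

variable {ι : Type*} [Fintype ι]

theorem normSq_commutator (B B' : Matrix ι ι ℝ) (hB : B.IsSymm) (hB' : B'.IsSymm) :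
    normSq (B * B' - B' * B) = 2 * (B * B * (B' * B')).trace - 2 * (B * B' * (B * B')).trace := by
  rw [normSq_eq_trace, Matrix.transpose_sub, Matrix.transpose_mul, Matrix.transpose_mul, hB.eq,
    hB'.eq, Matrix.sub_mul, Matrix.mul_sub, Matrix.mul_sub, Matrix.trace_sub, Matrix.trace_sub,
    Matrix.trace_sub]
  have e1 : (B' * B * (B * B')).trace = (B * B * (B' * B')).trace := by
    rw [Matrix.mul_assoc, Matrix.trace_mul_comm]; simp only [Matrix.mul_assoc]
  have e2 : (B * B' * (B' * B)).trace = (B * B * (B' * B')).trace := by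
    rw [← Matrix.mul_assoc, Matrix.trace_mul_comm]; simp only [Matrix.mul_assoc]
  have e3 : (B' * B * (B' * B)).trace = (B * B' * (B * B')).trace := by
    rw [Matrix.mul_assoc, Matrix.trace_mul_comm]; simp only [Matrix.mul_assoc]
  rw [e1, e2, e3]
  ring

theorem trace_mul₄ (X Y Z W : Matrix ι ι ℝ) :
    (X * Y * (Z * W)).trace = ∑ a, ∑ e, ∑ u, ∑ i, X a u * Y u e * (Z e i * W i a) := by
  simp only [Matrix.trace, Matrix.diag, Matrix.mul_apply, Finset.sum_mul_sum]

/-- The matrix form of the quartic terms in Simons' identity. -/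
theorem quartic_sums (τ : ι → ι → ι → ℝ) (hτ : ∀ i j k, τ i j k = τ j i k)
    (Y : ι → Matrix ι ι ℝ) (hY : ∀ c, Y c = Matrix.of fun i j => τ i j c) :
    ∑ a, ∑ u, ∑ c, ∑ i, ∑ d, ∑ e, τ a u c * (τ a u e * τ i d e * τ i d c)
      + ∑ a, ∑ u, ∑ c, ∑ i, ∑ d, ∑ e, τ a u c * (τ a e c * τ i e d * τ i u d)
      + ∑ a, ∑ u, ∑ c, ∑ i, ∑ d, ∑ e, τ a u c * (τ a d i * τ d e i * τ e u c)
      - ∑ a, ∑ u, ∑ c, ∑ i, ∑ d, ∑ e, τ a u c * (τ i u e * τ a d e * τ i d c)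
      - ∑ a, ∑ u, ∑ c, ∑ i, ∑ d, ∑ e, τ a u c * (τ i e c * τ a e d * τ i u d) =
    ∑ c, ∑ d, (∑ i, ∑ j, Y c i j * Y d i j) ^ 2 +
      ∑ c, ∑ d, normSq (Y c * Y d - Y d * Y c) := by
  have hsymm : ∀ c, (Y c).IsSymm := fun c => by
    ext i j
    simp [hY, hτ i j]
  have e1 : ∑ a, ∑ u, ∑ c, ∑ i, ∑ d, ∑ e, τ a u c * (τ a u e * τ i d e * τ i d c) =
      ∑ c, ∑ d, (∑ i, ∑ j, Y c i j * Y d i j) ^ 2 := by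
    simp only [sq, Finset.sum_mul_sum]
    simp only [← Fintype.sum_prod_type']
    -- Here and below the equivalence permutes the six summation indices; the summands then agree up
    -- to the symmetry of `τ` in its first two slots.
    refine Fintype.sum_equiv
      ⟨fun ⟨a, u, c, i, d, e⟩ => ⟨c, e, a, i, u, d⟩, fun ⟨c, e, a, i, u, d⟩ => ⟨a, u, c, i, d, e⟩,
        fun _ => rfl, fun _ => rfl⟩ _ _ fun ⟨a, u, c, i, d, e⟩ => ?_
    simp only [hY, Matrix.of_apply, Equiv.coe_fn_mk]
    ring
  have e2 : ∑ a, ∑ u, ∑ c, ∑ i, ∑ d, ∑ e, τ a u c * (τ a e c * τ i e d * τ i u d) =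
      ∑ c, ∑ d, (Y c * Y c * (Y d * Y d)).trace := by
    simp only [trace_mul₄]
    simp only [← Fintype.sum_prod_type']
    refine Fintype.sum_equiv
      ⟨fun ⟨a, u, c, i, d, e⟩ => ⟨c, d, u, e, a, i⟩, fun ⟨c, d, u, e, a, i⟩ => ⟨a, u, c, i, d, e⟩,
        fun _ => rfl, fun _ => rfl⟩ _ _ fun ⟨a, u, c, i, d, e⟩ => ?_
    simp only [hY, Matrix.of_apply, Equiv.coe_fn_mk]
    rw [hτ u a, hτ e i]; ring
  have e3 : ∑ a, ∑ u, ∑ c, ∑ i, ∑ d, ∑ e, τ a u c * (τ a d i * τ d e i * τ e u c) =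
      ∑ c, ∑ d, (Y c * Y c * (Y d * Y d)).trace := by
    simp only [trace_mul₄]
    simp only [← Fintype.sum_prod_type']
    refine Fintype.sum_equiv
      ⟨fun ⟨a, u, c, i, d, e⟩ => ⟨c, i, a, e, u, d⟩, fun ⟨c, i, a, e, u, d⟩ => ⟨a, u, c, i, d, e⟩,
        fun _ => rfl, fun _ => rfl⟩ _ _ fun ⟨a, u, c, i, d, e⟩ => ?_
    simp only [hY, Matrix.of_apply, Equiv.coe_fn_mk]
    rw [hτ u e, hτ e d, hτ a d]; ring
  have e4 : ∑ a, ∑ u, ∑ c, ∑ i, ∑ d, ∑ e, τ a u c * (τ i u e * τ a d e * τ i d c) =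
      ∑ c, ∑ d, (Y c * Y d * (Y c * Y d)).trace := by
    simp only [trace_mul₄]
    simp only [← Fintype.sum_prod_type']
    refine Fintype.sum_equiv
      ⟨fun ⟨a, u, c, i, d, e⟩ => ⟨c, e, a, i, u, d⟩, fun ⟨c, e, a, i, u, d⟩ => ⟨a, u, c, i, d, e⟩,
        fun _ => rfl, fun _ => rfl⟩ _ _ fun ⟨a, u, c, i, d, e⟩ => ?_
    simp only [hY, Matrix.of_apply, Equiv.coe_fn_mk]
    rw [hτ u i, hτ d a]; ring
  have e5 : ∑ a, ∑ u, ∑ c, ∑ i, ∑ d, ∑ e, τ a u c * (τ i e c * τ a e d * τ i u d) =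
      ∑ c, ∑ d, (Y c * Y d * (Y c * Y d)).trace := by
    simp only [trace_mul₄]
    simp only [← Fintype.sum_prod_type']
    refine Fintype.sum_equiv
      ⟨fun ⟨a, u, c, i, d, e⟩ => ⟨c, d, a, i, u, e⟩, fun ⟨c, d, a, i, u, e⟩ => ⟨a, u, c, i, d, e⟩,
        fun _ => rfl, fun _ => rfl⟩ _ _ fun ⟨a, u, c, i, d, e⟩ => ?_
    simp only [hY, Matrix.of_apply, Equiv.coe_fn_mk]
    rw [hτ u i, hτ e a]; ring
  have e6 : ∑ c, ∑ d, normSq (Y c * Y d - Y d * Y c) =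
      2 * ∑ c, ∑ d, (Y c * Y c * (Y d * Y d)).trace -
        2 * ∑ c, ∑ d, (Y c * Y d * (Y c * Y d)).trace := by
    simp only [fun c d => normSq_commutator (Y c) (Y d) (hsymm c) (hsymm d),
      Finset.sum_sub_distrib, Finset.mul_sum]
  rw [e1, e2, e3, e4, e5, e6]
  ring

theorem eq_zero_of_basis {E : Type*} [NormedAddCommGroup E] [InnerProductSpace ℝ E]
    (b : OrthonormalBasis ι ℝ E) (f : E → ℝ) (hadd : ∀ v w, f (v + w) = f v + f w)
    (hsmul : ∀ (r : ℝ) v, f (r • v) = r * f v) (h : ∀ i, f (b i) = 0) (v : E) : f v = 0 := by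
  have : (⟨⟨f, hadd⟩, hsmul⟩ : E →ₗ[ℝ] ℝ) = 0 := b.toBasis.ext fun i => by simpa using h i
  exact LinearMap.congr_fun this v

end Arrays

/-! ### Principal normals and the pointwise gap estimate -/

namespace SphereCalculus

variable {E : Type*} [NormedAddCommGroup E] [InnerProductSpace ℝ E]
    [FiniteDimensional ℝ E] {n : ℕ} {M A : Type*} [CommRing A] [Algebra ℝ A]
    (C : SphereCalculus E n M A) {ι : Type*} [Fintype ι] (b : OrthonormalBasis ι ℝ E)

theorem gam_smul₁ (r : ℝ) (v a u c : E) : C.gam (r • v) a u c = r • C.gam v a u c := by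
  simp only [gam, map_smul, LinearMap.smul_apply, mul_smul_comm, smul_mul_assoc, ← Finset.smul_sum,
    Derivation.smul_apply, smul_add, smul_sub]

theorem gam_smul₂ (r : ℝ) (v a u c : E) : C.gam v (r • a) u c = r • C.gam v a u c := by
  simp only [gam, map_smul, LinearMap.smul_apply, mul_smul_comm, smul_mul_assoc, ← Finset.smul_sum,
    Derivation.map_smul, smul_add, smul_sub]

theorem gam_eq_zero_of_basis (x : M) (h : ∀ i j k l, C.ev x (C.gam (b i) (b j) (b k) (b l)) = 0)
    (v a u c : E) : C.ev x (C.gam v a u c) = 0 := by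
  have h1 : ∀ j k l v, C.ev x (C.gam v (b j) (b k) (b l)) = 0 := fun j k l =>
    eq_zero_of_basis b _ (fun _ _ => by rw [gam_add₁, map_add])
      (fun _ _ => by rw [gam_smul₁, map_smul, smul_eq_mul]) fun i => h i j k l
  have h2 : ∀ k l a v, C.ev x (C.gam v a (b k) (b l)) = 0 := fun k l a v =>
    eq_zero_of_basis b (fun a => C.ev x (C.gam v a (b k) (b l)))
      (fun _ _ => by rw [gam_add₂, map_add])
      (fun _ _ => by rw [gam_smul₂, map_smul, smul_eq_mul]) (fun j => h1 j k l v) a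
  have h3 : ∀ l a v u, C.ev x (C.gam v a u (b l)) = 0 := fun l a v u =>
    eq_zero_of_basis b (fun u => C.ev x (C.gam v a u (b l)))
      (fun _ _ => by simp only [C.gam_symm v a]; rw [gam_add₂, map_add])
      (fun _ _ => by simp only [C.gam_symm v a]; rw [gam_smul₂, map_smul, smul_eq_mul])
      (fun k => h2 k l a v) u
  exact eq_zero_of_basis b (fun c => C.ev x (C.gam v a u c))
      (fun _ _ => by rw [gam_add₄, map_add])
      (fun _ _ => by rw [gam_smul₄, map_smul, smul_eq_mul]) (fun l => h3 l a v u) c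

theorem sum_t_sq_basis {ι' : Type*} [Fintype ι'] (b' : OrthonormalBasis ι' ℝ E) :
    ∑ i, ∑ j, ∑ k, C.t (b i) (b j) (b k) ^ 2 = ∑ i, ∑ j, ∑ k, C.t (b' i) (b' j) (b' k) ^ 2 := by
  simp only [sq]
  have h1 : ∀ i j, ∑ k, C.t (b i) (b j) (b k) * C.t (b i) (b j) (b k) =
      ∑ k, C.t (b i) (b j) (b' k) * C.t (b i) (b j) (b' k) := fun i j => sum_mul_eq b b' _ _
  have h2 : ∀ i k, ∑ j, C.t (b i) (b j) (b' k) * C.t (b i) (b j) (b' k) =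
      ∑ j, C.t (b i) (b' j) (b' k) * C.t (b i) (b' j) (b' k) := fun i k =>
    sum_mul_eq b b' ((C.t (b i)).flip (b' k)) ((C.t (b i)).flip (b' k))
  have h3 : ∀ j k, ∑ i, C.t (b i) (b' j) (b' k) * C.t (b i) (b' j) (b' k) =
      ∑ i, C.t (b' i) (b' j) (b' k) * C.t (b' i) (b' j) (b' k) := fun j k =>
    sum_mul_eq b b' (C.t.flip (b' j) |>.flip (b' k)) (C.t.flip (b' j) |>.flip (b' k))
  calc _ = ∑ i, ∑ j, ∑ k, C.t (b i) (b j) (b' k) * C.t (b i) (b j) (b' k) := by simp_rw [h1]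
    _ = ∑ i, ∑ k, ∑ j, C.t (b i) (b' j) (b' k) * C.t (b i) (b' j) (b' k) := by
      refine Finset.sum_congr rfl fun i _ => ?_
      rw [Finset.sum_comm]
      simp_rw [h2]
    _ = ∑ k, ∑ j, ∑ i, C.t (b i) (b' j) (b' k) * C.t (b i) (b' j) (b' k) := by
      rw [Finset.sum_comm]
      exact Finset.sum_congr rfl fun i _ => Finset.sum_comm
    _ = ∑ k, ∑ j, ∑ i, C.t (b' i) (b' j) (b' k) * C.t (b' i) (b' j) (b' k) := by simp_rw [h3]
    _ = ∑ k, ∑ i, ∑ j, C.t (b' i) (b' j) (b' k) * C.t (b' i) (b' j) (b' k) :=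
      Finset.sum_congr rfl fun i _ => Finset.sum_comm
    _ = ∑ i, ∑ k, ∑ j, C.t (b' i) (b' j) (b' k) * C.t (b' i) (b' j) (b' k) := Finset.sum_comm
    _ = _ := Finset.sum_congr rfl fun i _ => Finset.sum_comm

/-- The normal space at a point. -/
def N (x : M) : Submodule ℝ E := (C.T x ⊔ Submodule.span ℝ {C.pt x})ᗮ

theorem mem_N {x : M} {c : E} : c ∈ C.N x ↔ c ∈ (C.T x)ᗮ ∧ ⟪C.pt x, c⟫ = 0 := by
  rw [N, ← Submodule.inf_orthogonal, Submodule.mem_inf, Submodule.mem_orthogonal_singleton_iff_inner_right]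

/-- The Gram operator of the second fundamental form on the normal space. -/
def gram (x : M) : C.N x →ₗ[ℝ] C.N x :=
  (C.N x).orthogonalProjectionOnto.toLinearMap ∘ₗ
    (∑ i, ∑ j, (((C.ev x).toLinearMap ∘ₗ C.t (stdOrthonormalBasis ℝ E i)
      (stdOrthonormalBasis ℝ E j)).smulRight
      (C.H x (stdOrthonormalBasis ℝ E i) (stdOrthonormalBasis ℝ E j)))) ∘ₗ (C.N x).subtype

theorem inner_gram (x : M) (c d : C.N x) : ⟪C.gram x c, d⟫ =
    ∑ i, ∑ j, C.ev x (C.t (stdOrthonormalBasis ℝ E i) (stdOrthonormalBasis ℝ E j) c) *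
      C.ev x (C.t (stdOrthonormalBasis ℝ E i) (stdOrthonormalBasis ℝ E j) d) := by
  rw [gram, LinearMap.comp_apply, ContinuousLinearMap.coe_coe,
    Submodule.inner_orthogonalProjectionOnto_eq_of_mem_right]
  simp [sum_inner, real_inner_smul_left, inner_H]

theorem gram_symmetric (x : M) : (C.gram x).IsSymmetric := fun c d => by
  rw [inner_gram, real_inner_comm, inner_gram]
  simp_rw [mul_comm]

variable {κ κ' : Type*} [Fintype κ] [Fintype κ']

theorem orthonormal_adapted (x : M) (e : OrthonormalBasis κ ℝ (C.T x))
    (ν : OrthonormalBasis κ' ℝ (C.N x)) :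
    Orthonormal ℝ (Sum.elim (fun _ : Unit => C.pt x)
      (Sum.elim (fun i => (e i : E)) (fun j => (ν j : E)))) := by
  classical
  have h1 : ∀ i, ⟪C.pt x, (e i : E)⟫ = 0 := fun i =>
    (Submodule.mem_orthogonal' _ _).1 (C.pt_mem x) _ (e i).2
  have h2 : ∀ j, ⟪C.pt x, (ν j : E)⟫ = 0 := fun j => (C.mem_N.1 (ν j).2).2
  have h3 : ∀ i j, ⟪(e i : E), (ν j : E)⟫ = 0 := fun i j =>
    (Submodule.mem_orthogonal _ _).1 (C.mem_N.1 (ν j).2).1 _ (e i).2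
  have h4 : ∀ i j, ⟪(e i : E), (e j : E)⟫ = if i = j then 1 else 0 := fun i j => by
    simpa using orthonormal_iff_ite.1 e.orthonormal i j
  have h5 : ∀ i j, ⟪(ν i : E), (ν j : E)⟫ = if i = j then 1 else 0 := fun i j => by
    simpa using orthonormal_iff_ite.1 ν.orthonormal i j
  rw [orthonormal_iff_ite]
  rintro (⟨⟩ | i | i) (⟨⟩ | j | j)
  · simp [C.norm_pt x]
  all_goals
    simp [h1, h2, h3, h4, h5, real_inner_comm (C.pt x), real_inner_comm (e _ : E) (ν _ : E)]

/-- The orthonormal basis of the ambient space assembled from the position vector and bases of the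
tangent and the normal space. -/
def adaptedBasis (x : M) (e : OrthonormalBasis κ ℝ (C.T x)) (ν : OrthonormalBasis κ' ℝ (C.N x)) :
    OrthonormalBasis (Unit ⊕ κ ⊕ κ') ℝ E :=
  OrthonormalBasis.mkOfOrthogonalEqBot (C.orthonormal_adapted x e ν) (by
    rw [eq_bot_iff]
    intro z hz
    rw [Submodule.mem_orthogonal] at hz
    have hz' : ∀ k, ⟪(Sum.elim (fun _ : Unit => C.pt x)
      (Sum.elim (fun i => (e i : E)) (fun j => (ν j : E)))) k, z⟫ = 0 := fun k =>
      hz _ (Submodule.subset_span ⟨k, rfl⟩)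
    have hT : z ∈ (C.T x)ᗮ := by
      rw [Submodule.mem_orthogonal]
      intro u hu
      have := e.sum_repr' ⟨u, hu⟩
      rw [show u = ((⟨u, hu⟩ : C.T x) : E) from rfl, ← this]
      simp only [Submodule.coe_sum, Submodule.coe_smul, sum_inner, real_inner_smul_left]
      exact Finset.sum_eq_zero fun i _ => by
        rw [show ⟪(e i : E), z⟫ = 0 from hz' (.inr (.inl i)), mul_zero]
    have hN : z ∈ C.N x := C.mem_N.2 ⟨hT, hz' (.inl ())⟩
    have h0 : (⟨z, hN⟩ : C.N x) = 0 := by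
      rw [← ν.sum_repr' ⟨z, hN⟩]
      exact Finset.sum_eq_zero fun i _ => by
        rw [show ⟪ν i, (⟨z, hN⟩ : C.N x)⟫ = 0 from hz' (.inr (.inr i)), zero_smul]
    simpa using congrArg Subtype.val h0)

theorem adaptedBasis_apply (x : M) (e : OrthonormalBasis κ ℝ (C.T x))
    (ν : OrthonormalBasis κ' ℝ (C.N x)) (k : Unit ⊕ κ ⊕ κ') :
    C.adaptedBasis x e ν k = Sum.elim (fun _ : Unit => C.pt x)
      (Sum.elim (fun i => (e i : E)) (fun j => (ν j : E))) k := by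
  rw [adaptedBasis, OrthonormalBasis.coe_of_orthogonal_eq_bot_mk]

theorem adapted_adaptedBasis (x : M) (e : OrthonormalBasis κ ℝ (C.T x))
    (ν : OrthonormalBasis κ' ℝ (C.N x)) : C.Adapted (C.adaptedBasis x e ν) x := by
  rintro (⟨⟩ | i | j) <;> rw [adaptedBasis_apply]
  · exact .inr (.inl rfl)
  · exact .inl (e i).2
  · exact .inr (.inr (C.mem_N.1 (ν j).2))

theorem inner_H_H (x : M) (a u a' u' : E) : ⟪C.H x a u, C.H x a' u'⟫ =
    ∑ i, C.ev x (C.t a u (b i)) * C.ev x (C.t a' u' (b i)) := by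
  rw [C.sum_t_mul b x a u (C.t a' u'), ← C.inner_H, real_inner_comm]

theorem t_eq_zero_of_basis (x : M) (c : E) (h : ∀ i j, C.ev x (C.t (b i) (b j) c) = 0)
    (a u : E) : C.ev x (C.t a u c) = 0 := by
  have h1 : ∀ j a, C.ev x (C.t a (b j) c) = 0 := fun j =>
    eq_zero_of_basis b _ (by simp) (by simp) fun i => h i j
  exact eq_zero_of_basis b (fun u => C.ev x (C.t a u c)) (by simp) (by simp) (fun j => h1 j a) u

theorem sum_t_mul_t_basis {ι' : Type*} [Fintype ι'] (b' : OrthonormalBasis ι' ℝ E) (x : M)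
    (c d : E) : ∑ i, ∑ j, C.ev x (C.t (b' i) (b' j) c) * C.ev x (C.t (b' i) (b' j) d) =
    ∑ i, ∑ j, C.ev x (C.t (b i) (b j) c) * C.ev x (C.t (b i) (b j) d) := by
  have h1 : ∀ i, ∑ j, C.ev x (C.t (b' i) (b' j) c) * C.ev x (C.t (b' i) (b' j) d) =
      ∑ j, C.ev x (C.t (b' i) (b j) c) * C.ev x (C.t (b' i) (b j) d) := fun i =>
    sum_mul_eq (A := ℝ) b' b ((C.ev x).toLinearMap ∘ₗ (C.t (b' i)).flip c)
      ((C.ev x).toLinearMap ∘ₗ (C.t (b' i)).flip d)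
  have h2 : ∀ j, ∑ i, C.ev x (C.t (b' i) (b j) c) * C.ev x (C.t (b' i) (b j) d) =
      ∑ i, C.ev x (C.t (b i) (b j) c) * C.ev x (C.t (b i) (b j) d) := fun j =>
    sum_mul_eq (A := ℝ) b' b ((C.ev x).toLinearMap ∘ₗ (C.t.flip (b j)).flip c)
      ((C.ev x).toLinearMap ∘ₗ (C.t.flip (b j)).flip d)
  simp_rw [h1]
  rw [Finset.sum_comm]
  simp_rw [h2]
  exact Finset.sum_comm

theorem inner_gram_basis (x : M) (c d : C.N x) : ⟪C.gram x c, d⟫ =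
    ∑ i, ∑ j, C.ev x (C.t (b i) (b j) c) * C.ev x (C.t (b i) (b j) d) := by
  rw [inner_gram]
  exact C.sum_t_mul_t_basis b _ x c d

/-- The shape operator in the direction `c`, as a matrix. -/
def shape (x : M) (c : E) : Matrix ι ι ℝ := Matrix.of fun i j => C.ev x (C.t (b i) (b j) c)

theorem shape_isSymm (x : M) (c : E) : (C.shape b x c).IsSymm := by
  ext i j
  simp [shape, C.t_symm (b i)]

theorem shape_zero (x : M) : C.shape b x 0 = 0 := by
  ext i j
  simp [shape]

/-- There is an adapted orthonormal basis whose normal vectors diagonalize the Gram operator. -/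
theorem exists_principal_normals (x : M) :
    ∃ (ι' : Type) (_ : Fintype ι') (_ : DecidableEq ι') (b' : OrthonormalBasis ι' ℝ E) (q : ℕ)
      (c : ℕ → E), C.Adapted b' x ∧ (∀ k, q ≤ k → c k = 0) ∧
      (∀ k k', k ≠ k' →
        ∑ i, ∑ j, C.shape b' x (c k) i j * C.shape b' x (c k') i j = 0) ∧
      (Antitone fun k => normSq (C.shape b' x (c k))) ∧
      ∀ f : E → ℝ, (∀ d ∈ C.T x, f d = 0) → f (C.pt x) = 0 →
        ∑ i, f (b' i) = ∑ k ∈ Finset.range q, f (c k) := by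
  classical
  set q := Module.finrank ℝ (C.N x) with hq
  set ν : OrthonormalBasis (Fin q) ℝ (C.N x) := (C.gram_symmetric x).eigenvectorBasis rfl with hν
  set l : Fin q → ℝ := (C.gram_symmetric x).eigenvalues rfl with hl
  have hlanti : Antitone l := (C.gram_symmetric x).eigenvalues_antitone rfl
  set b' := C.adaptedBasis x (stdOrthonormalBasis ℝ (C.T x)) ν with hb'
  have hXX : ∀ k k' : Fin q, ∑ i, ∑ j, C.shape b' x (ν k) i j * C.shape b' x (ν k') i j =
      if k = k' then l k else 0 := by
    intro k k'
    simp only [shape, Matrix.of_apply]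
    rw [← inner_gram_basis, hν, LinearMap.IsSymmetric.apply_eigenvectorBasis, real_inner_smul_left,
      orthonormal_iff_ite.1 (OrthonormalBasis.orthonormal _)]
    simp [hl]
  have hA : C.Adapted b' x := C.adapted_adaptedBasis x _ _
  have hsum : ∀ f : E → ℝ, (∀ d ∈ C.T x, f d = 0) → f (C.pt x) = 0 →
        ∑ i, f (b' i) = ∑ k, f (ν k) := by
    intro f hf hf'
    simp only [Fintype.sum_sum_type, hb', C.adaptedBasis_apply, Sum.elim_inl, Sum.elim_inr, hf',
      hf _ (Subtype.coe_prop _), Finset.sum_const_zero, zero_add]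
  clear_value b' ν l
  -- Extension by zero gives the infinite sequence that `liLi` expects. It remains decreasing
  -- because squared norms are nonnegative.
  set c : ℕ → E := fun k => if h : k < q then (ν ⟨k, h⟩ : E) else 0 with hc
  have hc0 : ∀ k, q ≤ k → c k = 0 := fun k hk => by simp [hc, hk]
  have hc1 : ∀ k : Fin q, c k = ν k := fun k => by simp [hc]
  have hn : ∀ k : Fin q, normSq (C.shape b' x (c k)) = l k := fun k => by
    have := hXX k k
    rw [hc1]
    simpa [normSq, sq] using this
  refine ⟨_, inferInstance, inferInstance, b', q, c, hA, hc0, fun k k' hne => ?_, fun k k' hkl => ?_,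
    fun f hf hf' => ?_⟩
  · by_cases hk : k < q
    · by_cases hk' : k' < q
      · have := hXX ⟨k, hk⟩ ⟨k', hk'⟩
        rw [← hc1, ← hc1] at this
        simpa [hne] using this
      · simp [hc0 k' (by omega), shape_zero]
    · simp [hc0 k (by omega), shape_zero]
  · dsimp only
    by_cases hl : k' < q
    · rw [hn ⟨k', hl⟩, hn ⟨k, by omega⟩]
      exact hlanti hkl
    · rw [hc0 k' (by omega), shape_zero]
      simpa [normSq] using normSq_nonneg (C.shape b' x (c k))
  · rw [hsum f hf hf', Finset.sum_range]
    simp only [hc1]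

theorem shape_tan (x : M) (c : E) (hc : c ∈ C.T x) : C.shape b x c = 0 := by
  ext i j
  exact C.t_tan x c hc _ _

theorem shape_pt (x : M) : C.shape b x (C.pt x) = 0 := by
  ext i j
  exact C.t_pt x _ _

/-- Simons' identity in terms of the shape operators. -/
theorem simons_shape [DecidableEq ι] (x : M) {b : OrthonormalBasis ι ℝ E} (hb : C.Adapted b x)
    {s : ℝ} (hs : ∑ i, ∑ j, ∑ k, C.t (b i) (b j) (b k) ^ 2 = algebraMap ℝ A s) :
    ∑ v, ∑ i, ∑ j, ∑ k, C.ev x (C.gam (b v) (b i) (b j) (b k)) ^ 2 + n * s =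
      ∑ c, ∑ d, (∑ i, ∑ j, C.shape b x (b c) i j * C.shape b x (b d) i j) ^ 2 +
      ∑ c, ∑ d, normSq (C.shape b x (b c) * C.shape b x (b d) -
        C.shape b x (b d) * C.shape b x (b c)) := by
  obtain ⟨τ, hτ⟩ : ∃ τ : ι → ι → ι → ℝ, ∀ i j k, τ i j k = C.ev x (C.t (b i) (b j) (b k)) :=
    ⟨_, fun _ _ _ => rfl⟩
  have h1 := C.simons x hb hs τ hτ
  have h2 := quartic_sums τ (fun i j k => by rw [hτ, hτ, C.t_symm (b i)])
    (fun d => C.shape b x (b d)) (fun c => by ext i j; simp [shape, hτ])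
  rw [← h2, ← sub_eq_zero, ← h1]
  ring

/-- The equality case in the estimate for the squared length of the second fundamental form. -/
theorem gap_pointwise (x : M) {s : ℝ} (hs0 : 0 < s) (hsn : s ≤ 2 / 3 * n)
    (hs : ∑ i, ∑ j, ∑ k, C.t (b i) (b j) (b k) ^ 2 = algebraMap ℝ A s) :
    s = 2 / 3 * n ∧ (∀ v a u c, C.ev x (C.gam v a u c) = 0) ∧
    ∃ (ι' : Type) (_ : Fintype ι') (_ : DecidableEq ι') (b' : OrthonormalBasis ι' ℝ E)
      (c c' : E), C.Adapted b' x ∧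
      normSq (C.shape b' x c) = s / 2 ∧ normSq (C.shape b' x c') = s / 2 ∧
      (∑ i, ∑ j, C.shape b' x c i j * C.shape b' x c' i j = 0) ∧
      normSq (C.shape b' x c * C.shape b' x c' - C.shape b' x c' * C.shape b' x c) =
        2 * normSq (C.shape b' x c) * normSq (C.shape b' x c') ∧
      ∀ a u a' u', ⟪C.H x a u, C.H x a' u'⟫ =
        C.ev x (C.t a u c) * C.ev x (C.t a' u' c) + C.ev x (C.t a u c') * C.ev x (C.t a' u' c') := by
  obtain ⟨ι', _, _, b', q, c, hA, hc0, horth, hanti, hsum⟩ := C.exists_principal_normals x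
  have hX0 : ∀ k, q ≤ k → C.shape b' x (c k) = 0 := fun k hk => by rw [hc0 k hk, shape_zero]
  have hn0 : normSq (0 : Matrix ι' ι' ℝ) = 0 := by simp [normSq]
  rw [C.sum_t_sq_basis b b'] at hs
  have hsr : ∑ k ∈ Finset.range q, normSq (C.shape b' x (c k)) = s := by
    have h := congrArg (C.ev x) hs
    simp only [map_sum, map_pow, AlgHom.commutes, Algebra.algebraMap_self, RingHom.id_apply] at h
    rw [← hsum (fun d => normSq (C.shape b' x d)) (fun d hd => by simp only [C.shape_tan b' x d hd, hn0])
      (by simp only [shape_pt, hn0]), ← h]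
    simp only [normSq, shape, Matrix.of_apply]
    rw [Finset.sum_comm]
    exact Finset.sum_congr rfl fun i _ => Finset.sum_comm
  have hqu := C.simons_shape x hA hs
  set Y := C.shape b' x with hY
  have hYt : ∀ d ∈ C.T x, Y d = 0 := fun d hd => C.shape_tan b' x d hd
  have hYp : Y (C.pt x) = 0 := C.shape_pt b' x
  have hq1 : ∑ c, ∑ d, (∑ i, ∑ j, Y (b' c) i j * Y (b' d) i j) ^ 2 =
      ∑ k ∈ Finset.range q, normSq (Y (c k)) ^ 2 := by
    have h1 : ∀ e, ∑ d, (∑ i, ∑ j, Y e i j * Y (b' d) i j) ^ 2 =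
        ∑ k ∈ Finset.range q, (∑ i, ∑ j, Y e i j * Y (c k) i j) ^ 2 := fun e =>
      hsum (fun d => (∑ i, ∑ j, Y e i j * Y d i j) ^ 2) (fun d hd => by simp [hYt d hd])
        (by simp [hYp])
    simp_rw [h1]
    rw [hsum (fun e => ∑ k ∈ Finset.range q, (∑ i, ∑ j, Y e i j * Y (c k) i j) ^ 2)
      (fun d hd => by simp [hYt d hd]) (by simp [hYp])]
    refine Finset.sum_congr rfl fun k hk => ?_
    rw [Finset.sum_eq_single k]
    · simp only [normSq, sq]
    · intro k' _ hne
      rw [horth k k' hne.symm]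
      simp
    · exact fun h => absurd hk h
  have hq2 : ∑ c, ∑ d, normSq (Y (b' c) * Y (b' d) - Y (b' d) * Y (b' c)) =
      ∑ j ∈ Finset.range q, ∑ k ∈ Finset.range q,
        normSq (Y (c j) * Y (c k) - Y (c k) * Y (c j)) := by
    have h1 : ∀ e, ∑ d, normSq (Y e * Y (b' d) - Y (b' d) * Y e) =
        ∑ k ∈ Finset.range q, normSq (Y e * Y (c k) - Y (c k) * Y e) := fun e =>
      hsum (fun d => normSq (Y e * Y d - Y d * Y e)) (fun d hd => by simp [hYt d hd, hn0])
        (by simp [hYp, hn0])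
    simp_rw [h1]
    exact hsum (fun e => ∑ k ∈ Finset.range q, normSq (Y e * Y (c k) - Y (c k) * Y e))
      (fun d hd => by simp [hYt d hd, hn0]) (by simp [hYp, hn0])
  obtain ⟨hll, hll'⟩ := liLi (fun k => Y (c k)) q hX0 (fun k => C.shape_isSymm b' x _) horth hanti
    hsr
  set G := ∑ v, ∑ i, ∑ j, ∑ k, C.ev x (C.gam (b' v) (b' i) (b' j) (b' k)) ^ 2 with hG
  have hG0 : 0 ≤ G := Finset.sum_nonneg fun v _ => Finset.sum_nonneg fun i _ =>
    Finset.sum_nonneg fun j _ => Finset.sum_nonneg fun k _ => sq_nonneg _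
  have hkey : G + n * s = ∑ j ∈ Finset.range q, ∑ k ∈ Finset.range q,
      normSq (Y (c j) * Y (c k) - Y (c k) * Y (c j)) +
      ∑ k ∈ Finset.range q, normSq (Y (c k)) ^ 2 := by
    rw [hqu, hq1, hq2, add_comm]
  rw [← hkey] at hll hll'
  -- The matrix inequality reads `G + n * s ≤ 3 / 2 * s ^ 2`. Since `G` and `s * (n - 3 / 2 * s)`
  -- are both nonnegative and `s > 0`, equality holds throughout.
  have hGz : G = 0 ∧ s = 2 / 3 * n := by
    clear_value G
    clear * - hll hG0 hs0 hsn
    have hprod : 0 ≤ s * (n - 3 / 2 * s) := mul_nonneg hs0.le (by linarith)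
    have : s * (n - 3 / 2 * s) = 0 := by linarith
    have := (mul_eq_zero.1 this).resolve_left hs0.ne'
    constructor <;> linarith
  obtain ⟨hGz, hsn'⟩ := hGz
  obtain ⟨h0, h1, hz, hcomm⟩ := hll' (by rw [hGz, hsn']; ring)
  refine ⟨hsn', C.gam_eq_zero_of_basis b' x fun i j k l => ?_, _, inferInstance, inferInstance, b',
    c 0, c 1, hA, h0, h1, horth 0 1 zero_ne_one, hcomm, fun a u a' u' => ?_⟩
  · have hnn := fun v i j k => sq_nonneg (C.ev x (C.gam (b' v) (b' i) (b' j) (b' k)))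
    have g1 := (Finset.sum_eq_zero_iff_of_nonneg (fun v _ => Finset.sum_nonneg fun i _ =>
      Finset.sum_nonneg fun j _ => Finset.sum_nonneg fun k _ => hnn v i j k)).1 hGz i
      (Finset.mem_univ i)
    have g2 := (Finset.sum_eq_zero_iff_of_nonneg (fun i' _ =>
      Finset.sum_nonneg fun j _ => Finset.sum_nonneg fun k _ => hnn i i' j k)).1 g1 j
      (Finset.mem_univ j)
    have g3 := (Finset.sum_eq_zero_iff_of_nonneg (fun j' _ =>
      Finset.sum_nonneg fun k _ => hnn i j j' k)).1 g2 k (Finset.mem_univ k)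
    have g4 := (Finset.sum_eq_zero_iff_of_nonneg (fun k' _ => hnn i j k k')).1 g3 l
      (Finset.mem_univ l)
    exact pow_eq_zero_iff (two_ne_zero) |>.1 g4
  · have e2 : ∀ k, 2 ≤ k → C.ev x (C.t a u (c k)) = 0 := fun k hk =>
      C.t_eq_zero_of_basis b' x _ (fun i j => congrFun (congrFun (hz k hk) i) j) a u
    have e3 : ∑ k ∈ Finset.range (q + 2), C.ev x (C.t a u (c k)) * C.ev x (C.t a' u' (c k)) =
        ∑ k ∈ Finset.range q, C.ev x (C.t a u (c k)) * C.ev x (C.t a' u' (c k)) := by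
      rw [Finset.sum_range_succ, Finset.sum_range_succ, hc0 q le_rfl, hc0 (q + 1) (by omega)]
      simp
    rw [C.inner_H_H b', hsum (fun d => C.ev x (C.t a u d) * C.ev x (C.t a' u' d))
      (fun d hd => by simp [C.t_tan x d hd]) (by simp [C.t_pt]), ← e3,
      Finset.sum_range_succ', Finset.sum_range_succ', Finset.sum_eq_zero fun k _ => by
        rw [e2 (k + 1 + 1) (by omega), zero_mul]]
    ring

end SphereCalculus

/-! ### Reduction to surfaces and the Veronese relation -/

namespace SphereCalculus

variable {E : Type*} [NormedAddCommGroup E] [InnerProductSpace ℝ E]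
    [FiniteDimensional ℝ E] {n : ℕ} {M A : Type*} [CommRing A] [Algebra ℝ A]
    (C : SphereCalculus E n M A) {ι : Type*} [Fintype ι] (b : OrthonormalBasis ι ℝ E)

theorem t_eq_zero_of_tangent (x : M)
    (h : ∀ a ∈ C.T x, ∀ u ∈ C.T x, ∀ c ∈ (C.T x)ᗮ, C.ev x (C.t a u c) = 0) (a u c : E) :
    C.ev x (C.t a u c) = 0 := by
  have m := fun w => Submodule.starProjection_apply_mem (C.T x) w
  rw [← C.t_proj, C.t_symm, ← C.t_proj]
  have e : c = (C.T x).starProjection c + (c - (C.T x).starProjection c) := by abel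
  rw [e, map_add, map_add, C.t_tan x _ (m c),
    h _ (m u) _ (m a) _ (Submodule.sub_starProjection_mem_orthogonal _), add_zero]

/-- If the second fundamental form is parallel and has a nullity direction, it vanishes. -/
theorem t_eq_zero_of_nullity (hg : ∀ v a u c, C.gam v a u c = 0) (x : M) (w : E) (hw : w ∈ C.T x)
    (hw0 : w ≠ 0) (hn : ∀ u c, C.ev x (C.t w u c) = 0) (a u c : E) :
    C.ev x (C.t a u c) = 0 := by
  have hn' : ∀ u c, C.ev x (C.t u w c) = 0 := fun u c => by rw [C.t_symm, hn]
  refine C.t_eq_zero_of_tangent x (fun a ha e he c hc => ?_) a u c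
  -- Differentiate `t a w c` along `w` and `e` in both orders. With the derivative along `w` taken
  -- first the result is zero by nullity; in the other order the derivative of `F w` leaves `-⟪w, w⟫
  -- * t a e c`. This is the sphere's curvature in the Ricci identity.
  have h := C.comm_tan x w e hw he (C.t a w c)
  set b := stdOrthonormalBasis ℝ E
  have d1 : ∀ v d, C.ev x (C.D v (C.t w d w)) = 0 := fun v d => by
    rw [C.ev_D_t_tan b x v w d w hw]
    simp [hn]
  have d2 : ∀ d, C.ev x (C.D w (C.t e d w)) = 0 := fun d => by
    rw [C.ev_D_t_tan b x w e d w hw]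
    simp [hn]
  have e1 : C.ev x (C.D e (C.D w (C.t a w c))) = 0 := by
    rw [C.D_t b, hg]
    simp [Derivation.leibniz, hn, hn', C.F_tan x a ha, C.F_tan x w hw, d1]
  have e2 : C.ev x (C.D w (C.D e (C.t a w c))) = -(⟪w, w⟫ * C.ev x (C.t a e c)) := by
    rw [C.D_t b, hg]
    simp only [map_sub, map_add, map_zero, map_sum, Derivation.leibniz, smul_eq_mul, map_mul,
      hn', C.F_tan x a ha, C.F_tan x w hw, d2, C.D_F, C.p_tan x w hw, C.t_tan x a ha,
      C.t_tan x w hw, C.t_orth' x c hc, zero_mul, mul_zero, add_zero, zero_add,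
      Finset.sum_const_zero, sub_zero]
    ring
  rw [e1, e2] at h
  have hw2 : ⟪w, w⟫ ≠ 0 := fun h => hw0 (inner_self_eq_zero.1 h)
  exact (mul_eq_zero.1 (neg_eq_zero.1 h)).resolve_left hw2

section Tangent

variable {κ : Type*} [Fintype κ] {x : M} (e : OrthonormalBasis κ ℝ (C.T x))

theorem proj_eq_sum (a : E) : (C.T x).starProjection a = ∑ k, ⟪(e k : E), a⟫ • (e k : E) := by
  have h := e.sum_repr' ((C.T x).orthogonalProjectionOnto a)
  have h2 := congrArg Subtype.val h
  simp only [Submodule.coe_sum, Submodule.coe_smul,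
    Submodule.inner_orthogonalProjectionOnto_eq_of_mem_left] at h2
  exact h2.symm

theorem ev_p_eq_sum (a u : E) : C.ev x (C.p a u) = ∑ k, ⟪(e k : E), a⟫ * ⟪(e k : E), u⟫ := by
  rw [C.ev_p, C.proj_eq_sum e, sum_inner]
  simp_rw [real_inner_smul_left]

theorem ev_t_eq_sum (a u c : E) : C.ev x (C.t a u c) =
    ∑ k, ∑ l, ⟪(e k : E), a⟫ * ⟪(e l : E), u⟫ * C.ev x (C.t (e k) (e l) c) := by
  rw [← C.t_proj, C.t_symm, ← C.t_proj, C.t_symm, C.proj_eq_sum e a, C.proj_eq_sum e u]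
  simp only [map_sum, LinearMap.sum_apply, map_smul, LinearMap.smul_apply, smul_eq_mul,
    Finset.mul_sum]
  rw [Finset.sum_comm]
  exact Finset.sum_congr rfl fun k _ => Finset.sum_congr rfl fun l _ => by ring

theorem trace_tangent (c : E) : ∑ k, C.ev x (C.t (e k) (e k) c) = 0 := by
  have h := congrArg (C.ev x)
    (C.trace_basis (C.adaptedBasis x e (stdOrthonormalBasis ℝ (C.N x))) c)
  simpa [Fintype.sum_sum_type, adaptedBasis_apply, C.t_orth x _ (C.pt_mem x),
    C.t_orth x _ (C.mem_N.1 (Subtype.coe_prop _)).1] using h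

theorem sum_t_mul_t_tangent (c d : E) :
    ∑ i, ∑ j, C.ev x (C.t (b i) (b j) c) * C.ev x (C.t (b i) (b j) d) =
    ∑ k, ∑ l, C.ev x (C.t (e k) (e l) c) * C.ev x (C.t (e k) (e l) d) := by
  rw [C.sum_t_mul_t_basis (C.adaptedBasis x e (stdOrthonormalBasis ℝ (C.N x))) b]
  have h : ∀ (k) (y : E) c, C.ev x (C.t (stdOrthonormalBasis ℝ (C.N x) k : E) y c) = 0 :=
    fun k => C.t_orth x _ (C.mem_N.1 (Subtype.coe_prop _)).1
  have h' : ∀ (k) (y : E) c, C.ev x (C.t y (stdOrthonormalBasis ℝ (C.N x) k : E) c) = 0 :=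
    fun k => C.t_orth' x _ (C.mem_N.1 (Subtype.coe_prop _)).1
  simp [Fintype.sum_sum_type, adaptedBasis_apply, C.t_orth x _ (C.pt_mem x), h, h',
    C.t_orth' x _ (C.pt_mem x)]

theorem sum_t_comp_tangent (v a c : E) :
    ∑ i, C.ev x (C.t v (b i) c) * C.ev x (C.t (b i) a c) =
    ∑ k, C.ev x (C.t v (e k) c) * C.ev x (C.t (e k) a c) := by
  have h0 := sum_mul_eq (A := ℝ) b (C.adaptedBasis x e (stdOrthonormalBasis ℝ (C.N x)))
    ((C.ev x).toLinearMap ∘ₗ (C.t v).flip c) ((C.ev x).toLinearMap ∘ₗ (C.t.flip a).flip c)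
  simp only [LinearMap.comp_apply, LinearMap.flip_apply, AlgHom.toLinearMap_apply] at h0
  rw [h0]
  have h : ∀ (k) (y : E) c, C.ev x (C.t (stdOrthonormalBasis ℝ (C.N x) k : E) y c) = 0 :=
    fun k => C.t_orth x _ (C.mem_N.1 (Subtype.coe_prop _)).1
  simp [Fintype.sum_sum_type, adaptedBasis_apply, C.t_orth x _ (C.pt_mem x), h]

/-- The tangent space of a surface has an orthonormal basis with two elements. -/
def frame (hn : n = 2) (x : M) : OrthonormalBasis (Fin 2) ℝ (C.T x) :=
  (stdOrthonormalBasis ℝ (C.T x)).reindex (finCongr ((C.finrank_T x).trans hn))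

end Tangent

/-- In dimension two, shape operators square to multiples of the identity. -/
theorem sum_t_comp_surface (hn : n = 2) (v a c : E) :
    ∑ i, C.t v (b i) c * C.t (b i) a c =
      (1 / 2 : ℝ) • ((∑ i, ∑ j, C.t (b i) (b j) c * C.t (b i) (b j) c) * C.p v a) := by
  refine C.ext _ _ fun x => ?_
  have e := C.frame hn x
  simp only [map_sum, map_mul, map_smul, smul_eq_mul]
  rw [C.sum_t_comp_tangent b e, C.sum_t_mul_t_tangent b e, C.ev_p_eq_sum e]
  simp_rw [C.ev_t_eq_sum e v, C.ev_t_eq_sum e _ a]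
  have h := C.trace_tangent e c
  have h' : C.t (e 1 : E) (e 0) c = C.t (e 0 : E) (e 1) c := C.t_symm _ _ _
  have h4 : ∀ i j, ⟪(e i : E), (e j : E)⟫ = if i = j then 1 else 0 := fun i j => by
    simpa using orthonormal_iff_ite.1 e.orthonormal i j
  simp only [Fin.sum_univ_two, h', h4] at h ⊢
  have h2 := eq_neg_of_add_eq_zero_right h
  simp only [h2]
  norm_num
  ring

/-- The Veronese relation between the values of the second fundamental form. -/
def VeroneseAt (x : M) : Prop := ∀ a u a' u', ⟪C.H x a u, C.H x a' u'⟫ =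
  1 / 3 * (C.ev x (C.p a a') * C.ev x (C.p u u') + C.ev x (C.p a u') * C.ev x (C.p u a')
    - C.ev x (C.p a u) * C.ev x (C.p a' u'))

/-- If the rows of a square matrix are orthogonal of equal length, so are its columns. Rows are the
two shape operators, columns the values of `h` on the frame. -/
theorem veronese_numbers {p q r s : ℝ} (h1 : p ^ 2 + q ^ 2 = 1 / 3) (h2 : r ^ 2 + s ^ 2 = 1 / 3)
    (h3 : p * r + q * s = 0) :
    p ^ 2 + r ^ 2 = 1 / 3 ∧ q ^ 2 + s ^ 2 = 1 / 3 ∧ p * q + r * s = 0 := by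
  have e1 : p ^ 2 = s ^ 2 := by
    have : p ^ 2 * r ^ 2 = q ^ 2 * s ^ 2 := by
      have : p * r = -(q * s) := by linarith
      calc p ^ 2 * r ^ 2 = (p * r) ^ 2 := by ring
        _ = _ := by rw [this]; ring
    nlinarith
  have e2 : (s ^ 2 + q ^ 2) * (p * q + r * s) = 0 := by
    have hs : s * (p * q + r * s) = 0 := by
      have : s * (p * q + r * s) = p * (p * r + q * s) + r * (s ^ 2 - p ^ 2) := by ring
      rw [this, h3, e1]; ring
    have hq : q * (p * q + r * s) = 0 := by
      have : q * (p * q + r * s) = r * (p * r + q * s) + p * (q ^ 2 - r ^ 2) := by ring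
      rw [this, h3, show q ^ 2 - r ^ 2 = 0 by linarith]; ring
    linear_combination s * hs + q * hq
  refine ⟨by linarith, by linarith, (mul_eq_zero.1 e2).resolve_left ?_⟩
  have : s ^ 2 + q ^ 2 = 1 / 3 := by linarith
  rw [this]
  norm_num

/-- Minimal submanifolds with `0 < S ≤ 2n/3` constant are surfaces with parallel second fundamental
form satisfying the Veronese relation. -/
theorem gap {s : ℝ} (hs0 : 0 < s) (hsn : s ≤ 2 / 3 * n)
    (hs : ∑ i, ∑ j, ∑ k, C.t (b i) (b j) (b k) ^ 2 = algebraMap ℝ A s) [hM : Nonempty M] :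
    s = 2 / 3 * n ∧ n = 2 ∧ (∀ v a u c, C.gam v a u c = 0) ∧ ∀ x, C.VeroneseAt x := by
  have hg : ∀ v a u c, C.gam v a u c = 0 := fun v a u c => C.ext _ _ fun x => by
    rw [(C.gap_pointwise b x hs0 hsn hs).2.1, map_zero]
  have ht : ∀ x, ¬ ∀ a u c, C.ev x (C.t a u c) = 0 := by
    intro x h
    have h1 := congrArg (C.ev x) hs
    simp [h] at h1
    linarith
  have hsn' : s = 2 / 3 * n := (C.gap_pointwise b hM.some hs0 hsn hs).1
  have hn2 : n = 2 := by
    obtain ⟨x⟩ := hM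
    obtain ⟨-, -, ι', _, _, b', c, c', hA, h1, h2, h3, h4, h5⟩ := C.gap_pointwise b x hs0 hsn hs
    by_contra hne
    rcases Nat.lt_or_ge n 3 with h | h
    -- In dimension zero `s` would vanish, and in dimension one a trace-free `h` is zero.
    · have : n = 0 ∨ n = 1 := by omega
      rcases this with h0 | h0
      · rw [h0] at hsn'
        norm_num at hsn'
        linarith
      · set e : OrthonormalBasis (Fin 1) ℝ (C.T x) :=
          (stdOrthonormalBasis ℝ (C.T x)).reindex (finCongr ((C.finrank_T x).trans h0))
        refine ht x fun a u c => ?_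
        have := C.trace_tangent e c
        rw [C.ev_t_eq_sum e]
        simp only [Fin.sum_univ_one] at this ⊢
        rw [this, mul_zero]
    · have hnz : ∀ c, normSq (C.shape b' x c) = s / 2 → C.shape b' x c ≠ 0 := by
        intro c hc h0
        rw [h0] at hc
        simp [normSq] at hc
        linarith
      obtain ⟨u, u', hu⟩ := commutator_eq _ _ (C.shape_isSymm b' x c) (hnz c h1) (hnz c' h2) h4
      -- Both shape operators vanish on vectors orthogonal to two given ones. A tangent space of
      -- dimension at least three contains such a vector `w ≠ 0`. As the other shape operators are
      -- zero, `w` is a nullity direction.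
      set φ : C.T x →ₗ[ℝ] ℝ × ℝ :=
        ((innerₗ E (∑ i, u i • b' i)).prod (innerₗ E (∑ i, u' i • b' i))) ∘ₗ (C.T x).subtype with hφ
      have hker : LinearMap.ker φ ≠ ⊥ := by
        apply LinearMap.ker_ne_bot_of_finrank_lt
        rw [C.finrank_T]
        simp
        omega
      obtain ⟨w, hw, hw0⟩ := Submodule.exists_mem_ne_zero_of_ne_bot hker
      have hw' : ∑ i, u i * ⟪b' i, (w : E)⟫ = 0 ∧ ∑ i, u' i * ⟪b' i, (w : E)⟫ = 0 := by
        simpa [hφ, sum_inner, real_inner_smul_left] using hw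
      obtain ⟨g1, g2⟩ := hu (fun i => ⟪b' i, (w : E)⟫) hw'.1 hw'.2
      have hz : ∀ c, (C.shape b' x c).mulVec (fun i => ⟪b' i, (w : E)⟫) = 0 →
          ∀ a, C.ev x (C.t w a c) = 0 := by
        intro c hc a
        refine eq_zero_of_basis b' (fun a => C.ev x (C.t w a c)) (by simp) (by simp) (fun i => ?_) a
        have h6 := congrFun hc i
        have h7 := C.sum_inner_mul_ev b' x ((C.t (b' i)).flip c) w
        simp only [LinearMap.flip_apply] at h7
        rw [C.t_symm, ← h7, ← show _ = (0 : ℝ) from h6]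
        simp only [Matrix.mulVec, dotProduct, shape, Matrix.of_apply]
        exact Finset.sum_congr rfl fun j _ => by rw [mul_comm, real_inner_comm]
      refine ht x (C.t_eq_zero_of_nullity hg x w w.2 (by simpa using hw0) fun a d => ?_)
      have h8 := h5 w a w a
      rw [hz c g1, hz c' g2, mul_zero, add_zero, inner_self_eq_zero] at h8
      rw [← C.inner_H, h8, inner_zero_left]
  refine ⟨hsn', hn2, hg, fun x => ?_⟩
  obtain ⟨-, -, ι', _, _, b', c, c', hA, h1, h2, h3, h4, h5⟩ := C.gap_pointwise b x hs0 hsn hs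
  have e := C.frame hn2 x
  have k1 := C.sum_t_mul_t_tangent b' e c c
  have k2 := C.sum_t_mul_t_tangent b' e c' c'
  have k3 := C.sum_t_mul_t_tangent b' e c c'
  have k1' : ∑ i, ∑ j, C.ev x (C.t (b' i) (b' j) c) * C.ev x (C.t (b' i) (b' j) c) = s / 2 := by
    rw [← h1]; simp only [normSq, sq, shape, Matrix.of_apply]
  have k2' : ∑ i, ∑ j, C.ev x (C.t (b' i) (b' j) c') * C.ev x (C.t (b' i) (b' j) c') = s / 2 := by
    rw [← h2]; simp only [normSq, sq, shape, Matrix.of_apply]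
  have k3' : ∑ i, ∑ j, C.ev x (C.t (b' i) (b' j) c) * C.ev x (C.t (b' i) (b' j) c') = 0 := h3
  have hs43 : s = 4 / 3 := by rw [hsn', hn2]; norm_num
  rw [k1', hs43] at k1
  rw [k2', hs43] at k2
  rw [k3'] at k3
  have t1 := C.trace_tangent e c
  have t2 := C.trace_tangent e c'
  have s1 : C.t (e 1 : E) (e 0) c = C.t (e 0 : E) (e 1) c := C.t_symm _ _ _
  have s2 : C.t (e 1 : E) (e 0) c' = C.t (e 0 : E) (e 1) c' := C.t_symm _ _ _
  simp only [Fin.sum_univ_two, s1, s2] at k1 k2 k3 t1 t2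
  have t1' := eq_neg_of_add_eq_zero_right t1
  have t2' := eq_neg_of_add_eq_zero_right t2
  simp only [t1', t2'] at k1 k2 k3
  -- A symmetric trace-free 2×2 matrix has squared norm twice that of its first row. As each shape
  -- operator has squared norm `s / 2 = 2 / 3`, the first rows have squared length `1 / 3`.
  obtain ⟨r1, r2, r3⟩ := veronese_numbers (p := C.ev x (C.t (e 0 : E) (e 0) c))
    (q := C.ev x (C.t (e 0 : E) (e 1) c)) (r := C.ev x (C.t (e 0 : E) (e 0) c'))
    (s := C.ev x (C.t (e 0 : E) (e 1) c')) (by linarith) (by linarith) (by linarith)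
  intro a u a' u'
  rw [h5]
  rw [C.ev_t_eq_sum e a u c, C.ev_t_eq_sum e a' u' c, C.ev_t_eq_sum e a u c',
    C.ev_t_eq_sum e a' u' c']
  simp only [C.ev_p_eq_sum e, Fin.sum_univ_two, s1, s2, t1', t2']
  generalize C.ev x (C.t (e 0 : E) (e 0) c) = P at *
  generalize C.ev x (C.t (e 0 : E) (e 1) c) = Q at *
  generalize C.ev x (C.t (e 0 : E) (e 0) c') = R at *
  generalize C.ev x (C.t (e 0 : E) (e 1) c') = S at *
  generalize ⟪(e 0 : E), a⟫ = a0
  generalize ⟪(e 1 : E), a⟫ = a1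
  generalize ⟪(e 0 : E), u⟫ = u0
  generalize ⟪(e 1 : E), u⟫ = u1
  generalize ⟪(e 0 : E), a'⟫ = a0'
  generalize ⟪(e 1 : E), a'⟫ = a1'
  generalize ⟪(e 0 : E), u'⟫ = u0'
  generalize ⟪(e 1 : E), u'⟫ = u1'
  linear_combination (a0 * u0 - a1 * u1) * (a0' * u0' - a1' * u1') * r1 +
    (a0 * u1 + a1 * u0) * (a0' * u1' + a1' * u0') * r2 +
    ((a0 * u0 - a1 * u1) * (a0' * u1' + a1' * u0') +
      (a0 * u1 + a1 * u0) * (a0' * u0' - a1' * u1')) * r3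

end SphereCalculus

/-! ### First integrals: osculating space and cubic form -/

namespace SphereCalculus

variable {E : Type*} [NormedAddCommGroup E] [InnerProductSpace ℝ E]
    [FiniteDimensional ℝ E] {n : ℕ} {M A : Type*} [CommRing A] [Algebra ℝ A]
    (C : SphereCalculus E n M A) {ι : Type*} [Fintype ι] (b : OrthonormalBasis ι ℝ E)

/-- For a totally geodesic submanifold the span of position and tangent space is constant. -/
theorem D_span_eq_zero (h : ∀ a u c, C.t a u c = 0) (v c d : E) :
    C.D v (C.F c * C.F d + C.p c d) = 0 := by
  simp only [map_add, Derivation.leibniz, C.D_F, C.D_p, h, smul_eq_mul]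
  ring

/-- The normal metric induced by the second fundamental form. -/
def Kn (c d : E) : A := ∑ i, ∑ j, C.t (b i) (b j) c * C.t (b i) (b j) d

/-- After expanding `Kn`, the Veronese relation replaces `⟪h(v, w), h(b i, b j)⟫` by projections.
Two of the three terms each return a third of `t v w d`, and the last is a trace. Thus `Kn` acts as
2/3 on the first normal space. -/
theorem sum_t_mul_Kn (hV : ∀ x, C.VeroneseAt x) (v w d : E) :
    ∑ e, C.t v w (b e) * C.Kn b (b e) d = (2 / 3 : ℝ) • C.t v w d := by
  refine C.ext _ _ fun x => ?_
  have h1 : ∀ i j, ∑ e, C.ev x (C.t v w (b e)) * C.ev x (C.t (b i) (b j) (b e)) =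
      ⟪C.H x v w, C.H x (b i) (b j)⟫ := fun i j => by
    rw [C.sum_t_mul b x v w (C.t (b i) (b j)), ← C.inner_H, real_inner_comm]
  have h2 : C.ev x (∑ e, C.t v w (b e) * C.Kn b (b e) d) =
      ∑ i, ∑ j, ⟪C.H x v w, C.H x (b i) (b j)⟫ * C.ev x (C.t (b i) (b j) d) := by
    simp only [Kn, map_sum, map_mul, Finset.mul_sum, ← h1, Finset.sum_mul]
    rw [Finset.sum_comm]
    refine Finset.sum_congr rfl fun i _ => ?_
    rw [Finset.sum_comm]
    exact Finset.sum_congr rfl fun j _ => Finset.sum_congr rfl fun e _ => by ring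
  have e1 : ∑ i, ∑ j, C.ev x (C.p v (b i)) * C.ev x (C.p w (b j)) * C.ev x (C.t (b i) (b j) d) =
      C.ev x (C.t v w d) := by
    have h3 : ∀ i, ∑ j, C.ev x (C.p w (b j)) * C.ev x (C.t (b i) (b j) d) =
        C.ev x (C.t (b i) w d) := fun i => by
      have := congrArg (C.ev x) (C.sum_p_mul_t b w (b i) d)
      simp only [map_sum, map_mul, C.t_symm _ (b i)] at this
      rw [this]
    have h4 := congrArg (C.ev x) (C.sum_p_mul_t b v w d)
    simp only [map_sum, map_mul] at h4
    rw [← h4]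
    refine Finset.sum_congr rfl fun i _ => ?_
    rw [← h3, Finset.mul_sum]
    exact Finset.sum_congr rfl fun j _ => by ring
  have e2 : ∑ i, ∑ j, C.ev x (C.p v (b j)) * C.ev x (C.p w (b i)) * C.ev x (C.t (b i) (b j) d) =
      C.ev x (C.t v w d) := by
    rw [Finset.sum_comm, ← e1]
    exact Finset.sum_congr rfl fun i _ => Finset.sum_congr rfl fun j _ => by
      rw [C.t_symm (b j)]
  have e3 : ∑ i, ∑ j, C.ev x (C.p (b i) (b j)) * C.ev x (C.t (b i) (b j) d) = 0 := by
    have h3 : ∀ i, ∑ j, C.ev x (C.p (b i) (b j)) * C.ev x (C.t (b i) (b j) d) =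
        C.ev x (C.t (b i) (b i) d) := fun i => by
      have := congrArg (C.ev x) (C.sum_p_mul_t b (b i) (b i) d)
      simp only [map_sum, map_mul, C.t_symm _ (b i)] at this
      rw [this]
    simp_rw [h3]
    have := congrArg (C.ev x) (C.trace_basis b d)
    simpa using this
  have h5 : ∀ i j, ⟪C.H x v w, C.H x (b i) (b j)⟫ * C.ev x (C.t (b i) (b j) d) =
      1 / 3 * (C.ev x (C.p v (b i)) * C.ev x (C.p w (b j)) * C.ev x (C.t (b i) (b j) d)) +
      1 / 3 * (C.ev x (C.p v (b j)) * C.ev x (C.p w (b i)) * C.ev x (C.t (b i) (b j) d)) -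
      1 / 3 * C.ev x (C.p v w) * (C.ev x (C.p (b i) (b j)) * C.ev x (C.t (b i) (b j) d)) :=
    fun i j => by rw [hV x]; ring
  rw [h2]
  simp_rw [h5, Finset.sum_sub_distrib, Finset.sum_add_distrib, ← Finset.mul_sum]
  rw [e1, e2, e3, map_smul, smul_eq_mul]
  ring

/-- For parallel `h` the derivative of `t` consists of corrections only. Those in the tangential
slots contract to zero with the second factor; the Weingarten term is left. -/
theorem sum_D_t_mul_t (hg : ∀ v a u c, C.gam v a u c = 0) (v c d : E) :
    ∑ i, ∑ j, C.D v (C.t (b i) (b j) c) * C.t (b i) (b j) d =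
      -∑ e, C.t v c (b e) * C.Kn b (b e) d := by
  have z1 : ∀ j u, ∑ i, C.F (b i) * C.t v u c * C.t (b i) (b j) d = 0 := fun j u => by
    have := C.sum_F_mul_t b (b j) d
    rw [← mul_zero (C.t v u c), ← this, Finset.mul_sum]
    exact Finset.sum_congr rfl fun i _ => by ring
  have z2 : ∀ j u, ∑ i, (∑ e, C.t v (b e) (b i) * C.t (b e) u c) * C.t (b i) (b j) d = 0 :=
    fun j u => by
    simp_rw [Finset.sum_mul]
    rw [Finset.sum_comm]
    refine Finset.sum_eq_zero fun e _ => ?_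
    have := C.sum_t_mul_t b v (b e) (b j) d
    rw [← mul_zero (C.t (b e) u c), ← this, Finset.mul_sum]
    exact Finset.sum_congr rfl fun i _ => by ring
  have z3 : ∑ i, ∑ j, (∑ e, C.t v c (b e) * C.t (b i) (b j) (b e)) * C.t (b i) (b j) d =
      ∑ e, C.t v c (b e) * C.Kn b (b e) d := by
    simp only [Kn, Finset.mul_sum, Finset.sum_mul]
    symm
    rw [Finset.sum_comm]
    refine Finset.sum_congr rfl fun i _ => ?_
    rw [Finset.sum_comm]
    exact Finset.sum_congr rfl fun j _ => Finset.sum_congr rfl fun e _ => by ring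
  have h : ∀ i j, C.D v (C.t (b i) (b j) c) * C.t (b i) (b j) d =
      -(C.F (b i) * C.t v (b j) c * C.t (b i) (b j) d)
      + (∑ e, C.t v (b e) (b i) * C.t (b e) (b j) c) * C.t (b i) (b j) d
      - C.F (b j) * C.t v (b i) c * C.t (b j) (b i) d
      + (∑ e, C.t v (b e) (b j) * C.t (b e) (b i) c) * C.t (b j) (b i) d
      - (∑ e, C.t v c (b e) * C.t (b i) (b j) (b e)) * C.t (b i) (b j) d := fun i j => by
    rw [C.D_t b, hg, C.t_symm (b j) (b i), C.t_symm (b i) v]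
    simp_rw [C.t_symm (b i) (b _) c]
    ring
  simp_rw [h, Finset.sum_sub_distrib, Finset.sum_add_distrib, Finset.sum_sub_distrib,
    Finset.sum_add_distrib, z3, Finset.sum_neg_distrib, z1, z2]
  have y1 : ∑ i, ∑ j, C.F (b i) * C.t v (b j) c * C.t (b i) (b j) d = 0 := by
    rw [Finset.sum_comm]; exact Finset.sum_eq_zero fun j _ => z1 j (b j)
  have y2 : ∑ i, ∑ j, (∑ e, C.t v (b e) (b i) * C.t (b e) (b j) c) * C.t (b i) (b j) d = 0 := by
    rw [Finset.sum_comm]; exact Finset.sum_eq_zero fun j _ => z2 j (b j)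
  rw [y1, y2]
  simp

theorem D_Kn (hg : ∀ v a u c, C.gam v a u c = 0) (hV : ∀ x, C.VeroneseAt x) (v c d : E) :
    C.D v (C.Kn b c d) = -(2 / 3 : ℝ) • (C.t v c d + C.t v d c) := by
  have h1 := C.sum_D_t_mul_t b hg v c d
  have h2 := C.sum_D_t_mul_t b hg v d c
  rw [C.sum_t_mul_Kn b hV] at h1 h2
  have h3 : C.D v (C.Kn b c d) = ∑ i, ∑ j, C.D v (C.t (b i) (b j) d) * C.t (b i) (b j) c +
      ∑ i, ∑ j, C.D v (C.t (b i) (b j) c) * C.t (b i) (b j) d := by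
    simp only [Kn, map_sum, Derivation.leibniz, smul_eq_mul, Finset.sum_add_distrib]
    simp_rw [mul_comm (C.t _ _ _) (C.D v _)]
  rw [h3, h1, h2]
  module

/-- The span of position, tangent space and first normal space is constant. -/
theorem D_osculating_eq_zero (hg : ∀ v a u c, C.gam v a u c = 0) (hV : ∀ x, C.VeroneseAt x)
    (v c d : E) :
    C.D v (C.F c * C.F d + C.p c d + (3 / 2 : ℝ) • C.Kn b c d) = 0 := by
  simp only [map_add, Derivation.leibniz, C.D_F, C.D_p, smul_eq_mul, Derivation.map_smul,
    C.D_Kn b hg hV, smul_smul]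
  norm_num
  ring

/-- The cubic form of the Veronese surface, in terms of the calculus at a point. -/
def cubic (a : E) : A := (2 : ℝ) • C.F a ^ 3 + (3 : ℝ) • (C.F a * C.p a a) -
  (9 : ℝ) • (C.F a * C.Kn b a a) + (9 : ℝ) • C.t a a a

/-- In an orthonormal frame adapted to the surface, `cubic` is twice Cartan's cubic polynomial, and
its four coefficients are those for which the derivatives cancel. Dimension two enters through the
squares of the shape operators, the Veronese relation through `|h(a, v)|`-type contractions and
`D_Kn`. -/
theorem D_cubic (hn : n = 2) (hg : ∀ v a u c, C.gam v a u c = 0) (hV : ∀ x, C.VeroneseAt x)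
    (v a : E) : C.D v (C.cubic b a) = 0 := by
  have h1 : ∑ e, C.t v (b e) a * C.t (b e) a a = (1 / 2 : ℝ) • (C.Kn b a a * C.p v a) :=
    C.sum_t_comp_surface b hn v a a
  have h1' : ∑ e, C.t v (b e) a * C.t a (b e) a = (1 / 2 : ℝ) • (C.Kn b a a * C.p v a) := by
    rw [← h1]
    exact Finset.sum_congr rfl fun e _ => by rw [C.t_symm a]
  have h2 : ∑ e, C.t v a (b e) * C.t a a (b e) = (1 / 3 : ℝ) • (C.p v a * C.p a a) := by
    refine C.ext _ _ fun x => ?_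
    simp only [map_sum, map_mul, map_smul, smul_eq_mul]
    rw [C.sum_t_mul b x v a (C.t a a), ← C.inner_H, real_inner_comm, hV x]
    ring
  simp only [cubic, map_add, map_sub, Derivation.map_smul, Derivation.leibniz, smul_eq_mul,
    Derivation.leibniz_pow, C.D_F, C.D_p, C.D_t b v a a a, hg, h1, h1', h2, C.D_Kn b hg hV,
    C.t_symm a v]
  simp only [Algebra.smul_def, map_neg,
    Nat.add_one_sub_one]
  have c3 : (algebraMap ℝ A) (1 / 3) * 3 = 1 := by
    rw [← map_ofNat (algebraMap ℝ A) 3, ← map_mul]; norm_num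
  have c2 : (algebraMap ℝ A) (1 / 2) * 2 = 1 := by
    rw [← map_ofNat (algebraMap ℝ A) 2, ← map_mul]; norm_num
  have c23 : (algebraMap ℝ A) (2 / 3) = 2 * (algebraMap ℝ A) (1 / 3) := by
    rw [← map_ofNat (algebraMap ℝ A) 2, ← map_mul]; norm_num
  rw [c23]
  simp only [map_ofNat]
  linear_combination (12 * C.F a * C.t v a a - 3 * C.p v a * C.p a a) * c3 +
    9 * C.Kn b a a * C.p v a * c2

end SphereCalculus

/-! ### The second fundamental form at a point -/

section Pointwise

variable {V : Type*} [NormedAddCommGroup V] [NormedSpace ℝ V]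
  {H : Type*} [TopologicalSpace H] (I : ModelWithCorners ℝ V H)
  {M : Type*} [TopologicalSpace M] [ChartedSpace H M]
  {E : Type*} [NormedAddCommGroup E] [InnerProductSpace ℝ E] [FiniteDimensional ℝ E]

/-- The derivative at `x` of a vector valued map, on the model space. -/
def differential {W : Type*} [NormedAddCommGroup W] [NormedSpace ℝ W] (F : M → W) (x : M) :
    V →L[ℝ] W := mvfderiv I F x

variable (F : M → E) (x : M)

theorem differential_mem (v : V) : differential I F x v ∈ tangentSubspace I F x :=
  LinearMap.mem_range.2 ⟨v, rfl⟩

theorem range_differential : LinearMap.range (differential I F x).toLinearMap =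
    tangentSubspace I F x := rfl

theorem differential_tangentLift (ξ : tangentSubspace I F x) :
    differential I F x (tangentLift I F x ξ) = ξ :=
  Classical.choose_spec (show ∃ v : TangentSpace I x, mvfderiv I F x v = ξ.1 from
    LinearMap.mem_range.mp ξ.2)

variable {I F x}

theorem tangentLift_eq (hF : Function.Injective (mvfderiv I F x)) {ξ : tangentSubspace I F x} {v : V} (h : differential I F x v = ξ) :
    tangentLift I F x ξ = v :=
  hF (show differential I F x _ = differential I F x v by rw [differential_tangentLift, h])

variable (hF : Function.Injective (mvfderiv I F x))

/-- The inverse of the differential of an immersion. -/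
def liftLinear : tangentSubspace I F x →ₗ[ℝ] V where
  toFun ξ := tangentLift I F x ξ
  map_add' ξ ζ := tangentLift_eq hF (by simp [differential_tangentLift])
  map_smul' r ξ := tangentLift_eq hF (by simp [differential_tangentLift])

/-- The second fundamental form as a bilinear map. -/
def sffBilin : tangentSubspace I F x →ₗ[ℝ] tangentSubspace I F x →ₗ[ℝ] E :=
  (((secondDerivative I F x).toLinearMap₁₂.compl₁₂ (liftLinear hF) (liftLinear hF)).compr₂
    (normalSubspace I F x).starProjection.toLinearMap)

theorem sffBilin_apply (ξ ζ : tangentSubspace I F x) :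
    sffBilin hF ξ ζ = secondFundamentalForm I F x ξ ζ := rfl

theorem finrank_tangentSubspace (hF : Function.Injective (mvfderiv I F x)) :
    Module.finrank ℝ (tangentSubspace I F x) = Module.finrank ℝ V :=
  LinearMap.finrank_range_of_inj (f := (differential I F x).toLinearMap) hF

theorem meanCurvature_eq {ι : Type*} [Fintype ι]
    (b : OrthonormalBasis ι ℝ (tangentSubspace I F x)) :
    meanCurvature I F x = (Module.finrank ℝ V : ℝ)⁻¹ • ∑ i, sffBilin hF (b i) (b i) := by
  have h : (Module.finrank ℝ (tangentSubspace I F x) : ℝ)⁻¹ = (Module.finrank ℝ V : ℝ)⁻¹ := by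
    rw [finrank_tangentSubspace hF]
  exact congrArg₂ (· • ·) h (sum_bilin_eq _ b (sffBilin hF))

theorem squaredLength_eq (hF : Function.Injective (mvfderiv I F x)) {ι : Type*} [Fintype ι]
    (b : OrthonormalBasis ι ℝ (tangentSubspace I F x)) :
    squaredLength I F x = ∑ i, ∑ j, ‖sffBilin hF (b i) (b j)‖ ^ 2 := by
  set s := stdOrthonormalBasis ℝ (tangentSubspace I F x)
  set B := sffBilin hF
  have h1 : ∀ ξ, ∑ j, ‖B ξ (s j)‖ ^ 2 = ∑ j, ‖B ξ (b j)‖ ^ 2 := fun ξ => by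
    have := sum_bilin_eq s b ((innerₗ E).compl₁₂ (B ξ) (B ξ))
    simpa [real_inner_self_eq_norm_sq] using this
  have h2 : ∀ ζ, ∑ j, ‖B (s j) ζ‖ ^ 2 = ∑ j, ‖B (b j) ζ‖ ^ 2 := fun ζ => by
    have := sum_bilin_eq s b ((innerₗ E).compl₁₂ (B.flip ζ) (B.flip ζ))
    simpa [real_inner_self_eq_norm_sq] using this
  change ∑ i, ∑ j, ‖B (s i) (s j)‖ ^ 2 = _
  simp_rw [h1]
  rw [Finset.sum_comm]
  simp_rw [h2]
  rw [Finset.sum_comm]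

end Pointwise

/-! ### Derivatives in a fixed chart -/

section Chart

variable {V : Type*} [NormedAddCommGroup V] [NormedSpace ℝ V]
  {H : Type*} [TopologicalSpace H] (I : ModelWithCorners ℝ V H) [I.Boundaryless]
  {M : Type*} [TopologicalSpace M] [ChartedSpace H M] [IsManifold I ∞ M]
  {W : Type*} [NormedAddCommGroup W] [NormedSpace ℝ W]

theorem contDiffOn_comp_symm {ψ : M → W} (hψ : ContMDiff I 𝓘(ℝ, W) ∞ ψ) (x₀ : M) :
    ContDiffOn ℝ ∞ (ψ ∘ (extChartAt I x₀).symm) (extChartAt I x₀).target := by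
  rw [← contMDiffOn_iff_contDiffOn]
  exact hψ.comp_contMDiffOn (contMDiffOn_extChartAt_symm x₀)

theorem contDiffAt_comp_symm {ψ : M → W} (hψ : ContMDiff I 𝓘(ℝ, W) ∞ ψ) {x₀ x : M}
    (hx : x ∈ (extChartAt I x₀).source) :
    ContDiffAt ℝ ∞ (ψ ∘ (extChartAt I x₀).symm) (extChartAt I x₀ x) :=
  (contDiffOn_comp_symm I hψ x₀).contDiffAt
    ((isOpen_extChartAt_target x₀).mem_nhds ((extChartAt I x₀).map_source hx))

theorem differential_eq_comp {ψ : M → W} (hψ : ContMDiff I 𝓘(ℝ, W) ∞ ψ) {x₀ x : M}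
    (hx : x ∈ (extChartAt I x₀).source) :
    differential I ψ x = (fderiv ℝ (ψ ∘ (extChartAt I x₀).symm) (extChartAt I x₀ x)).comp
      (differential I (extChartAt I x₀) x) := by
  have h1 : ψ =ᶠ[𝓝 x] (ψ ∘ (extChartAt I x₀).symm) ∘ extChartAt I x₀ := by
    filter_upwards [extChartAt_source_mem_nhds' hx] with z hz
    simp only [Function.comp_apply, (extChartAt I x₀).left_inv hz]
  have h2 : MDifferentiableAt I 𝓘(ℝ, V) (extChartAt I x₀) x :=
    mdifferentiableAt_extChartAt (by simpa using hx)
  have h3 : MDifferentiableAt 𝓘(ℝ, V) 𝓘(ℝ, W) (ψ ∘ (extChartAt I x₀).symm) (extChartAt I x₀ x) :=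
    ((contDiffAt_comp_symm I hψ hx).differentiableAt (by simp)).mdifferentiableAt
  have h4 := h1.mfderiv_eq (I := I) (I' := 𝓘(ℝ, W))
  have h5 := mfderiv_comp (I := I) (I' := 𝓘(ℝ, V)) (I'' := 𝓘(ℝ, W)) x h3 h2
  rw [mfderiv_eq_fderiv] at h5
  exact h4.trans h5

theorem differential_bijective {x₀ x : M} (hx : x ∈ (extChartAt I x₀).source) :
    Function.Bijective (differential I (extChartAt I x₀) x) := by
  have h := isInvertible_mfderiv_extChartAt (I := I) hx
  obtain ⟨e, he⟩ := h
  have : ⇑(differential I (extChartAt I x₀) x) = e := by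
    funext v
    exact (congrArg (fun L => L v) he).symm
  rw [this]
  exact e.bijective

theorem differential_eq_fderiv {ψ : M → W} (hψ : ContMDiff I 𝓘(ℝ, W) ∞ ψ) (x : M) :
    differential I ψ x = fderiv ℝ (ψ ∘ (extChartAt I x).symm) (extChartAt I x x) := by
  have h := ((hψ x).mdifferentiableAt (by simp)).mfderiv
  rw [I.range_eq_univ, fderivWithin_univ] at h
  exact h

end Chart

theorem sum_bilin_starProjection {E W : Type*} [NormedAddCommGroup E] [InnerProductSpace ℝ E]
    [FiniteDimensional ℝ E] [AddCommGroup W] [Module ℝ W] {ι ι' : Type*} [Fintype ι] [Fintype ι']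
    (b : OrthonormalBasis ι ℝ E) (T : Submodule ℝ E) (e : OrthonormalBasis ι' ℝ T)
    (B : T →ₗ[ℝ] T →ₗ[ℝ] W) :
    ∑ i, B (T.orthogonalProjectionOnto (b i)) (T.orthogonalProjectionOnto (b i)) =
      ∑ k, B (e k) (e k) := by
  classical
  have h1 : ∀ i, T.orthogonalProjectionOnto (b i) = ∑ k, ⟪(e k : E), b i⟫ • e k := fun i => by
    rw [← e.sum_repr' (T.orthogonalProjectionOnto (b i))]
    simp only [Submodule.inner_orthogonalProjectionOnto_eq_of_mem_left]
  simp_rw [h1, map_sum, LinearMap.sum_apply, map_smul, LinearMap.smul_apply, smul_smul]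
  rw [Finset.sum_comm]
  refine Finset.sum_congr rfl fun k _ => ?_
  rw [Finset.sum_comm]
  have h2 : ∀ l, ∑ i, (⟪(e l : E), b i⟫ * ⟪(e k : E), b i⟫) • B (e l) (e k) =
      if l = k then B (e l) (e k) else 0 := fun l => by
    rw [← Finset.sum_smul]
    have h3 : ∑ i, ⟪(e l : E), b i⟫ * ⟪(e k : E), b i⟫ = ⟪(e l : E), (e k : E)⟫ := by
      rw [← b.sum_inner_mul_inner]
      exact Finset.sum_congr rfl fun i _ => by rw [real_inner_comm (b i) (e k : E)]
    have h4 : ⟪(e l : E), (e k : E)⟫ = if l = k then 1 else 0 := by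
      simpa using orthonormal_iff_ite.1 e.orthonormal l k
    rw [h3, h4]
    split_ifs <;> simp
  simp_rw [mul_comm ⟪(e k : E), b _⟫]
  simp [h2]

/-! ### Smooth left inverses of injective linear maps -/

section PseudoInverse

variable {V E : Type*} [NormedAddCommGroup V] [InnerProductSpace ℝ V] [FiniteDimensional ℝ V]
  [NormedAddCommGroup E] [InnerProductSpace ℝ E] [FiniteDimensional ℝ E]

/-- The transpose of a linear map. -/
def transpose (A : V →L[ℝ] E) : E →L[ℝ] V :=
  ∑ i, (innerSL ℝ (A (stdOrthonormalBasis ℝ V i))).smulRight (stdOrthonormalBasis ℝ V i)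

theorem transpose_apply (A : V →L[ℝ] E) (a : E) : transpose A a =
    ∑ i, ⟪A (stdOrthonormalBasis ℝ V i), a⟫ • stdOrthonormalBasis ℝ V i := by
  simp [transpose]

theorem inner_transpose (A : V →L[ℝ] E) (a : E) (v : V) : ⟪v, transpose A a⟫ = ⟪A v, a⟫ := by
  conv_rhs => rw [← (stdOrthonormalBasis ℝ V).sum_repr' v]
  simp only [transpose_apply, inner_sum, real_inner_smul_right, map_sum, map_smul, sum_inner,
    real_inner_smul_left]
  exact Finset.sum_congr rfl fun i _ => by rw [real_inner_comm v, mul_comm]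

theorem contDiff_transpose : ContDiff ℝ ∞ (transpose : (V →L[ℝ] E) → E →L[ℝ] V) := by
  rw [contDiff_clm_apply_iff]
  intro a
  simp only [transpose_apply]
  exact ContDiff.sum fun i _ =>
    ((contDiff_id.clm_apply contDiff_const).inner ℝ contDiff_const).smul contDiff_const

/-- The left inverse `(AᵀA)⁻¹Aᵀ` of an injective linear map. -/
def pseudoInverse (A : V →L[ℝ] E) : E →L[ℝ] V :=
  ((transpose A).comp A).inverse.comp (transpose A)

theorem isInvertible_transpose_comp {A : V →L[ℝ] E} (hA : Function.Injective A) :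
    ((transpose A).comp A).IsInvertible := by
  have hinj : Function.Injective ((transpose A).comp A).toLinearMap := by
    rw [← LinearMap.ker_eq_bot, LinearMap.ker_eq_bot']
    intro v hv
    have h := inner_transpose A (A v) v
    have hv' : transpose A (A v) = 0 := hv
    rw [hv', inner_zero_right, eq_comm, inner_self_eq_zero] at h
    exact hA (by rw [h, map_zero])
  exact ⟨(LinearEquiv.ofInjectiveEndo _ hinj).toContinuousLinearEquiv, by ext v; rfl⟩

/-- Inversion is smooth at invertible maps, so the left inverse depends smoothly on `A`. This gives
smooth tangential fields without a choice of local frame. -/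
theorem contDiffAt_pseudoInverse {A : V →L[ℝ] E} (hA : Function.Injective A) :
    ContDiffAt ℝ ∞ (pseudoInverse : (V →L[ℝ] E) → E →L[ℝ] V) A := by
  have h1 := contDiff_transpose.contDiffAt (x := A)
  refine ContDiffAt.clm_comp ?_ h1
  exact ContDiffAt.comp (f := fun A : V →L[ℝ] E => (transpose A).comp A) A
    (isInvertible_transpose_comp hA).contDiffAt_map_inverse (h1.clm_comp contDiffAt_id)

theorem apply_pseudoInverse {A : V →L[ℝ] E} (hA : Function.Injective A) (a : E) :
    A (pseudoInverse A a) = (LinearMap.range A.toLinearMap).starProjection a := by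
  refine (Submodule.eq_starProjection_of_mem_of_inner_eq_zero (LinearMap.mem_range_self _ _)
    ?_).symm
  rintro _ ⟨v, rfl⟩
  have h : transpose A (A (pseudoInverse A a)) = transpose A a :=
    (isInvertible_transpose_comp hA).self_apply_inverse (transpose A a)
  change ⟪a - A (pseudoInverse A a), A v⟫ = 0
  rw [real_inner_comm, inner_sub_right, ← inner_transpose, ← inner_transpose, h, sub_self]

end PseudoInverse

/-! ### Derivatives along tangential parts of ambient vectors -/

section Directional

variable {V : Type*} [NormedAddCommGroup V] [InnerProductSpace ℝ V] [FiniteDimensional ℝ V]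
  {H : Type*} [TopologicalSpace H] (I : ModelWithCorners ℝ V H) [I.Boundaryless]
  {M : Type*} [TopologicalSpace M] [ChartedSpace H M] [IsManifold I ∞ M]
  {E : Type*} [NormedAddCommGroup E] [InnerProductSpace ℝ E] [FiniteDimensional ℝ E]
  {W : Type*} [NormedAddCommGroup W] [NormedSpace ℝ W]

/-- The tangent vector, in the model space, whose image is the tangential part of `a`. -/
def tangentialLift (F : M → E) (x : M) (a : E) : V :=
  tangentLift I F x ((tangentSubspace I F x).orthogonalProjectionOnto a)

/-- The derivative in the direction of the tangential part of `a`. -/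
def directional (F : M → E) (a : E) (ψ : M → W) (x : M) : W :=
  differential I ψ x (tangentialLift I F x a)

/-- In a chart, the vector field along which `directional` differentiates. -/
def chartLift (F : M → E) (x₀ : M) (y : V) : E →L[ℝ] V :=
  pseudoInverse (fderiv ℝ (F ∘ (extChartAt I x₀).symm) y)

variable {I} {F : M → E}

theorem directional_self (x : M) (a : E) :
    directional I F a F x = (tangentSubspace I F x).starProjection a :=
  differential_tangentLift I F x _

theorem tangentialLift_eq (hF : ∀ x, Function.Injective (mvfderiv I F x)) (x : M) (a : E) :
    tangentialLift I F x a = liftLinear (hF x) ((tangentSubspace I F x).orthogonalProjectionOnto a) :=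
  rfl

theorem injective_fderiv (hsm : ContMDiff I 𝓘(ℝ, E) ∞ F)
    (hF : ∀ x, Function.Injective (mvfderiv I F x)) {x₀ x : M}
    (hx : x ∈ (extChartAt I x₀).source) :
    Function.Injective (fderiv ℝ (F ∘ (extChartAt I x₀).symm) (extChartAt I x₀ x)) := by
  have h := differential_eq_comp I hsm hx
  have h2 := differential_bijective I hx
  intro u w huw
  obtain ⟨u', rfl⟩ := h2.2 u
  obtain ⟨w', rfl⟩ := h2.2 w
  have h3 : differential I F x u' = differential I F x w' := by rw [h]; exact huw
  rw [hF x h3]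

theorem range_fderiv (hsm : ContMDiff I 𝓘(ℝ, E) ∞ F) {x₀ x : M}
    (hx : x ∈ (extChartAt I x₀).source) :
    LinearMap.range (fderiv ℝ (F ∘ (extChartAt I x₀).symm) (extChartAt I x₀ x)).toLinearMap =
      tangentSubspace I F x := by
  rw [← range_differential, differential_eq_comp I hsm hx]
  ext ξ
  simp only [LinearMap.mem_range, ContinuousLinearMap.coe_coe, ContinuousLinearMap.comp_apply]
  constructor
  · rintro ⟨v, rfl⟩
    obtain ⟨u, rfl⟩ := (differential_bijective I hx).2 v
    exact ⟨u, rfl⟩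
  · rintro ⟨v, rfl⟩
    exact ⟨_, rfl⟩

/-- `tangentialLift` refers to the preferred chart at the moving point, which may jump. Read in one
fixed chart it becomes the smooth field `chartLift`. -/
theorem differential_tangentialLift (hsm : ContMDiff I 𝓘(ℝ, E) ∞ F)
    (hF : ∀ x, Function.Injective (mvfderiv I F x)) {x₀ x : M}
    (hx : x ∈ (extChartAt I x₀).source) (a : E) :
    differential I (extChartAt I x₀) x (tangentialLift I F x a) =
      chartLift I F x₀ (extChartAt I x₀ x) a := by
  refine injective_fderiv hsm hF hx ?_
  have h1 := congrArg (fun L => L (tangentialLift I F x a)) (differential_eq_comp I hsm hx)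
  have h2 : differential I F x (tangentialLift I F x a) =
    (tangentSubspace I F x).starProjection a := directional_self x a
  rw [h2] at h1
  rw [chartLift, apply_pseudoInverse (injective_fderiv hsm hF hx)]
  simp_rw [range_fderiv hsm hx]
  exact h1.symm

theorem directional_eq (hsm : ContMDiff I 𝓘(ℝ, E) ∞ F)
    (hF : ∀ x, Function.Injective (mvfderiv I F x)) {ψ : M → W} (hψ : ContMDiff I 𝓘(ℝ, W) ∞ ψ)
    {x₀ x : M} (hx : x ∈ (extChartAt I x₀).source) (a : E) :
    directional I F a ψ x = fderiv ℝ (ψ ∘ (extChartAt I x₀).symm) (extChartAt I x₀ x)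
      (chartLift I F x₀ (extChartAt I x₀ x) a) := by
  rw [directional, differential_eq_comp I hψ hx, ContinuousLinearMap.comp_apply,
    differential_tangentialLift hsm hF hx]

theorem contDiffAt_chartLift (hsm : ContMDiff I 𝓘(ℝ, E) ∞ F)
    (hF : ∀ x, Function.Injective (mvfderiv I F x)) {x₀ x : M}
    (hx : x ∈ (extChartAt I x₀).source) :
    ContDiffAt ℝ ∞ (chartLift I F x₀) (extChartAt I x₀ x) :=
  ContDiffAt.comp (f := fun y => fderiv ℝ (F ∘ (extChartAt I x₀).symm) y) _
    (contDiffAt_pseudoInverse (injective_fderiv hsm hF hx))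
    ((contDiffAt_comp_symm I hsm hx).fderiv_right (by simp))

theorem contMDiff_directional (hsm : ContMDiff I 𝓘(ℝ, E) ∞ F)
    (hF : ∀ x, Function.Injective (mvfderiv I F x)) {ψ : M → W} (hψ : ContMDiff I 𝓘(ℝ, W) ∞ ψ)
    (a : E) : ContMDiff I 𝓘(ℝ, W) ∞ (directional I F a ψ) := by
  intro x₀
  have h1 : ContDiffAt ℝ ∞ (fun y => fderiv ℝ (ψ ∘ (extChartAt I x₀).symm) y
      (chartLift I F x₀ y a)) (extChartAt I x₀ x₀) :=
    ((contDiffAt_comp_symm I hψ (mem_extChartAt_source x₀)).fderiv_right (by simp)).clm_apply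
      ((contDiffAt_chartLift hsm hF (mem_extChartAt_source x₀)).clm_apply contDiffAt_const)
  refine (h1.contMDiffAt.comp x₀ contMDiffAt_extChartAt).congr_of_eventuallyEq ?_
  filter_upwards [extChartAt_source_mem_nhds (I := I) x₀] with x hx
  exact directional_eq hsm hF hψ hx a

/-- The product rule in the chart. The second term, from the variation of the field, is a first
derivative of `ψ`. For the immersion itself it is tangent, so only the first term reaches the second
fundamental form. -/
theorem fderiv_directional (hsm : ContMDiff I 𝓘(ℝ, E) ∞ F)
    (hF : ∀ x, Function.Injective (mvfderiv I F x)) {ψ : M → W} (hψ : ContMDiff I 𝓘(ℝ, W) ∞ ψ)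
    (x : M) (a v : E) :
    directional I F v (directional I F a ψ) x =
      fderiv ℝ (fderiv ℝ (ψ ∘ (extChartAt I x).symm)) (extChartAt I x x)
        (tangentialLift I F x v) (tangentialLift I F x a) +
      differential I ψ x (fderiv ℝ (chartLift I F x) (extChartAt I x x)
        (tangentialLift I F x v) a) := by
  have hx := mem_extChartAt_source (I := I) x
  have hL : chartLift I F x (extChartAt I x x) a = tangentialLift I F x a := by
    have h2 := congrArg (fun L => L (tangentialLift I F x a)) (differential_eq_fderiv I hsm x)
    refine injective_fderiv hsm hF hx ?_
    rw [← h2, chartLift, apply_pseudoInverse (injective_fderiv hsm hF hx)]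
    simp_rw [range_fderiv hsm hx]
    exact (directional_self x a).symm
  rw [directional, differential_eq_fderiv I (contMDiff_directional hsm hF hψ a)]
  have h1 : directional I F a ψ ∘ (extChartAt I x).symm =ᶠ[𝓝 (extChartAt I x x)]
      fun y => fderiv ℝ (ψ ∘ (extChartAt I x).symm) y (chartLift I F x y a) := by
    filter_upwards [extChartAt_target_mem_nhds x] with y hy
    have h := directional_eq hsm hF hψ ((extChartAt I x).map_target hy) a
    rw [(extChartAt I x).right_inv hy] at h
    exact h
  rw [h1.fderiv_eq]
  have d1 : DifferentiableAt ℝ (fderiv ℝ (ψ ∘ (extChartAt I x).symm)) (extChartAt I x x) :=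
    ((contDiffAt_comp_symm I hψ hx).fderiv_right (m := ∞) (by simp)).differentiableAt (by simp)
  have d2 : DifferentiableAt ℝ (chartLift I F x) (extChartAt I x x) :=
    (contDiffAt_chartLift hsm hF hx).differentiableAt (by simp)
  rw [fderiv_clm_apply d1 (d2.clm_apply (differentiableAt_const a)),
    fderiv_clm_apply d2 (differentiableAt_const a)]
  simp only [add_apply, ContinuousLinearMap.comp_apply,
    ContinuousLinearMap.flip_apply, hL, differential_eq_fderiv I hψ x]
  simp [add_comm]

end Directional

/-! ### Smooth functions and components on a submanifold -/

section Instance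

variable {V : Type*} [NormedAddCommGroup V] [InnerProductSpace ℝ V] [FiniteDimensional ℝ V]
  {H : Type*} [TopologicalSpace H] {I : ModelWithCorners ℝ V H} [I.Boundaryless]
  {M : Type*} [TopologicalSpace M] [ChartedSpace H M] [IsManifold I ∞ M]
  {E : Type*} [NormedAddCommGroup E] [InnerProductSpace ℝ E] [FiniteDimensional ℝ E]

theorem differentiableAt_comp_symm {W : Type*} [NormedAddCommGroup W] [NormedSpace ℝ W]
    {ψ : M → W} (hψ : ContMDiff I 𝓘(ℝ, W) ∞ ψ) (x : M) :
    DifferentiableAt ℝ (ψ ∘ (extChartAt I x).symm) (extChartAt I x x) :=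
  (contDiffAt_comp_symm I hψ (mem_extChartAt_source x)).differentiableAt (by simp)

theorem contMDiff_inner {ψ χ : M → E} (hψ : ContMDiff I 𝓘(ℝ, E) ∞ ψ)
    (hχ : ContMDiff I 𝓘(ℝ, E) ∞ χ) : ContMDiff I 𝓘(ℝ) ∞ fun x => ⟪ψ x, χ x⟫ :=
  (contDiff_inner (𝕜 := ℝ) (E := E) (n := ∞)).contMDiff.comp (hψ.prodMk_space hχ)

theorem differential_inner {ψ χ : M → E} (hψ : ContMDiff I 𝓘(ℝ, E) ∞ ψ)
    (hχ : ContMDiff I 𝓘(ℝ, E) ∞ χ) (x : M) (u : V) :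
    differential I (fun x => ⟪ψ x, χ x⟫) x u =
      ⟪ψ x, differential I χ x u⟫ + ⟪differential I ψ x u, χ x⟫ := by
  rw [differential_eq_fderiv I (contMDiff_inner hψ hχ), differential_eq_fderiv I hψ,
    differential_eq_fderiv I hχ]
  have h := fderiv_inner_apply ℝ (differentiableAt_comp_symm hψ x)
    (differentiableAt_comp_symm hχ x) u
  simp only [Function.comp_apply, extChartAt_to_inv] at h
  exact h

theorem differential_inner_const {ψ : M → E} (hψ : ContMDiff I 𝓘(ℝ, E) ∞ ψ) (c : E) (x : M)
    (u : V) : differential I (fun x => ⟪ψ x, c⟫) x u = ⟪differential I ψ x u, c⟫ := by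
  have h : differential I (fun _ : M => c) x u = 0 := by
    rw [differential_eq_fderiv I contMDiff_const]
    simp [Function.comp_def]
  rw [differential_inner hψ contMDiff_const, h, inner_zero_right, zero_add]

namespace IsMinimalSubmanifold

variable {f : M → E} (hf : IsMinimalSubmanifold I f)

/-- The component of a vector valued function in a fixed direction. -/
def component {ψ : M → E} (hψ : ContMDiff I 𝓘(ℝ, E) ∞ ψ) : E →ₗ[ℝ] C^∞⟮I, M; ℝ⟯ where
  toFun a := ⟨fun x => ⟪ψ x, a⟫, contMDiff_inner hψ contMDiff_const⟩
  map_add' a b := by ext x; exact inner_add_right _ _ _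
  map_smul' r a := by ext x; exact real_inner_smul_right _ _ _

theorem component_apply {ψ : M → E} (hψ : ContMDiff I 𝓘(ℝ, E) ∞ ψ) (a : E) (x : M) :
    component hψ a x = ⟪ψ x, a⟫ := rfl

/-- The derivation of the algebra of smooth functions in the direction of the tangential part of a
vector. -/
def derivation : E →ₗ[ℝ] Derivation ℝ C^∞⟮I, M; ℝ⟯ C^∞⟮I, M; ℝ⟯ where
  toFun a := Derivation.mk'
    { toFun := fun φ => ⟨directional I f a φ,
        contMDiff_directional hf.contMDiff hf.immersion φ.contMDiff a⟩
      map_add' := fun φ χ => by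
        ext x
        have := mvfderiv_add (φ.contMDiff.mdifferentiable (by simp) x)
          (χ.contMDiff.mdifferentiable (by simp) x)
        exact congrArg (fun L : V →L[ℝ] ℝ => L (tangentialLift I f x a)) this
      map_smul' := fun r φ => by
        ext x
        have := mvfderiv_smul (I := I) (a := fun _ : M => r) (x := x) mdifferentiableAt_const
          (φ.contMDiff.mdifferentiable (by simp) x)
        rw [mvfderiv_const] at this
        have h2 := congrArg (fun L : V →L[ℝ] ℝ => L (tangentialLift I f x a)) this
        refine h2.trans ?_
        change r * directional I f a φ x + (0 : ℝ) • φ x = r * directional I f a φ x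
        rw [zero_smul, add_zero] }
    fun φ χ => by
      ext x
      have := mvfderiv_mul (φ.contMDiff.mdifferentiable (by simp) x)
        (χ.contMDiff.mdifferentiable (by simp) x)
      exact congrArg (fun L : V →L[ℝ] ℝ => L (tangentialLift I f x a)) this
  map_add' a b := by
    ext φ x
    change differential I φ x _ = differential I φ x _ + differential I φ x _
    rw [tangentialLift_eq hf.immersion, map_add, map_add, map_add]
    rfl
  map_smul' r a := by
    ext φ x
    change differential I φ x _ = r • differential I φ x _
    rw [tangentialLift_eq hf.immersion, map_smul, map_smul, map_smul]
    rfl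

theorem derivation_component {ψ : M → E} (hψ : ContMDiff I 𝓘(ℝ, E) ∞ ψ) (v a : E) :
    hf.derivation v (component hψ a) =
      component (contMDiff_directional hf.contMDiff hf.immersion hψ v) a := by
  ext x
  exact differential_inner_const hψ a x _

/-- The projection to the tangent space, as a map to the ambient space. -/
theorem contMDiff_proj (hf : IsMinimalSubmanifold I f) (a : E) : ContMDiff I 𝓘(ℝ, E) ∞ (directional I f a f) :=
  contMDiff_directional hf.contMDiff hf.immersion hf.contMDiff a

/-- The components of the projection to the tangent space. -/
def proj : E →ₗ[ℝ] E →ₗ[ℝ] C^∞⟮I, M; ℝ⟯ where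
  toFun a := component (hf.contMDiff_proj a)
  map_add' a b := by
    ext c x
    change ⟪directional I f (a + b) f x, c⟫ =
      ⟪directional I f a f x, c⟫ + ⟪directional I f b f x, c⟫
    simp only [directional_self, map_add, inner_add_left]
  map_smul' r a := by
    ext c x
    change ⟪directional I f (r • a) f x, c⟫ = r * ⟪directional I f a f x, c⟫
    simp only [directional_self, map_smul, real_inner_smul_left]

theorem proj_apply (a c : E) (x : M) :
    hf.proj a c x = ⟪(tangentSubspace I f x).starProjection a, c⟫ := by
  rw [← directional_self]
  rfl

/-- The second derivative of the position vector along the tangential parts of two vectors. -/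
def hess (x : M) (v a : E) : E := directional I f v (directional I f a f) x

theorem derivation_proj (v a c : E) (x : M) :
    hf.derivation v (hf.proj a c) x = ⟪hess (I := I) (f := f) x v a, c⟫ := by
  have := hf.derivation_component (hf.contMDiff_proj a) v c
  exact congrArg (fun φ : C^∞⟮I, M; ℝ⟯ => φ x) this

/-- The components of the second fundamental form. -/
def second : E →ₗ[ℝ] E →ₗ[ℝ] E →ₗ[ℝ] C^∞⟮I, M; ℝ⟯ :=
  LinearMap.mk₂ ℝ (fun v a =>
    ((hf.derivation v : _ →ₗ[ℝ] _) ∘ₗ hf.proj a)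
      - (∑ g, (LinearMap.mulLeft ℝ (hf.derivation v
          (hf.proj a (stdOrthonormalBasis ℝ E g)))) ∘ₗ hf.proj (stdOrthonormalBasis ℝ E g))
      + (LinearMap.mulRight ℝ (hf.proj v a)) ∘ₗ component hf.contMDiff)
    (fun v w a => by
      ext1 c
      simp only [map_add, LinearMap.add_apply, LinearMap.sub_apply, LinearMap.comp_apply,
        LinearMap.sum_apply, LinearMap.mulLeft_apply, LinearMap.mulRight_apply,
        Derivation.coeFn_coe, Derivation.add_apply, add_mul, mul_add, Finset.sum_add_distrib]
      ring)
    (fun r v a => by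
      ext1 c
      simp only [map_smul, LinearMap.add_apply, LinearMap.sub_apply, LinearMap.comp_apply,
        LinearMap.sum_apply, LinearMap.mulLeft_apply, LinearMap.mulRight_apply,
        LinearMap.smul_apply, Derivation.coeFn_coe, Derivation.smul_apply, smul_mul_assoc,
        mul_smul_comm, ← Finset.smul_sum, smul_add, smul_sub])
    (fun v a b => by
      ext1 c
      simp only [map_add, LinearMap.add_apply, LinearMap.sub_apply, LinearMap.comp_apply,
        LinearMap.sum_apply, LinearMap.mulLeft_apply, LinearMap.mulRight_apply,
        Derivation.coeFn_coe, add_mul, mul_add, Finset.sum_add_distrib]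
      ring)
    (fun r v a => by
      ext1 c
      simp only [map_smul, LinearMap.add_apply, LinearMap.sub_apply, LinearMap.comp_apply,
        LinearMap.sum_apply, LinearMap.mulLeft_apply, LinearMap.mulRight_apply,
        LinearMap.smul_apply, Derivation.coeFn_coe, Derivation.map_smul, smul_mul_assoc,
        mul_smul_comm, ← Finset.smul_sum, smul_add, smul_sub])

theorem second_eq (v a c : E) : hf.second v a c = hf.derivation v (hf.proj a c)
    - ∑ g, hf.derivation v (hf.proj a (stdOrthonormalBasis ℝ E g)) *
        hf.proj (stdOrthonormalBasis ℝ E g) c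
    + component hf.contMDiff c * hf.proj v a := by
  simp [second, LinearMap.sum_apply]

end IsMinimalSubmanifold

end Instance

theorem starProjection_normalSubspace {V : Type*} [NormedAddCommGroup V] [NormedSpace ℝ V]
    {H : Type*} [TopologicalSpace H] {I : ModelWithCorners ℝ V H}
    {M : Type*} [TopologicalSpace M] [ChartedSpace H M]
    {E : Type*} [NormedAddCommGroup E] [InnerProductSpace ℝ E] [FiniteDimensional ℝ E]
    {F : M → E} {x : M} (h1 : ‖F x‖ = 1) (h2 : F x ∈ (tangentSubspace I F x)ᗮ) (a : E) :
    (normalSubspace I F x).starProjection a =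
      a - (tangentSubspace I F x).starProjection a - ⟪F x, a⟫ • F x := by
  set T := tangentSubspace I F x
  refine Submodule.eq_starProjection_of_mem_orthogonal ?_ ?_
  · rw [normalSubspace, ← Submodule.inf_orthogonal, Submodule.mem_inf]
    refine ⟨Submodule.sub_mem _ (Submodule.sub_starProjection_mem_orthogonal a)
      (Submodule.smul_mem _ _ h2), ?_⟩
    rw [Submodule.mem_orthogonal_singleton_iff_inner_right, inner_sub_right, inner_sub_right,
      real_inner_smul_right, real_inner_self_eq_norm_sq, h1,
      (Submodule.mem_orthogonal' _ _).1 h2 _ (Submodule.starProjection_apply_mem T a)]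
    ring
  · have h : a - (a - T.starProjection a - ⟪F x, a⟫ • F x) =
        T.starProjection a + ⟪F x, a⟫ • F x := by abel
    rw [h, normalSubspace, Submodule.orthogonal_orthogonal]
    exact Submodule.add_mem_sup (Submodule.starProjection_apply_mem T a)
      (Submodule.smul_mem _ _ (Submodule.mem_span_singleton_self _))

/-! ### A minimal submanifold as a `SphereCalculus` -/

namespace IsMinimalSubmanifold

variable {V : Type*} [NormedAddCommGroup V] [InnerProductSpace ℝ V] [FiniteDimensional ℝ V]
  {H : Type*} [TopologicalSpace H] {I : ModelWithCorners ℝ V H} [I.Boundaryless]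
  {M : Type*} [TopologicalSpace M] [ChartedSpace H M] [IsManifold I ∞ M]
  {E : Type*} [NormedAddCommGroup E] [InnerProductSpace ℝ E] [FiniteDimensional ℝ E]
  {f : M → E} (hf : IsMinimalSubmanifold I f)

theorem differential_const {W : Type*} [NormedAddCommGroup W] [NormedSpace ℝ W] (c : W) (x : M)
    (u : V) : differential I (fun _ : M => c) x u = 0 := by
  rw [differential_eq_fderiv I contMDiff_const]
  simp [Function.comp_def]

theorem mem_orthogonal_tangentSubspace (hf : IsMinimalSubmanifold I f) (x : M) :
    f x ∈ (tangentSubspace I f x)ᗮ := by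
  rw [Submodule.mem_orthogonal]
  rintro _ ⟨u, rfl⟩
  have h := differential_inner hf.contMDiff hf.contMDiff x u
  have h2 : (fun x => ⟪f x, f x⟫) = fun _ => (1 : ℝ) := by
    funext x
    rw [real_inner_self_eq_norm_sq, hf.norm_eq_one, one_pow]
  have h3 := differential_const (I := I) (1 : ℝ) x u
  rw [h2, h3, real_inner_comm] at h
  have h4 : ⟪differential I f x u, f x⟫ = 0 := by linarith
  exact h4

theorem inner_hess_self (hf : IsMinimalSubmanifold I f) (x : M) (v a : E) :
    ⟪hess (I := I) (f := f) x v a, f x⟫ = -⟪(tangentSubspace I f x).starProjection v, a⟫ := by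
  have h := differential_inner (hf.contMDiff_proj a) hf.contMDiff x (tangentialLift I f x v)
  have h2 : (fun x => ⟪directional I f a f x, f x⟫) = fun _ => (0 : ℝ) := by
    funext x
    rw [directional_self]
    exact (Submodule.mem_orthogonal _ _).1 (hf.mem_orthogonal_tangentSubspace x) _
      (Submodule.starProjection_apply_mem _ _)
  have h3 := differential_const (I := I) (0 : ℝ) x (tangentialLift I f x v)
  have h4 : differential I f x (tangentialLift I f x v) =
    (tangentSubspace I f x).starProjection v := directional_self x v
  rw [h2, h3, h4, directional_self, Submodule.inner_starProjection_left_eq_right,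
    (Submodule.starProjection_eq_self_iff.2 (Submodule.starProjection_apply_mem _ v)),
    real_inner_comm] at h
  have h5 : hess (I := I) (f := f) x v a =
    differential I (directional I f a f) x (tangentialLift I f x v) := rfl
  rw [h5]
  linarith

theorem starProjection_hess (hf : IsMinimalSubmanifold I f) (x : M) (v a : E) :
    (normalSubspace I f x).starProjection (hess (I := I) (f := f) x v a) =
      sffBilin (hf.immersion x) ((tangentSubspace I f x).orthogonalProjectionOnto v)
        ((tangentSubspace I f x).orthogonalProjectionOnto a) := by
  have h := fderiv_directional hf.contMDiff hf.immersion hf.contMDiff x a v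
  have h0 : hess (I := I) (f := f) x v a = _ := h
  rw [h0, map_add, sffBilin_apply]
  have h2 : ∀ u, (normalSubspace I f x).starProjection (differential I f x u) = 0 := fun u => by
    rw [Submodule.starProjection_apply_eq_zero_iff, normalSubspace, Submodule.orthogonal_orthogonal]
    exact Submodule.mem_sup_left (differential_mem I f x u)
  rw [h2, add_zero]
  rfl

/-- `second` is built algebraically from derivatives of `proj`, which makes it smooth and
multilinear at once. The sum over the basis subtracts the tangential part of the Hessian, and the
last term its component along the position. -/
theorem second_apply (v a c : E) (x : M) : hf.second v a c x =
    ⟪sffBilin (hf.immersion x) ((tangentSubspace I f x).orthogonalProjectionOnto v)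
        ((tangentSubspace I f x).orthogonalProjectionOnto a), c⟫ := by
  rw [← hf.starProjection_hess, Submodule.inner_starProjection_left_eq_right,
    starProjection_normalSubspace (hf.norm_eq_one x) (hf.mem_orthogonal_tangentSubspace x),
    inner_sub_right, inner_sub_right, real_inner_smul_right, hf.inner_hess_self]
  have h := congrArg (fun φ : C^∞⟮I, M; ℝ⟯ => φ x) (hf.second_eq v a c)
  have e : ∀ φ : C^∞⟮I, M; ℝ⟯, φ x = (Pi.evalAlgHom ℝ (fun _ : M => ℝ) x).comp
    ContMDiffMap.coeFnAlgHom φ := fun _ => rfl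
  simp only [e, map_add, map_sub, map_mul, map_sum] at h
  simp only [← e, hf.derivation_proj, hf.proj_apply, component_apply] at h
  rw [h]
  have h2 : ∑ g, ⟪hess (I := I) (f := f) x v a, stdOrthonormalBasis ℝ E g⟫ *
      ⟪(tangentSubspace I f x).starProjection (stdOrthonormalBasis ℝ E g), c⟫ =
      ⟪hess (I := I) (f := f) x v a, (tangentSubspace I f x).starProjection c⟫ := by
    rw [← (stdOrthonormalBasis ℝ E).sum_inner_mul_inner]
    simp_rw [Submodule.inner_starProjection_left_eq_right]
  rw [h2]
  ring

theorem directional_comm (hf : IsMinimalSubmanifold I f) {W : Type*} [NormedAddCommGroup W]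
    [NormedSpace ℝ W] {ψ : M → W} (hψ : ContMDiff I 𝓘(ℝ, W) ∞ ψ) (x : M) (v a : E) :
    directional I f v (directional I f a ψ) x - directional I f a (directional I f v ψ) x =
      differential I ψ x (fderiv ℝ (chartLift I f x) (extChartAt I x x)
        (tangentialLift I f x v) a - fderiv ℝ (chartLift I f x) (extChartAt I x x)
        (tangentialLift I f x a) v) := by
  rw [fderiv_directional hf.contMDiff hf.immersion hψ,
    fderiv_directional hf.contMDiff hf.immersion hψ, map_sub]
  have hs := (contDiffAt_comp_symm I hψ (mem_extChartAt_source x)).isSymmSndFDerivAt (by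
    rw [minSmoothness_of_isRCLikeNormedField]; exact ENat.LEInfty.out)
  rw [hs.eq (tangentialLift I f x v)]
  abel

/-- By symmetry of second derivatives the commutator is a first-order operator, given by one vector
`w` for all functions. Applied to the immersion it shows the ambient image of `w`, which determines
the bracket. -/
theorem hess_symm (hf : IsMinimalSubmanifold I f) (x : M) (v a : E) :
    ∃ w : V, hess (I := I) (f := f) x v a - hess (I := I) (f := f) x a v = differential I f x w ∧
      ∀ φ : C^∞⟮I, M; ℝ⟯, hf.derivation v (hf.derivation a φ) x -
        hf.derivation a (hf.derivation v φ) x = differential I φ x w :=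
  ⟨_, hf.directional_comm hf.contMDiff x v a, fun φ => hf.directional_comm φ.contMDiff x v a⟩

/-- The differential calculus of a minimal submanifold. -/
def sphereCalculus {n : ℕ} (hn : Module.finrank ℝ V = n) :
    SphereCalculus E n M C^∞⟮I, M; ℝ⟯ where
  ev x := (Pi.evalAlgHom ℝ (fun _ : M => ℝ) x).comp ContMDiffMap.coeFnAlgHom
  ext φ ψ h := by ext x; exact h x
  D := hf.derivation
  F := component hf.contMDiff
  p := hf.proj
  t := hf.second
  pt := f
  T := tangentSubspace I f
  norm_pt := hf.norm_eq_one
  pt_mem := hf.mem_orthogonal_tangentSubspace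
  finrank_T x := (finrank_tangentSubspace (hf.immersion x)).trans hn
  ev_F x a := rfl
  ev_p x a b := hf.proj_apply a b x
  D_orth x a ha φ := by
    change differential I φ x (tangentialLift I f x a) = 0
    rw [tangentialLift_eq hf.immersion,
      (Submodule.orthogonalProjectionOnto_eq_zero_iff (v := a)).2 ha, map_zero, map_zero]
  t_symm a b c := by
    ext x
    have hs := (contDiffAt_comp_symm I hf.contMDiff (mem_extChartAt_source x)).isSymmSndFDerivAt (by
      rw [minSmoothness_of_isRCLikeNormedField]; exact ENat.LEInfty.out)
    rw [second_apply, second_apply, sffBilin_apply, sffBilin_apply, secondFundamentalForm,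
      secondFundamentalForm, secondDerivative, hs.eq]
  t_orth x a ha b c := by
    change hf.second a b c x = 0
    rw [second_apply, (Submodule.orthogonalProjectionOnto_eq_zero_iff (v := a)).2 ha, map_zero,
      LinearMap.zero_apply, inner_zero_left]
  t_tan x c hc a b := by
    change hf.second a b c x = 0
    rw [second_apply, real_inner_comm]
    refine (Submodule.mem_orthogonal _ _).1 (Submodule.starProjection_apply_mem
      (normalSubspace I f x) _) c (Submodule.mem_sup_left hc)
  t_pt x a b := by
    change hf.second a b (f x) x = 0
    rw [second_apply, real_inner_comm]
    refine (Submodule.mem_orthogonal _ _).1 (Submodule.starProjection_apply_mem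
      (normalSubspace I f x) _) _ (Submodule.mem_sup_right (Submodule.mem_span_singleton_self _))
  D_F v a := hf.derivation_component hf.contMDiff v a
  D_p v a b := by
    ext x
    change hf.derivation v (hf.proj a b) x = hf.second v a b x + hf.second v b a x -
      ⟪f x, b⟫ * hf.proj v a x - ⟪f x, a⟫ * hf.proj v b x
    have h1 : hf.proj a b = hf.proj b a := by
      ext y
      rw [proj_apply, proj_apply, Submodule.inner_starProjection_left_eq_right, real_inner_comm]
    have h2 : ⟪hess (I := I) (f := f) x v b, a⟫ = ⟪hess (I := I) (f := f) x v a, b⟫ := by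
      rw [← hf.derivation_proj, ← hf.derivation_proj, h1]
    -- Since projections are idempotent and symmetric, `p a b` is the inner product of two
    -- tangential parts. Its derivative involves two Hessians, each of which `h6` expresses by
    -- `second`.
    have h3 := differential_inner (hf.contMDiff_proj a) (hf.contMDiff_proj b) x
      (tangentialLift I f x v)
    have h4 : (fun x => ⟪directional I f a f x, directional I f b f x⟫) = hf.proj a b := by
      funext y
      rw [proj_apply, directional_self, directional_self,
        ← Submodule.inner_starProjection_left_eq_right,
        (Submodule.starProjection_eq_self_iff.2 (Submodule.starProjection_apply_mem _ a))]
    have h5 : hf.derivation v (hf.proj a b) x =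
      ⟪(tangentSubspace I f x).starProjection a, hess (I := I) (f := f) x v b⟫ +
      ⟪hess (I := I) (f := f) x v a, (tangentSubspace I f x).starProjection b⟫ := by
      rw [h4, directional_self, directional_self] at h3
      exact h3
    have h6 : ∀ a b, hf.second v a b x = ⟪hess (I := I) (f := f) x v a, b⟫ -
        ⟪hess (I := I) (f := f) x v a, (tangentSubspace I f x).starProjection b⟫ +
        ⟪f x, b⟫ * hf.proj v a x := by
      intro a b
      rw [second_apply, ← hf.starProjection_hess, Submodule.inner_starProjection_left_eq_right,
        starProjection_normalSubspace (hf.norm_eq_one x) (hf.mem_orthogonal_tangentSubspace x),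
        inner_sub_right, inner_sub_right, real_inner_smul_right, hf.inner_hess_self, proj_apply]
      ring
    rw [h6, h6, h2]
    rw [hf.derivation_proj, real_inner_comm (hess (I := I) (f := f) x v b)] at h5
    rw [hf.derivation_proj]
    linarith
  comm x v w φ z hz := by
    obtain ⟨u, hu, hφ⟩ := hf.hess_symm x v w
    change hf.derivation v (hf.derivation w φ) x - hf.derivation w (hf.derivation v φ) x =
      differential I φ x (tangentialLift I f x z)
    have h1 : z = differential I f x u := by
      rw [← hu]
      refine ext_inner_right ℝ fun d => ?_
      rw [hz d, inner_sub_left, ← hf.derivation_proj, ← hf.derivation_proj]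
      rfl
    have h2 : tangentialLift I f x z = u := by
      refine tangentLift_eq (hf.immersion x) ?_
      have h3 := Submodule.starProjection_eq_self_iff.2 (differential_mem I f x u)
      rw [h1]
      exact h3.symm
    rw [hφ, h2]
  trace c := by
    ext x
    change (Pi.evalAlgHom ℝ (fun _ : M => ℝ) x).comp ContMDiffMap.coeFnAlgHom _ = 0
    rw [map_sum]
    change ∑ i, hf.second _ _ c x = 0
    simp_rw [second_apply]
    rw [← sum_inner, sum_bilin_starProjection _ _ (stdOrthonormalBasis ℝ _)]
    have h := meanCurvature_eq (hf.immersion x) (stdOrthonormalBasis ℝ (tangentSubspace I f x))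
    rw [hf.meanCurvature_eq_zero, eq_comm, smul_eq_zero] at h
    -- The factor `n⁻¹` is zero when `n = 0`; in that case the sum is empty.
    rcases h with h | h
    · have h0 : Module.finrank ℝ (tangentSubspace I f x) = 0 := by
        rw [finrank_tangentSubspace (hf.immersion x)]
        simpa using h
      have : IsEmpty (Fin (Module.finrank ℝ (tangentSubspace I f x))) := by
        rw [h0]; infer_instance
      simp
    · rw [h, inner_zero_left]

end IsMinimalSubmanifold

/-! ### Traces and norms over ambient bases -/

section Ambient

variable {V : Type*} [NormedAddCommGroup V] [NormedSpace ℝ V]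
  {H : Type*} [TopologicalSpace H] {I : ModelWithCorners ℝ V H}
  {M : Type*} [TopologicalSpace M] [ChartedSpace H M]
  {E : Type*} [NormedAddCommGroup E] [InnerProductSpace ℝ E] [FiniteDimensional ℝ E]
  {F : M → E} {x : M} (hF : Function.Injective (mvfderiv I F x))
  {ι : Type*} [Fintype ι] (b : OrthonormalBasis ι ℝ E)

/-- The second fundamental form applied to the tangential parts of two vectors. -/
def sffAmbient : E →ₗ[ℝ] E →ₗ[ℝ] E :=
  (sffBilin hF).compl₁₂ (tangentSubspace I F x).orthogonalProjectionOnto.toLinearMap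
    (tangentSubspace I F x).orthogonalProjectionOnto.toLinearMap

theorem sffAmbient_apply (v a : E) : sffAmbient hF v a =
    sffBilin hF ((tangentSubspace I F x).orthogonalProjectionOnto v)
      ((tangentSubspace I F x).orthogonalProjectionOnto a) := rfl

theorem meanCurvature_eq_sum : meanCurvature I F x =
    (Module.finrank ℝ V : ℝ)⁻¹ • ∑ i, sffAmbient hF (b i) (b i) := by
  rw [meanCurvature_eq hF (stdOrthonormalBasis ℝ _), ← sum_bilin_starProjection b]
  rfl

theorem squaredLength_eq_sum : squaredLength I F x =
    ∑ i, ∑ j, ‖sffAmbient hF (b i) (b j)‖ ^ 2 := by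
  set T := tangentSubspace I F x
  set s := stdOrthonormalBasis ℝ T
  set B := sffBilin hF
  have h1 : ∀ ξ, ∑ j, ‖B ξ (T.orthogonalProjectionOnto (b j))‖ ^ 2 = ∑ j, ‖B ξ (s j)‖ ^ 2 :=
    fun ξ => by
      have := sum_bilin_starProjection b T s ((innerₗ E).compl₁₂ (B ξ) (B ξ))
      simpa [real_inner_self_eq_norm_sq] using this
  have h2 : ∀ ζ, ∑ j, ‖B (T.orthogonalProjectionOnto (b j)) ζ‖ ^ 2 = ∑ j, ‖B (s j) ζ‖ ^ 2 :=
    fun ζ => by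
      have := sum_bilin_starProjection b T s ((innerₗ E).compl₁₂ (B.flip ζ) (B.flip ζ))
      simpa [real_inner_self_eq_norm_sq] using this
  rw [squaredLength_eq hF s]
  symm
  calc ∑ i, ∑ j, ‖sffAmbient hF (b i) (b j)‖ ^ 2
      = ∑ i, ∑ j, ‖B (T.orthogonalProjectionOnto (b i)) (s j)‖ ^ 2 :=
        Finset.sum_congr rfl fun i _ => h1 _
    _ = ∑ j, ∑ i, ‖B (T.orthogonalProjectionOnto (b i)) (s j)‖ ^ 2 := Finset.sum_comm
    _ = ∑ j, ∑ i, ‖B (s i) (s j)‖ ^ 2 := Finset.sum_congr rfl fun i _ => h2 _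
    _ = ∑ i, ∑ j, ‖B (s i) (s j)‖ ^ 2 := Finset.sum_comm

theorem sum_starProjection_sq (T : Submodule ℝ E) :
    ∑ i, ∑ j, ⟪T.starProjection (b i), b j⟫ ^ 2 = Module.finrank ℝ T := by
  have h := sum_bilin_starProjection b T (stdOrthonormalBasis ℝ T) (innerₗ T)
  have h2 : ∀ i, ∑ j, ⟪T.starProjection (b i), b j⟫ ^ 2 =
      ⟪T.orthogonalProjectionOnto (b i), T.orthogonalProjectionOnto (b i)⟫ := fun i => by
    change _ = ⟪T.starProjection (b i), T.starProjection (b i)⟫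
    have := b.sum_inner_mul_inner (T.starProjection (b i)) (T.starProjection (b i))
    rw [← this]
    exact Finset.sum_congr rfl fun j _ => by rw [sq, real_inner_comm (b j)]
  simp_rw [h2]
  simp only [innerₗ_apply_apply] at h
  rw [h]
  simp

theorem sum_starProjection_self (T : Submodule ℝ E) :
    ∑ i, ⟪T.starProjection (b i), b i⟫ = Module.finrank ℝ T := by
  have h := sum_bilin_starProjection b T (stdOrthonormalBasis ℝ T) (innerₗ T)
  have h2 : ∀ i, ⟪T.starProjection (b i), b i⟫ =
      ⟪T.orthogonalProjectionOnto (b i), T.orthogonalProjectionOnto (b i)⟫ := fun i => by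
    change _ = ⟪T.starProjection (b i), T.starProjection (b i)⟫
    rw [← Submodule.inner_starProjection_left_eq_right,
      Submodule.starProjection_eq_self_iff.2 (Submodule.starProjection_apply_mem _ _)]
  simp_rw [h2]
  simp only [innerₗ_apply_apply] at h
  rw [h]
  simp

end Ambient

namespace IsMinimalSubmanifold

variable {V : Type*} [NormedAddCommGroup V] [InnerProductSpace ℝ V] [FiniteDimensional ℝ V]
  {H : Type*} [TopologicalSpace H] {I : ModelWithCorners ℝ V H} [I.Boundaryless]
  {M : Type*} [TopologicalSpace M] [ChartedSpace H M] [IsManifold I ∞ M]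
  {E : Type*} [NormedAddCommGroup E] [InnerProductSpace ℝ E] [FiniteDimensional ℝ E]
  {f : M → E} (hf : IsMinimalSubmanifold I f) {ι : Type*} [Fintype ι] (b : OrthonormalBasis ι ℝ E)

theorem sum_second_sq (x : M) :
    ∑ i, ∑ j, ∑ k, hf.second (b i) (b j) (b k) x ^ 2 = squaredLength I f x := by
  rw [squaredLength_eq_sum (hf.immersion x) b]
  refine Finset.sum_congr rfl fun i _ => Finset.sum_congr rfl fun j _ => ?_
  simp_rw [second_apply]
  rw [← real_inner_self_eq_norm_sq, ← b.sum_inner_mul_inner]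
  exact Finset.sum_congr rfl fun k _ => by
    change ⟪sffAmbient (hf.immersion x) (b i) (b j), b k⟫ ^ 2 = _
    rw [sq, real_inner_comm (b k)]

theorem sum_second_sq_eq_algebraMap {s : ℝ} (hs : ∀ x, squaredLength I f x = s) :
    ∑ i, ∑ j, ∑ k, hf.second (b i) (b j) (b k) ^ 2 = algebraMap ℝ C^∞⟮I, M; ℝ⟯ s := by
  ext x
  change (Pi.evalAlgHom ℝ (fun _ : M => ℝ) x).comp ContMDiffMap.coeFnAlgHom _ = s
  simp only [map_sum, map_pow]
  rw [← hs x, ← hf.sum_second_sq b]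
  rfl

theorem tangentialLift_differential (hf : IsMinimalSubmanifold I f) (x : M) (u : V) :
    tangentialLift I f x (differential I f x u) = u := by
  refine tangentLift_eq (hf.immersion x) ?_
  exact (Submodule.starProjection_eq_self_iff.2 (differential_mem I f x u)).symm

/-- Every tangent vector is the tangential part of its own image, so all of `dφ` vanishes. Then `φ`
is constant on chart balls, hence locally constant. -/
theorem eq_of_derivation_eq_zero [PreconnectedSpace M] (φ : C^∞⟮I, M; ℝ⟯)
    (h : ∀ v, hf.derivation v φ = 0) (x y : M) : φ x = φ y := by
  have h0 : ∀ z, differential I φ z = 0 := fun z => by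
    ext u
    have := congrArg (fun χ : C^∞⟮I, M; ℝ⟯ => χ z) (h (differential I f z u))
    have h2 : differential I φ z (tangentialLift I f z (differential I f z u)) = 0 := this
    rwa [hf.tangentialLift_differential] at h2
  have hloc : IsLocallyConstant φ := by
    rw [IsLocallyConstant.iff_eventually_eq]
    intro x₀
    have hd : ∀ z ∈ (extChartAt I x₀).target,
        fderiv ℝ (φ ∘ (extChartAt I x₀).symm) z = 0 := by
      intro z hz
      have h1 := differential_eq_comp I φ.contMDiff ((extChartAt I x₀).map_target hz)
      rw [h0, (extChartAt I x₀).right_inv hz] at h1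
      ext w
      obtain ⟨u, rfl⟩ := (differential_bijective I ((extChartAt I x₀).map_target hz)).2 w
      exact (congrArg (fun L => L u) h1).symm
    obtain ⟨r, hr, hball⟩ := Metric.isOpen_iff.1 (isOpen_extChartAt_target (I := I) x₀)
      _ (mem_extChartAt_target x₀)
    filter_upwards [extChartAt_source_mem_nhds (I := I) x₀,
      (continuousAt_extChartAt (I := I) x₀).eventually (Metric.ball_mem_nhds _ hr)] with z hz1 hz2
    have h3 := Metric.isOpen_ball.is_const_of_fderiv_eq_zero (𝕜 := ℝ)
      (convex_ball (extChartAt I x₀ x₀) r).isPreconnected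
      (((contDiffOn_comp_symm I φ.contMDiff x₀).mono hball).differentiableOn (by simp))
      (fun z hz => hd z (hball hz)) hz2 (Metric.mem_ball_self hr)
    simpa only [Function.comp_apply, (extChartAt I x₀).left_inv hz1, extChartAt_to_inv] using h3
  exact hloc.apply_eq_of_preconnectedSpace x y

end IsMinimalSubmanifold

theorem hasFDerivAt_toLp_prod {V₁ V₂ W₁ W₂ : Type*} [NormedAddCommGroup V₁] [NormedSpace ℝ V₁]
    [NormedAddCommGroup V₂] [NormedSpace ℝ V₂] [NormedAddCommGroup W₁] [NormedSpace ℝ W₁]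
    [NormedAddCommGroup W₂] [NormedSpace ℝ W₂] {A : V₁ → W₁} {B : V₂ → W₂} {y : V₁ × V₂}
    (hA : DifferentiableAt ℝ A y.1) (hB : DifferentiableAt ℝ B y.2) (c₁ c₂ : ℝ) (u : V₁ × V₂) :
    DifferentiableAt ℝ (fun z : V₁ × V₂ => WithLp.toLp 2 (c₁ • A z.1, c₂ • B z.2)) y ∧
    fderiv ℝ (fun z : V₁ × V₂ => WithLp.toLp 2 (c₁ • A z.1, c₂ • B z.2)) y u =
      WithLp.toLp 2 (c₁ • fderiv ℝ A y.1 u.1, c₂ • fderiv ℝ B y.2 u.2) := by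
  have h1 := (hA.hasFDerivAt.comp y hasFDerivAt_fst).const_smul c₁
  have h2 := (hB.hasFDerivAt.comp y hasFDerivAt_snd).const_smul c₂
  have h3 := ((WithLp.prodContinuousLinearEquiv 2 ℝ W₁ W₂).symm.hasFDerivAt).comp y
    (h1.prodMk h2)
  have h4 : (fun z : V₁ × V₂ => WithLp.toLp 2 (c₁ • A z.1, c₂ • B z.2)) =
    (WithLp.prodContinuousLinearEquiv 2 ℝ W₁ W₂).symm ∘
      fun x => ((c₁ • A ∘ Prod.fst) x, (c₂ • B ∘ Prod.snd) x) := rfl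
  rw [h4]
  exact ⟨h3.differentiableAt, by rw [h3.fderiv]; rfl⟩

/-! ### Second fundamental form of a product -/

section Product

variable {V₁ : Type*} [NormedAddCommGroup V₁] [InnerProductSpace ℝ V₁] [FiniteDimensional ℝ V₁]
  {H₁ : Type*} [TopologicalSpace H₁] {I₁ : ModelWithCorners ℝ V₁ H₁} [I₁.Boundaryless]
  {M₁ : Type*} [TopologicalSpace M₁] [ChartedSpace H₁ M₁] [IsManifold I₁ ∞ M₁]
  {E₁ : Type*} [NormedAddCommGroup E₁] [InnerProductSpace ℝ E₁] [FiniteDimensional ℝ E₁]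
  {V₂ : Type*} [NormedAddCommGroup V₂] [InnerProductSpace ℝ V₂] [FiniteDimensional ℝ V₂]
  {H₂ : Type*} [TopologicalSpace H₂] {I₂ : ModelWithCorners ℝ V₂ H₂} [I₂.Boundaryless]
  {M₂ : Type*} [TopologicalSpace M₂] [ChartedSpace H₂ M₂] [IsManifold I₂ ∞ M₂]
  {E₂ : Type*} [NormedAddCommGroup E₂] [InnerProductSpace ℝ E₂] [FiniteDimensional ℝ E₂]
  {f₁ : M₁ → E₁} {f₂ : M₂ → E₂} (hf₁ : IsMinimalSubmanifold I₁ f₁)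
  (hf₂ : IsMinimalSubmanifold I₂ f₂) {c₁ c₂ : ℝ}

theorem productMap_comp_symm (c₁ c₂ : ℝ) (x : M₁ × M₂) :
    productMap c₁ c₂ f₁ f₂ ∘ (extChartAt (I₁.prod I₂) x).symm =
      fun y => WithLp.toLp 2 (c₁ • (f₁ ∘ (extChartAt I₁ x.1).symm) y.1,
        c₂ • (f₂ ∘ (extChartAt I₂ x.2).symm) y.2) := by
  rw [extChartAt_prod]
  rfl

theorem secondDerivative_productMap (hf₁ : IsMinimalSubmanifold I₁ f₁)
    (hf₂ : IsMinimalSubmanifold I₂ f₂) (c₁ c₂ : ℝ) (x : M₁ × M₂) (u w : V₁ × V₂) :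
    secondDerivative (I₁.prod I₂) (productMap c₁ c₂ f₁ f₂) x u w =
      WithLp.toLp 2 (c₁ • secondDerivative I₁ f₁ x.1 u.1 w.1,
        c₂ • secondDerivative I₂ f₂ x.2 u.2 w.2) := by
  rw [secondDerivative, productMap_comp_symm]
  set G₁ := f₁ ∘ (extChartAt I₁ x.1).symm
  set G₂ := f₂ ∘ (extChartAt I₂ x.2).symm
  have hy : extChartAt (I₁.prod I₂) x x = (extChartAt I₁ x.1 x.1, extChartAt I₂ x.2 x.2) := by
    rw [extChartAt_prod]; rfl
  rw [hy]
  have k1 := contDiffAt_comp_symm I₁ hf₁.contMDiff (mem_extChartAt_source (I := I₁) x.1)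
  have k2 := contDiffAt_comp_symm I₂ hf₂.contMDiff (mem_extChartAt_source (I := I₂) x.2)
  have d1 : DifferentiableAt ℝ (fderiv ℝ G₁) (extChartAt I₁ x.1 x.1) :=
    (k1.fderiv_right (m := ∞) (by simp)).differentiableAt (by simp)
  have d2 : DifferentiableAt ℝ (fderiv ℝ G₂) (extChartAt I₂ x.2 x.2) :=
    (k2.fderiv_right (m := ∞) (by simp)).differentiableAt (by simp)
  set G : V₁ × V₂ → WithLp 2 (E₁ × E₂) := fun y => WithLp.toLp 2 (c₁ • G₁ y.1, c₂ • G₂ y.2)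
  set y : V₁ × V₂ := (extChartAt I₁ x.1 x.1, extChartAt I₂ x.2 x.2) with hydef
  have hG : ContDiffAt ℝ ∞ G y := by
    refine ((WithLp.prodContinuousLinearEquiv 2 ℝ E₁ E₂).symm.contDiff.contDiffAt).comp y
      (ContDiffAt.prodMk ?_ ?_)
    · exact (k1.comp y contDiffAt_fst).const_smul c₁
    · exact (k2.comp y contDiffAt_snd).const_smul c₂
  have dG : DifferentiableAt ℝ (fderiv ℝ G) y :=
    (hG.fderiv_right (m := ∞) (by simp)).differentiableAt (by simp)
  have e1 : fderiv ℝ (fderiv ℝ G) y u w = fderiv ℝ (fun z => fderiv ℝ G z w) y u := by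
    rw [fderiv_clm_apply dG (differentiableAt_const w)]
    simp
  have e2 : (fun z => fderiv ℝ G z w) =ᶠ[𝓝 y]
      fun z => WithLp.toLp 2 (c₁ • (fun a => fderiv ℝ G₁ a w.1) z.1,
        c₂ • (fun a => fderiv ℝ G₂ a w.2) z.2) := by
    have t1 : ∀ᶠ z : V₁ × V₂ in 𝓝 y, z.1 ∈ (extChartAt I₁ x.1).target :=
      continuousAt_fst.eventually (extChartAt_target_mem_nhds x.1)
    have t2 : ∀ᶠ z : V₁ × V₂ in 𝓝 y, z.2 ∈ (extChartAt I₂ x.2).target :=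
      continuousAt_snd.eventually (extChartAt_target_mem_nhds x.2)
    filter_upwards [t1, t2] with z hz1 hz2
    have g1 := ((contDiffOn_comp_symm I₁ hf₁.contMDiff x.1).contDiffAt
      ((isOpen_extChartAt_target x.1).mem_nhds hz1)).differentiableAt (by simp)
    have g2 := ((contDiffOn_comp_symm I₂ hf₂.contMDiff x.2).contDiffAt
      ((isOpen_extChartAt_target x.2).mem_nhds hz2)).differentiableAt (by simp)
    exact (hasFDerivAt_toLp_prod g1 g2 c₁ c₂ w).2
  have e3 := (hasFDerivAt_toLp_prod (A := fun a => fderiv ℝ G₁ a w.1)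
    (B := fun a => fderiv ℝ G₂ a w.2) (y := y) (d1.clm_apply (differentiableAt_const w.1))
    (d2.clm_apply (differentiableAt_const w.2)) c₁ c₂ u).2
  rw [e1, e2.fderiv_eq]
  refine e3.trans ?_
  rw [fderiv_clm_apply d1 (differentiableAt_const w.1),
    fderiv_clm_apply d2 (differentiableAt_const w.2)]
  simp [secondDerivative, G₁, G₂]

theorem differential_productMap (hf₁ : IsMinimalSubmanifold I₁ f₁)
    (hf₂ : IsMinimalSubmanifold I₂ f₂)
    (hf : IsMinimalSubmanifold (I₁.prod I₂) (productMap c₁ c₂ f₁ f₂)) (x : M₁ × M₂)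
    (u : V₁ × V₂) :
    differential (I₁.prod I₂) (productMap c₁ c₂ f₁ f₂) x u =
      WithLp.toLp 2 (c₁ • differential I₁ f₁ x.1 u.1, c₂ • differential I₂ f₂ x.2 u.2) := by
  rw [differential_eq_fderiv _ hf.contMDiff, productMap_comp_symm,
    differential_eq_fderiv I₁ hf₁.contMDiff, differential_eq_fderiv I₂ hf₂.contMDiff]
  have hy : extChartAt (I₁.prod I₂) x x = (extChartAt I₁ x.1 x.1, extChartAt I₂ x.2 x.2) := by
    rw [extChartAt_prod]; rfl
  rw [hy]
  exact (hasFDerivAt_toLp_prod (y := (extChartAt I₁ x.1 x.1, extChartAt I₂ x.2 x.2))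
    (differentiableAt_comp_symm hf₁.contMDiff x.1)
    (differentiableAt_comp_symm hf₂.contMDiff x.2) c₁ c₂ u).2

/-- This is the orthogonality of position and tangent vectors, differentiated once: the sphere
contributes minus the metric. -/
theorem inner_secondDerivative_self {V : Type*} [NormedAddCommGroup V] [InnerProductSpace ℝ V]
    [FiniteDimensional ℝ V] {H : Type*} [TopologicalSpace H] {I : ModelWithCorners ℝ V H}
    [I.Boundaryless] {M : Type*} [TopologicalSpace M] [ChartedSpace H M] [IsManifold I ∞ M]
    {E : Type*} [NormedAddCommGroup E] [InnerProductSpace ℝ E] [FiniteDimensional ℝ E]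
    {f : M → E} (hf : IsMinimalSubmanifold I f) (x : M) (v a : E) :
    ⟪f x, secondDerivative I f x (tangentialLift I f x v) (tangentialLift I f x a)⟫ =
      -⟪(tangentSubspace I f x).starProjection v, a⟫ := by
  have h := hf.inner_hess_self x v a
  have h2 : IsMinimalSubmanifold.hess (I := I) (f := f) x v a = _ :=
    fderiv_directional hf.contMDiff hf.immersion hf.contMDiff x a v
  rw [h2, inner_add_left, (Submodule.mem_orthogonal _ _).1 (hf.mem_orthogonal_tangentSubspace x) _
    (differential_mem I f x _), add_zero, real_inner_comm] at h
  exact h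

theorem starProjection_productMap (hf₁ : IsMinimalSubmanifold I₁ f₁)
    (hf₂ : IsMinimalSubmanifold I₂ f₂)
    (hf : IsMinimalSubmanifold (I₁.prod I₂) (productMap c₁ c₂ f₁ f₂)) (hc₁ : c₁ ≠ 0) (hc₂ : c₂ ≠ 0)
    (x : M₁ × M₂) (a : E₁) (b : E₂) :
    (tangentSubspace (I₁.prod I₂) (productMap c₁ c₂ f₁ f₂) x).starProjection (WithLp.toLp 2 (a, b)) =
      WithLp.toLp 2 ((tangentSubspace I₁ f₁ x.1).starProjection a,
        (tangentSubspace I₂ f₂ x.2).starProjection b) := by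
  refine Submodule.eq_starProjection_of_mem_of_inner_eq_zero ?_ ?_
  · have h := differential_mem (I₁.prod I₂) (productMap c₁ c₂ f₁ f₂) x
      (c₁⁻¹ • tangentialLift I₁ f₁ x.1 a, c₂⁻¹ • tangentialLift I₂ f₂ x.2 b)
    rw [differential_productMap hf₁ hf₂ hf] at h
    simp only [map_smul, smul_smul, mul_inv_cancel₀ hc₁, mul_inv_cancel₀ hc₂, one_smul] at h
    have e1 : differential I₁ f₁ x.1 (tangentialLift I₁ f₁ x.1 a) = _ := directional_self x.1 a
    have e2 : differential I₂ f₂ x.2 (tangentialLift I₂ f₂ x.2 b) = _ := directional_self x.2 b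
    rwa [e1, e2] at h
  · rintro _ ⟨u, rfl⟩
    have h := differential_productMap hf₁ hf₂ hf x u
    change ⟪_, differential (I₁.prod I₂) (productMap c₁ c₂ f₁ f₂) x u⟫ = 0
    rw [h, WithLp.prod_inner_apply]
    change ⟪a - (tangentSubspace I₁ f₁ x.1).starProjection a, c₁ • differential I₁ f₁ x.1 u.1⟫ +
      ⟪b - (tangentSubspace I₂ f₂ x.2).starProjection b, c₂ • differential I₂ f₂ x.2 u.2⟫ = 0
    rw [real_inner_smul_right, real_inner_smul_right,
      (Submodule.mem_orthogonal' _ _).1 (Submodule.sub_starProjection_mem_orthogonal a) _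
        (differential_mem I₁ f₁ x.1 u.1),
      (Submodule.mem_orthogonal' _ _).1 (Submodule.sub_starProjection_mem_orthogonal b) _
        (differential_mem I₂ f₂ x.2 u.2)]
    ring

/-- The second fundamental form of a product of two submanifolds of spheres. -/
theorem sffAmbient_productMap (hf₁ : IsMinimalSubmanifold I₁ f₁)
    (hf₂ : IsMinimalSubmanifold I₂ f₂)
    (hf : IsMinimalSubmanifold (I₁.prod I₂) (productMap c₁ c₂ f₁ f₂)) (hc₁ : c₁ ≠ 0) (hc₂ : c₂ ≠ 0)
    (x : M₁ × M₂) (a a' : E₁) (b b' : E₂) :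
    sffAmbient (hf.immersion x) (WithLp.toLp 2 (a, b)) (WithLp.toLp 2 (a', b')) = WithLp.toLp 2
      (c₁⁻¹ • sffAmbient (hf₁.immersion x.1) a a' +
        ((⟪(tangentSubspace I₁ f₁ x.1).starProjection a, a'⟫ +
          ⟪(tangentSubspace I₂ f₂ x.2).starProjection b, b'⟫) * c₁ -
          c₁⁻¹ * ⟪(tangentSubspace I₁ f₁ x.1).starProjection a, a'⟫) • f₁ x.1,
      c₂⁻¹ • sffAmbient (hf₂.immersion x.2) b b' +
        ((⟪(tangentSubspace I₁ f₁ x.1).starProjection a, a'⟫ +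
          ⟪(tangentSubspace I₂ f₂ x.2).starProjection b, b'⟫) * c₂ -
          c₂⁻¹ * ⟪(tangentSubspace I₂ f₂ x.2).starProjection b, b'⟫) • f₂ x.2) := by
  set f := productMap c₁ c₂ f₁ f₂ with hfdef
  -- The differential of the product scales the factors by `c₁` and `c₂`, so lifts carry the inverse
  -- weights.
  have hlift : ∀ (a : E₁) (b : E₂), tangentLift (I₁.prod I₂) f x
      ((tangentSubspace (I₁.prod I₂) f x).orthogonalProjectionOnto (WithLp.toLp 2 (a, b))) =
      (c₁⁻¹ • tangentialLift I₁ f₁ x.1 a, c₂⁻¹ • tangentialLift I₂ f₂ x.2 b) := fun a b => by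
    refine tangentLift_eq (hf.immersion x) ?_
    rw [differential_productMap hf₁ hf₂ hf]
    simp only [map_smul, smul_smul, mul_inv_cancel₀ hc₁, mul_inv_cancel₀ hc₂, one_smul]
    have e1 : differential I₁ f₁ x.1 (tangentialLift I₁ f₁ x.1 a) = _ := directional_self x.1 a
    have e2 : differential I₂ f₂ x.2 (tangentialLift I₂ f₂ x.2 b) = _ := directional_self x.2 b
    rw [e1, e2, ← starProjection_productMap hf₁ hf₂ hf hc₁ hc₂]
    rfl
  have horth : f x ∈ (tangentSubspace (I₁.prod I₂) f x)ᗮ := by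
    rw [Submodule.mem_orthogonal']
    rintro _ ⟨u, rfl⟩
    have h := differential_productMap hf₁ hf₂ hf x u
    change ⟪_, differential (I₁.prod I₂) (productMap c₁ c₂ f₁ f₂) x u⟫ = 0
    rw [h, WithLp.prod_inner_apply]
    change ⟪c₁ • f₁ x.1, c₁ • differential I₁ f₁ x.1 u.1⟫ +
      ⟪c₂ • f₂ x.2, c₂ • differential I₂ f₂ x.2 u.2⟫ = 0
    rw [real_inner_smul_right, real_inner_smul_right, real_inner_smul_left, real_inner_smul_left,
      (Submodule.mem_orthogonal' _ _).1 (hf₁.mem_orthogonal_tangentSubspace x.1) _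
        (differential_mem I₁ f₁ x.1 u.1),
      (Submodule.mem_orthogonal' _ _).1 (hf₂.mem_orthogonal_tangentSubspace x.2) _
        (differential_mem I₂ f₂ x.2 u.2)]
    ring
  have h0 : sffAmbient (hf.immersion x) (WithLp.toLp 2 (a, b)) (WithLp.toLp 2 (a', b')) =
      (normalSubspace (I₁.prod I₂) f x).starProjection (secondDerivative (I₁.prod I₂) f x
        (tangentLift (I₁.prod I₂) f x ((tangentSubspace (I₁.prod I₂) f x).orthogonalProjectionOnto
          (WithLp.toLp 2 (a, b))))
        (tangentLift (I₁.prod I₂) f x ((tangentSubspace (I₁.prod I₂) f x).orthogonalProjectionOnto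
          (WithLp.toLp 2 (a', b'))))) := rfl
  have h1 : sffAmbient (hf₁.immersion x.1) a a' = (normalSubspace I₁ f₁ x.1).starProjection
    (secondDerivative I₁ f₁ x.1 (tangentialLift I₁ f₁ x.1 a) (tangentialLift I₁ f₁ x.1 a')) := rfl
  have h2 : sffAmbient (hf₂.immersion x.2) b b' = (normalSubspace I₂ f₂ x.2).starProjection
    (secondDerivative I₂ f₂ x.2 (tangentialLift I₂ f₂ x.2 b) (tangentialLift I₂ f₂ x.2 b')) := rfl
  rw [h0, hlift, hlift, secondDerivative_productMap hf₁ hf₂, h1, h2,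
    starProjection_normalSubspace (hf.norm_eq_one x) horth,
    starProjection_productMap hf₁ hf₂ hf hc₁ hc₂,
    starProjection_normalSubspace (hf₁.norm_eq_one x.1) (hf₁.mem_orthogonal_tangentSubspace x.1),
    starProjection_normalSubspace (hf₂.norm_eq_one x.2) (hf₂.mem_orthogonal_tangentSubspace x.2),
    inner_secondDerivative_self hf₁, inner_secondDerivative_self hf₂]
  -- In each factor one weight comes from position, one from the map, and two inverse weights from
  -- the lifts. They cancel, leaving minus the sum of the two metrics.
  have hin : ⟪f x, WithLp.toLp 2 (c₁ • secondDerivative I₁ f₁ x.1 (c₁⁻¹ • tangentialLift I₁ f₁ x.1 a)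
        (c₁⁻¹ • tangentialLift I₁ f₁ x.1 a'), c₂ • secondDerivative I₂ f₂ x.2
        (c₂⁻¹ • tangentialLift I₂ f₂ x.2 b) (c₂⁻¹ • tangentialLift I₂ f₂ x.2 b'))⟫ =
      -⟪(tangentSubspace I₁ f₁ x.1).starProjection a, a'⟫ -
        ⟪(tangentSubspace I₂ f₂ x.2).starProjection b, b'⟫ := by
    rw [WithLp.prod_inner_apply]
    change ⟪c₁ • f₁ x.1, _⟫ + ⟪c₂ • f₂ x.2, _⟫ = _
    simp only [map_smul, smul_apply, smul_smul, real_inner_smul_left, real_inner_smul_right,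
      inner_secondDerivative_self hf₁, inner_secondDerivative_self hf₂]
    field_simp
    ring
  rw [hin]
  set D₁ := secondDerivative I₁ f₁ x.1 (tangentialLift I₁ f₁ x.1 a) (tangentialLift I₁ f₁ x.1 a')
  set D₂ := secondDerivative I₂ f₂ x.2 (tangentialLift I₂ f₂ x.2 b) (tangentialLift I₂ f₂ x.2 b')
  have k1 : c₁ * (c₁⁻¹ * c₁⁻¹) = c₁⁻¹ := by field_simp
  have k2 : c₂ * (c₂⁻¹ * c₂⁻¹) = c₂⁻¹ := by field_simp
  have hfx : f x = WithLp.toLp 2 (c₁ • f₁ x.1, c₂ • f₂ x.2) := rfl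
  simp only [map_smul, smul_apply, smul_smul, hfx, k1, k2, ← WithLp.toLp_smul, ← WithLp.toLp_sub,
    Prod.smul_mk, Prod.mk_sub_mk]
  congr 2 <;> module

theorem norm_sq_sff_add {V : Type*} [NormedAddCommGroup V] [InnerProductSpace ℝ V]
    [FiniteDimensional ℝ V] {H : Type*} [TopologicalSpace H] {I : ModelWithCorners ℝ V H}
    {M : Type*} [TopologicalSpace M] [ChartedSpace H M]
    {E : Type*} [NormedAddCommGroup E] [InnerProductSpace ℝ E] [FiniteDimensional ℝ E]
    {f : M → E} (hf : IsMinimalSubmanifold I f) (x : M) (a a' : E) (r s : ℝ) :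
    ‖r • sffAmbient (hf.immersion x) a a' + s • f x‖ ^ 2 =
      r ^ 2 * ‖sffAmbient (hf.immersion x) a a'‖ ^ 2 + s ^ 2 := by
  have h : ⟪sffAmbient (hf.immersion x) a a', f x⟫ = 0 := by
    rw [real_inner_comm]
    exact (Submodule.mem_orthogonal _ _).1 (Submodule.starProjection_apply_mem
      (normalSubspace I f x) _) _ (Submodule.mem_sup_right (Submodule.mem_span_singleton_self _))
  rw [norm_add_sq_real, real_inner_smul_left, real_inner_smul_right, h, norm_smul, norm_smul,
    hf.norm_eq_one, mul_pow, mul_pow, Real.norm_eq_abs, Real.norm_eq_abs, sq_abs, sq_abs]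
  ring

theorem sum_sffAmbient {V : Type*} [NormedAddCommGroup V] [NormedSpace ℝ V]
    [Nontrivial V] [FiniteDimensional ℝ V]
    {H : Type*} [TopologicalSpace H] {I : ModelWithCorners ℝ V H}
    {M : Type*} [TopologicalSpace M] [ChartedSpace H M]
    {E : Type*} [NormedAddCommGroup E] [InnerProductSpace ℝ E] [FiniteDimensional ℝ E]
    {f : M → E} (hf : IsMinimalSubmanifold I f) (x : M) {ι : Type*} [Fintype ι]
    (b : OrthonormalBasis ι ℝ E) : ∑ i, sffAmbient (hf.immersion x) (b i) (b i) = 0 := by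
  have h := meanCurvature_eq_sum (hf.immersion x) b
  rw [hf.meanCurvature_eq_zero, eq_comm, smul_eq_zero] at h
  refine h.resolve_left (inv_ne_zero ?_)
  exact_mod_cast (Module.finrank_pos (R := ℝ) (M := V)).ne'

/-- The weights of a minimal product are determined by the dimensions. -/
theorem weight_sq (hf₁ : IsMinimalSubmanifold I₁ f₁)
    (hf₂ : IsMinimalSubmanifold I₂ f₂)
    (hf : IsMinimalSubmanifold (I₁.prod I₂) (productMap c₁ c₂ f₁ f₂)) (hc₁ : c₁ ≠ 0) (hc₂ : c₂ ≠ 0)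
    [Nontrivial V₁] [Nontrivial V₂] (x : M₁ × M₂) :
    (Module.finrank ℝ V₁ + Module.finrank ℝ V₂ : ℝ) * c₁ ^ 2 = Module.finrank ℝ V₁ ∧
    (Module.finrank ℝ V₁ + Module.finrank ℝ V₂ : ℝ) * c₂ ^ 2 = Module.finrank ℝ V₂ := by
  set b₁ := stdOrthonormalBasis ℝ E₁
  set b₂ := stdOrthonormalBasis ℝ E₂
  have h := sum_sffAmbient hf x (b₁.prod b₂)
  rw [Fintype.sum_sum_type] at h
  simp only [OrthonormalBasis.prod_apply, Sum.elim_inl, Sum.elim_inr, Function.comp_apply,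
    LinearMap.inl_apply, LinearMap.inr_apply, sffAmbient_productMap hf₁ hf₂ hf hc₁ hc₂, map_zero,
    inner_zero_left, add_zero, zero_add, mul_zero, sub_zero, smul_zero] at h
  have t1 := sum_starProjection_self b₁ (tangentSubspace I₁ f₁ x.1)
  have t2 := sum_starProjection_self b₂ (tangentSubspace I₂ f₂ x.2)
  rw [finrank_tangentSubspace (hf₁.immersion x.1)] at t1
  rw [finrank_tangentSubspace (hf₂.immersion x.2)] at t2
  -- Along `f₁` the trace equals `(n₁ + n₂) * c₁ - n₁ / c₁`, because the second fundamental forms of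
  -- the factors are trace-free; similarly along `f₂`.
  have hh1 := congrArg (fun z : WithLp 2 (E₁ × E₂) => ⟪f₁ x.1, (WithLp.ofLp z).1⟫) h
  have hh2 := congrArg (fun z : WithLp 2 (E₁ × E₂) => ⟪f₂ x.2, (WithLp.ofLp z).2⟫) h
  simp only [WithLp.ofLp_add, WithLp.ofLp_sum, Prod.fst_add, Prod.snd_add, Prod.fst_sum,
    Prod.snd_sum, Finset.sum_add_distrib, ← Finset.smul_sum, ← Finset.sum_smul,
    sum_sffAmbient hf₁ x.1 b₁, sum_sffAmbient hf₂ x.2 b₂, smul_zero, zero_add, inner_add_right,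
    real_inner_smul_right, real_inner_self_eq_norm_sq, hf₁.norm_eq_one, hf₂.norm_eq_one,
    Finset.sum_sub_distrib, ← Finset.mul_sum, ← Finset.sum_mul, t1, t2, WithLp.ofLp_zero,
    Prod.fst_zero, Prod.snd_zero, inner_zero_right] at hh1 hh2
  constructor
  · field_simp at hh1
    linarith
  · field_simp at hh2
    linarith

/-- The squared length of the second fundamental form of a minimal product. -/
theorem squaredLength_productMap (hf₁ : IsMinimalSubmanifold I₁ f₁)
    (hf₂ : IsMinimalSubmanifold I₂ f₂)
    (hf : IsMinimalSubmanifold (I₁.prod I₂) (productMap c₁ c₂ f₁ f₂)) (hc₁ : c₁ ≠ 0) (hc₂ : c₂ ≠ 0)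
    (hc : c₁ ^ 2 + c₂ ^ 2 = 1) (x : M₁ × M₂) :
    squaredLength (I₁.prod I₂) (productMap c₁ c₂ f₁ f₂) x =
      (squaredLength I₁ f₁ x.1 + Module.finrank ℝ V₁) / c₁ ^ 2 +
      (squaredLength I₂ f₂ x.2 + Module.finrank ℝ V₂) / c₂ ^ 2 -
      (Module.finrank ℝ V₁ + Module.finrank ℝ V₂) := by
  set b₁ := stdOrthonormalBasis ℝ E₁
  set b₂ := stdOrthonormalBasis ℝ E₂
  have t1 := sum_starProjection_sq b₁ (tangentSubspace I₁ f₁ x.1)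
  have t2 := sum_starProjection_sq b₂ (tangentSubspace I₂ f₂ x.2)
  rw [finrank_tangentSubspace (hf₁.immersion x.1)] at t1
  rw [finrank_tangentSubspace (hf₂.immersion x.2)] at t2
  rw [squaredLength_eq_sum (hf.immersion x) (b₁.prod b₂),
    squaredLength_eq_sum (hf₁.immersion x.1) b₁, squaredLength_eq_sum (hf₂.immersion x.2) b₂]
  simp only [Fintype.sum_sum_type, OrthonormalBasis.prod_apply, Sum.elim_inl, Sum.elim_inr,
    Function.comp_apply, LinearMap.inl_apply, LinearMap.inr_apply,
    sffAmbient_productMap hf₁ hf₂ hf hc₁ hc₂, WithLp.prod_norm_sq_eq_of_L2,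
    norm_sq_sff_add hf₁, norm_sq_sff_add hf₂, WithLp.toLp_fst,
    WithLp.toLp_snd, map_zero, LinearMap.zero_apply, norm_zero,
    inner_zero_left, inner_zero_right, add_zero, zero_add, mul_zero, sub_zero, zero_mul,
    Finset.sum_const_zero, ne_eq, OfNat.ofNat_ne_zero, not_false_eq_true, zero_pow]
  -- Expanding gives the coefficient `c₁² + c₂² - 2 + c₁⁻²` of `g²`, and the normalization of the
  -- weights reduces it.
  have e1 : ∀ (g h : ℝ), c₁⁻¹ ^ 2 * h + (g * c₁ - c₁⁻¹ * g) ^ 2 + (g * c₂) ^ 2 =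
      c₁⁻¹ ^ 2 * h + (c₁⁻¹ ^ 2 - 1) * g ^ 2 := fun g h => by
    have : c₁⁻¹ * c₁ = 1 := inv_mul_cancel₀ hc₁
    linear_combination g ^ 2 * hc - 2 * g ^ 2 * this
  have e2 : ∀ (g h : ℝ), (g * c₁) ^ 2 + (c₂⁻¹ ^ 2 * h + (g * c₂ - c₂⁻¹ * g) ^ 2) =
      c₂⁻¹ ^ 2 * h + (c₂⁻¹ ^ 2 - 1) * g ^ 2 := fun g h => by
    have : c₂⁻¹ * c₂ = 1 := inv_mul_cancel₀ hc₂
    linear_combination g ^ 2 * hc - 2 * g ^ 2 * this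
  simp only [e1, e2, Finset.sum_add_distrib, ← Finset.mul_sum, t1, t2]
  field_simp
  ring

end Product

/-! ### Open-and-closed arguments on the unit sphere -/

section Sphere

variable {W : Type*} [NormedAddCommGroup W] [InnerProductSpace ℝ W] [FiniteDimensional ℝ W]

/-- The cone over a local hypersurface parametrization of the unit sphere is open. -/
theorem eventually_mem_cone {V : Type*} [NormedAddCommGroup V] [NormedSpace ℝ V]
    [FiniteDimensional ℝ V] (hdim : Module.finrank ℝ W = Module.finrank ℝ V + 1) {l : V → W} {y₀ : V}
    (hl : ContDiffAt ℝ ∞ l y₀) (hunit : ∀ᶠ y in 𝓝 y₀, ‖l y‖ = 1)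
    (hinj : Function.Injective (fderiv ℝ l y₀)) {U : Set V} (hU : U ∈ 𝓝 y₀) :
    ∀ᶠ w in 𝓝 (l y₀), ∃ y ∈ U, ∃ r : ℝ, 0 < r ∧ w = r • l y := by
  -- At `(1, y₀)` the derivative of the cone map sends the radial direction to `l y₀` and `V`
  -- injectively into the orthogonal complement of `l y₀`. Equality of dimensions makes it onto, so
  -- `Φ` maps neighbourhoods to neighbourhoods.
  set Φ : ℝ × V → W := fun z => z.1 • l z.2 with hΦ
  have hs : HasStrictFDerivAt l (fderiv ℝ l y₀) y₀ := hl.hasStrictFDerivAt (by simp)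
  have hΦ' := (hasStrictFDerivAt_fst (𝕜 := ℝ) (p := ((1 : ℝ), y₀))).smul
    (hs.comp ((1 : ℝ), y₀) hasStrictFDerivAt_snd)
  set L := (1 : ℝ) • (fderiv ℝ l y₀).comp (ContinuousLinearMap.snd ℝ ℝ V) +
    (ContinuousLinearMap.fst ℝ ℝ V).smulRight (l y₀) with hL
  have hΦ'' : HasStrictFDerivAt Φ L (1, y₀) := hΦ'
  have horth : ∀ u, ⟪l y₀, fderiv ℝ l y₀ u⟫ = 0 := by
    intro u
    have h1 := fderiv_inner_apply ℝ hs.hasFDerivAt.differentiableAt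
      hs.hasFDerivAt.differentiableAt u
    have h2 : (fun y => ⟪l y, l y⟫) =ᶠ[𝓝 y₀] fun _ => (1 : ℝ) := by
      filter_upwards [hunit] with y hy
      rw [real_inner_self_eq_norm_sq, hy, one_pow]
    rw [h2.fderiv_eq, real_inner_comm (l y₀)] at h1
    simp at h1
    linarith
  have hLapp : ∀ z, L z = fderiv ℝ l y₀ z.2 + z.1 • l y₀ := fun z => by simp [hL]
  have hLinj : Function.Injective L.toLinearMap := by
    rw [← LinearMap.ker_eq_bot, LinearMap.ker_eq_bot']
    rintro ⟨ρ, u⟩ hz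
    have hz' : fderiv ℝ l y₀ u + ρ • l y₀ = 0 := by rw [← hLapp (ρ, u)]; exact hz
    have h3 := congrArg (fun w => ⟪l y₀, w⟫) hz'
    simp only [inner_add_right, real_inner_smul_right, horth, inner_zero_right,
      real_inner_self_eq_norm_sq, hunit.self_of_nhds] at h3
    have hρ : ρ = 0 := by linarith
    rw [hρ, zero_smul, add_zero] at hz'
    have hu : u = 0 := hinj (by rw [hz', map_zero])
    rw [hρ, hu]
    rfl
  have hLsurj : Function.Surjective L.toLinearMap :=
    (LinearMap.injective_iff_surjective_of_finrank_eq_finrank (by simp [hdim, add_comm])).1 hLinj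
  have hmap := hΦ''.map_nhds_eq_of_surj (LinearMap.range_eq_top.2 hLsurj)
  have h1 : Φ (1, y₀) = l y₀ := by simp [hΦ]
  rw [← h1, ← hmap, Filter.eventually_map]
  have hr : ∀ᶠ z : ℝ × V in 𝓝 (1, y₀), 0 < z.1 :=
    continuousAt_fst.eventually (lt_mem_nhds (by simp))
  have hy : ∀ᶠ z : ℝ × V in 𝓝 (1, y₀), z.2 ∈ U := continuousAt_snd.eventually hU
  filter_upwards [hr, hy] with z hz1 hz2
  exact ⟨z.2, hz2, z.1, hz1, rfl⟩

/-- A closed subset which is relatively open in the unit sphere in the radial sense contains the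
sphere, if it meets it. -/
theorem sphere_subset (hdim : 1 < Module.finrank ℝ W) {S : Set W} (hS : IsClosed S)
    (hne : ∃ w ∈ S, ‖w‖ = 1)
    (hopen : ∀ w₀ ∈ S, ‖w₀‖ = 1 → ∀ᶠ w in 𝓝 w₀, ‖w‖⁻¹ • w ∈ S) {w : W} (hw : ‖w‖ = 1) : w ∈ S := by
  -- The punctured cone over `S` is open, and closed relative to the complement of the origin, which
  -- is connected in dimension at least two.
  set K : Set W := {w | w ≠ 0 ∧ ‖w‖⁻¹ • w ∈ S} with hK
  have hKo : IsOpen K := by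
    rw [isOpen_iff_mem_nhds]
    rintro w₀ ⟨h0, hw₀⟩
    have hn : ‖w₀‖ ≠ 0 := norm_ne_zero_iff.2 h0
    have h1 := hopen _ hw₀ (norm_smul_inv_norm (𝕜 := ℝ) h0)
    have hc : ContinuousAt (fun w => ‖w₀‖⁻¹ • w) w₀ := by fun_prop
    filter_upwards [hc.eventually h1, isOpen_ne.mem_nhds h0] with w hw1 hw2
    refine ⟨hw2, ?_⟩
    rw [norm_smul, smul_smul, norm_inv, norm_norm] at hw1
    have : (‖w₀‖⁻¹ * ‖w‖)⁻¹ * ‖w₀‖⁻¹ = ‖w‖⁻¹ := by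
      field_simp
    rwa [this] at hw1
  have hcon : IsPreconnected ({0}ᶜ : Set W) := by
    refine (isConnected_compl_singleton_of_one_lt_rank ?_ 0).isPreconnected
    rw [← Module.finrank_eq_rank]
    exact_mod_cast hdim
  have hsub : ({0}ᶜ : Set W) ⊆ K := by
    refine hcon.subset_of_closure_inter_subset hKo ?_ ?_
    · obtain ⟨w, hwS, hw1⟩ := hne
      have h0 : w ≠ 0 := fun h => by simp [h] at hw1
      exact ⟨w, h0, h0, by rwa [hw1, inv_one, one_smul]⟩
    · rintro w ⟨hwc, hw0⟩
      refine ⟨hw0, ?_⟩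
      have hcont : ContinuousAt (fun w : W => ‖w‖⁻¹ • w) w :=
        ((continuous_norm.continuousAt).inv₀ (norm_ne_zero_iff.2 hw0)).smul continuousAt_id
      have h2 := hcont.continuousWithinAt.mem_closure (s := K) (t := S) hwc fun z hz => hz.2
      rwa [hS.closure_eq] at h2
  have h0 : w ≠ 0 := fun h => by simp [h] at hw
  have := (hsub h0).2
  rwa [hw, inv_one, one_smul] at this

variable {V : Type*} [NormedAddCommGroup V] [InnerProductSpace ℝ V] [FiniteDimensional ℝ V]
  {H : Type*} [TopologicalSpace H] {I : ModelWithCorners ℝ V H} [I.Boundaryless]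
  {M : Type*} [TopologicalSpace M] [ChartedSpace H M] [IsManifold I ∞ M]

theorem injective_fderiv_comp_symm {W : Type*} [NormedAddCommGroup W] [NormedSpace ℝ W]
    {g : M → W} (hg : ContMDiff I 𝓘(ℝ, W) ∞ g)
    {x : M} (hinj : Function.Injective (differential I g x)) :
    Function.Injective (fderiv ℝ (g ∘ (extChartAt I x).symm) (extChartAt I x x)) := by
  rwa [← differential_eq_fderiv I hg]

/-- A closed hypersurface of the sphere of its own dimension is the whole sphere. -/
theorem sphere_subset_range [CompactSpace M] [Nonempty M]
    (hdim : Module.finrank ℝ W = Module.finrank ℝ V + 1) (hV : 0 < Module.finrank ℝ V) {g : M → W}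
    (hg : ContMDiff I 𝓘(ℝ, W) ∞ g) (hunit : ∀ x, ‖g x‖ = 1)
    (hinj : ∀ x, Function.Injective (differential I g x)) {w : W} (hw : ‖w‖ = 1) :
    w ∈ Set.range g := by
  obtain ⟨x₁⟩ := ‹Nonempty M›
  refine sphere_subset (by omega) (isCompact_range hg.continuous).isClosed
    ⟨g x₁, ⟨x₁, rfl⟩, hunit x₁⟩ ?_ hw
  rintro _ ⟨x₀, rfl⟩ -
  have h := eventually_mem_cone hdim
    (contDiffAt_comp_symm I hg (mem_extChartAt_source x₀)) (.of_forall fun y => hunit _)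
    (injective_fderiv_comp_symm hg (hinj x₀)) Filter.univ_mem
  rw [Function.comp_apply, extChartAt_to_inv] at h
  filter_upwards [h] with w hw
  obtain ⟨y, -, r, hr, rfl⟩ := hw
  refine ⟨(extChartAt I x₀).symm y, ?_⟩
  rw [norm_smul, Function.comp_apply, hunit, mul_one, Real.norm_of_nonneg hr.le, smul_smul,
    inv_mul_cancel₀ hr.ne', one_smul]

end Sphere

/-! ### Totally geodesic submanifolds -/

namespace IsMinimalSubmanifold

variable {V : Type*} [NormedAddCommGroup V] [InnerProductSpace ℝ V] [FiniteDimensional ℝ V]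
  {H : Type*} [TopologicalSpace H] {I : ModelWithCorners ℝ V H} [I.Boundaryless]
  {M : Type*} [TopologicalSpace M] [ChartedSpace H M] [IsManifold I ∞ M]
  {E : Type*} [NormedAddCommGroup E] [InnerProductSpace ℝ E] [FiniteDimensional ℝ E]
  {f : M → E} (hf : IsMinimalSubmanifold I f)

theorem sffAmbient_eq_zero {x : M} (hF : Function.Injective (mvfderiv I f x))
    (h : squaredLength I f x = 0) : sffAmbient hF = 0 := by
  set b := stdOrthonormalBasis ℝ E
  rw [squaredLength_eq_sum hF b, Finset.sum_eq_zero_iff_of_nonneg (fun i _ => by positivity)] at h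
  refine b.toBasis.ext fun i => b.toBasis.ext fun j => ?_
  have h2 := h i (Finset.mem_univ _)
  rw [Finset.sum_eq_zero_iff_of_nonneg (fun i _ => by positivity)] at h2
  simpa using h2 j (Finset.mem_univ _)

theorem second_eq_zero {x : M} (h : squaredLength I f x = 0) (a u c : E) :
    hf.second a u c x = 0 := by
  rw [second_apply, ← sffAmbient_apply, sffAmbient_eq_zero (hf.immersion x) h]
  simp

theorem squaredLength_nonneg (x : M) : 0 ≤ squaredLength I f x :=
  Finset.sum_nonneg fun _ _ => Finset.sum_nonneg fun _ _ => by positivity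

/-- A closed totally geodesic submanifold of the sphere is a great sphere. -/
theorem isCongruentTo_standardSphere (hf : IsMinimalSubmanifold I f) [CompactSpace M] [ConnectedSpace M] {n : ℕ}
    (hn : Module.finrank ℝ V = n) (hn0 : 0 < n) (h : ∀ x, squaredLength I f x = 0) :
    IsCongruentTo f (standardSphere n) := by
  set C := hf.sphereCalculus hn
  obtain ⟨x₀⟩ := (inferInstance : Nonempty M)
  have ht : ∀ a u c, C.t a u c = 0 := fun a u c => by
    ext x
    exact hf.second_eq_zero (h x) a u c
  -- The squared length of the projection of `c` to the span of position and tangent space does not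
  -- depend on the point. For `c` orthogonal to that span at `x₀` it is zero, so all of `f` lies in
  -- `W`.
  have hconst : ∀ x c, ⟪f x, c⟫ ^ 2 + ⟪(tangentSubspace I f x).starProjection c, c⟫ =
      ⟪f x₀, c⟫ ^ 2 + ⟪(tangentSubspace I f x₀).starProjection c, c⟫ := fun x c => by
    have h1 := hf.eq_of_derivation_eq_zero (C.F c * C.F c + C.p c c)
      (fun v => C.D_span_eq_zero ht v c c) x x₀
    have h2 : ∀ x, (C.F c * C.F c + C.p c c) x =
        ⟪f x, c⟫ ^ 2 + ⟪(tangentSubspace I f x).starProjection c, c⟫ := fun x => by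
      have := hf.proj_apply c c x
      change ⟪f x, c⟫ * ⟪f x, c⟫ + hf.proj c c x = _
      rw [this, sq]
    rw [h2, h2] at h1
    exact h1
  set W : Submodule ℝ E := tangentSubspace I f x₀ ⊔ Submodule.span ℝ {f x₀} with hW
  have hfW : ∀ x, f x ∈ W := fun x => by
    rw [← Submodule.orthogonal_orthogonal W, Submodule.mem_orthogonal']
    intro c hc
    rw [hW, ← Submodule.inf_orthogonal, Submodule.mem_inf,
      Submodule.mem_orthogonal_singleton_iff_inner_right] at hc
    have h1 := hconst x c
    rw [hc.2, (Submodule.starProjection_apply_eq_zero_iff _).2 hc.1, inner_zero_left] at h1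
    have h3 : 0 ≤ ⟪(tangentSubspace I f x).starProjection c, c⟫ := by
      rw [Submodule.inner_starProjection_left_eq_right, ← Submodule.starProjection_eq_self_iff.2
        (Submodule.starProjection_apply_mem (tangentSubspace I f x) c),
        ← Submodule.inner_starProjection_left_eq_right]
      exact real_inner_self_nonneg
    have h4 : ⟪f x, c⟫ ^ 2 = 0 := by nlinarith [sq_nonneg ⟪f x, c⟫]
    exact pow_eq_zero_iff two_ne_zero |>.1 h4
  have hdim : Module.finrank ℝ W = n + 1 := by
    have hd : Disjoint (tangentSubspace I f x₀) (Submodule.span ℝ {f x₀}) := by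
      refine Submodule.IsOrtho.disjoint ?_
      rw [Submodule.isOrtho_comm, Submodule.isOrtho_iff_le, Submodule.span_singleton_le_iff_mem]
      exact hf.mem_orthogonal_tangentSubspace x₀
    have h0 : f x₀ ≠ 0 := fun h0 => by simpa [h0] using hf.norm_eq_one x₀
    have := Submodule.finrank_sup_add_finrank_inf_eq (tangentSubspace I f x₀)
      (Submodule.span ℝ {f x₀})
    rw [hd.eq_bot, finrank_bot, add_zero, finrank_span_singleton h0,
      finrank_tangentSubspace (hf.immersion x₀), hn] at this
    exact this
  set g : M → W := fun x => W.orthogonalProjectionOnto (f x) with hg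
  have hgf : ∀ x, (g x : E) = f x := fun x => Submodule.starProjection_eq_self_iff.2 (hfW x)
  have hgs : ContMDiff I 𝓘(ℝ, W) ∞ g :=
    (W.orthogonalProjectionOnto.contDiff.contMDiff).comp hf.contMDiff
  have hgu : ∀ x, ‖g x‖ = 1 := fun x => by
    rw [← hf.norm_eq_one x, ← hgf]; rfl
  have hinj : ∀ x, Function.Injective (differential I g x) := fun x => by
    have h1 : differential I f x = W.subtypeL.comp (differential I g x) := by
      rw [differential_eq_fderiv I hf.contMDiff, differential_eq_fderiv I hgs]
      have h2 : f ∘ (extChartAt I x).symm = W.subtypeL ∘ (g ∘ (extChartAt I x).symm) := by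
        funext y
        exact (hgf _).symm
      rw [h2]
      exact (W.subtypeL.hasFDerivAt.comp _ (differentiableAt_comp_symm hgs x).hasFDerivAt).fderiv
    have h3 : Function.Injective (differential I f x) := hf.immersion x
    rw [h1] at h3
    exact fun u w huw => h3 (congrArg W.subtypeL huw)
  set e : OrthonormalBasis (Fin (n + 1)) ℝ W :=
    (stdOrthonormalBasis ℝ W).reindex (finCongr hdim)
  refine ⟨W.subtypeₗᵢ.comp e.repr.symm.toLinearIsometry, ?_⟩
  ext w
  constructor
  · rintro ⟨x, rfl⟩
    refine ⟨e.repr (g x), ⟨⟨e.repr (g x), by simp [hgu]⟩, rfl⟩, ?_⟩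
    simp [hgf]
  · rintro ⟨_, ⟨y, rfl⟩, rfl⟩
    have hy : ‖e.repr.symm y.1‖ = 1 := by
      rw [LinearIsometryEquiv.norm_map]
      simpa using y.2
    obtain ⟨x, hx⟩ := sphere_subset_range (by rw [hdim, hn]) (by omega) hgs hgu hinj hy
    refine ⟨x, ?_⟩
    rw [← hgf, hx]
    rfl

end IsMinimalSubmanifold

/-! ### Rigidity of the Clifford hypersurface -/

section Single

variable {V : Type*} [NormedAddCommGroup V] [InnerProductSpace ℝ V] [FiniteDimensional ℝ V]
  {H : Type*} [TopologicalSpace H] {I : ModelWithCorners ℝ V H} [I.Boundaryless]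
  {M : Type*} [TopologicalSpace M] [ChartedSpace H M] [IsManifold I ∞ M]
  {E : Type*} [NormedAddCommGroup E] [InnerProductSpace ℝ E] [FiniteDimensional ℝ E]
  {f : M → E} (hf : IsMinimalSubmanifold I f)

/-- A linear function constant on the submanifold determines the corresponding components of the
second fundamental form. -/
theorem inner_sff_of_inner_const {a : E} {α : ℝ} (h : ∀ x, ⟪f x, a⟫ = α) (x : M) (v w : E) :
    ⟪sffAmbient (hf.immersion x) v w, a⟫ = α * ⟪(tangentSubspace I f x).starProjection v, w⟫ ∧
      ⟪(tangentSubspace I f x).starProjection v, a⟫ = 0 := by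
  set C := hf.sphereCalculus rfl
  have hF : C.F a = algebraMap ℝ _ α := by
    ext y
    exact h y
  have hp : ∀ v, C.p v a = 0 := fun v => by
    rw [← C.D_F, hF, Derivation.map_algebraMap]
  have hpv : ∀ v, ⟪(C.T x).starProjection v, a⟫ = 0 := fun v => by
    rw [← C.ev_p, hp, map_zero]
  have ha : a ∈ (C.T x)ᗮ := by
    rw [Submodule.mem_orthogonal]
    intro u hu
    rw [← hpv u, Submodule.starProjection_eq_self_iff.2 hu]
  have h1 := congrArg (C.ev x) (C.D_p v w a)
  rw [hp] at h1
  simp only [map_zero, map_add, map_sub, map_mul, hp, C.t_orth' x a ha, mul_zero, sub_zero,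
    add_zero] at h1
  refine ⟨?_, hpv v⟩
  have h2 : ⟪sffAmbient (hf.immersion x) v w, a⟫ = C.ev x (C.t v w a) :=
    (hf.second_apply v w a x).symm
  have h3 : C.ev x (C.F a) = α := h x
  have h4 : C.ev x (C.p v w) = ⟪(tangentSubspace I f x).starProjection v, w⟫ := C.ev_p x v w
  rw [h2, ← h4, ← h3]
  linarith

theorem inner_sff_self (x : M) (v w : E) : ⟪sffAmbient (hf.immersion x) v w, f x⟫ = 0 := by
  rw [real_inner_comm]
  exact (Submodule.mem_orthogonal _ _).1 (Submodule.starProjection_apply_mem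
    (normalSubspace I f x) _) _ (Submodule.mem_sup_right (Submodule.mem_span_singleton_self _))

theorem inner_tangent_sff (x : M) {u : E} (hu : u ∈ tangentSubspace I f x) (v w : E) :
    ⟪u, sffAmbient (hf.immersion x) v w⟫ = 0 :=
  (Submodule.mem_orthogonal _ _).1 (Submodule.starProjection_apply_mem
    (normalSubspace I f x) _) _ (Submodule.mem_sup_left hu)

theorem squaredLength_eq_zero_of_diag (x : M)
    (h : ∀ v, (tangentSubspace I f x).starProjection v ≠ 0 →
      sffAmbient (hf.immersion x) v v = 0) : squaredLength I f x = 0 := by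
  have h1 : ∀ v, sffAmbient (hf.immersion x) v v = 0 := fun v => by
    by_cases hv : (tangentSubspace I f x).starProjection v = 0
    · have : (tangentSubspace I f x).orthogonalProjectionOnto v = 0 := Subtype.ext hv
      rw [sffAmbient_apply, this, map_zero]
    · exact h v hv
  have hsymm : ∀ v w, sffAmbient (hf.immersion x) v w = sffAmbient (hf.immersion x) w v :=
    fun v w => by
      refine ext_inner_right ℝ fun c => ?_
      rw [sffAmbient_apply, sffAmbient_apply, ← hf.second_apply, ← hf.second_apply]
      exact congrArg (fun φ : C^∞⟮I, M; ℝ⟯ => φ x) ((hf.sphereCalculus rfl).t_symm v w c)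
  have h2 : ∀ v w, sffAmbient (hf.immersion x) v w = 0 := fun v w => by
    have h3 := h1 (v + w)
    rw [map_add, hsymm (v + w), hsymm (v + w), map_add, map_add, h1, h1, zero_add, add_zero,
      hsymm w v, ← two_smul ℝ] at h3
    exact (smul_eq_zero.1 h3).resolve_left two_ne_zero
  rw [squaredLength_eq_sum (hf.immersion x) (stdOrthonormalBasis ℝ E)]
  simp [h2]

theorem decompose_eq_zero (x : M) {a : E} (ha : a ∈ tangentSubspace I f x) (v : E) (r s : ℝ)
    (h : a + r • f x + s • sffAmbient (hf.immersion x) v v = 0) :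
    a = 0 ∧ r = 0 ∧ s • sffAmbient (hf.immersion x) v v = 0 := by
  have h1 := congrArg (fun w => ⟪a, w⟫) h
  simp only [inner_add_right, real_inner_smul_right, inner_tangent_sff hf x ha,
    (Submodule.mem_orthogonal _ _).1 (hf.mem_orthogonal_tangentSubspace x) _ ha, mul_zero,
    add_zero, inner_zero_right, inner_self_eq_zero] at h1
  rw [h1, zero_add] at h
  have h2 := congrArg (fun w => ⟪w, f x⟫) h
  simp only [inner_add_left, real_inner_smul_left, inner_sff_self hf, real_inner_self_eq_norm_sq,
    hf.norm_eq_one, inner_zero_left] at h2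
  have hr : r = 0 := by linarith
  rw [hr, zero_smul, zero_add] at h
  exact ⟨h1, hr, h⟩

theorem exists_starProjection_ne_zero (hf : IsMinimalSubmanifold I f) [Nontrivial V] (x : M) :
    ∃ v, (tangentSubspace I f x).starProjection v ≠ 0 := by
  obtain ⟨u, hu⟩ := exists_ne (0 : V)
  refine ⟨differential I f x u, ?_⟩
  rw [Submodule.starProjection_eq_self_iff.2 (differential_mem I f x u)]
  intro h
  have hinj : Function.Injective (differential I f x) := hf.immersion x
  exact hu (hinj (by rw [h, map_zero]))

theorem inner_starProjection_self_ne_zero {T : Submodule ℝ E} {v : E}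
    (h : T.starProjection v ≠ 0) : ⟪T.starProjection v, v⟫ ≠ 0 := by
  have h1 : ⟪T.starProjection v, v⟫ = ⟪T.starProjection v, T.starProjection v⟫ := by
    rw [← Submodule.inner_starProjection_left_eq_right,
      Submodule.starProjection_eq_self_iff.2 (Submodule.starProjection_apply_mem T v)]
  rw [h1]
  exact inner_self_ne_zero.2 h

end Single

variable {V₁ : Type*} [NormedAddCommGroup V₁] [InnerProductSpace ℝ V₁] [FiniteDimensional ℝ V₁]
  {H₁ : Type*} [TopologicalSpace H₁] {I₁ : ModelWithCorners ℝ V₁ H₁} [I₁.Boundaryless]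
  {M₁ : Type*} [TopologicalSpace M₁] [ChartedSpace H₁ M₁] [IsManifold I₁ ∞ M₁]
  {E₁ : Type*} [NormedAddCommGroup E₁] [InnerProductSpace ℝ E₁] [FiniteDimensional ℝ E₁]
  {V₂ : Type*} [NormedAddCommGroup V₂] [InnerProductSpace ℝ V₂] [FiniteDimensional ℝ V₂]
  {H₂ : Type*} [TopologicalSpace H₂] {I₂ : ModelWithCorners ℝ V₂ H₂} [I₂.Boundaryless]
  {M₂ : Type*} [TopologicalSpace M₂] [ChartedSpace H₂ M₂] [IsManifold I₂ ∞ M₂]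
  {E₂ : Type*} [NormedAddCommGroup E₂] [InnerProductSpace ℝ E₂] [FiniteDimensional ℝ E₂]
  {f₁ : M₁ → E₁} {f₂ : M₂ → E₂} (hf₁ : IsMinimalSubmanifold I₁ f₁)
  (hf₂ : IsMinimalSubmanifold I₂ f₂) {c₁ c₂ : ℝ}

/-- If a product lies in a linear subspace of codimension one over its own cone, its factors have
vanishing second fundamental forms. -/
theorem sff_eq_zero_of_finrank_le (hc₁ : c₁ ≠ 0) (hc₂ : c₂ ≠ 0)
    (R : Submodule ℝ (WithLp 2 (E₁ × E₂)))
    (hR : Module.finrank ℝ R ≤ Module.finrank ℝ V₁ + Module.finrank ℝ V₂ + 2)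
    (hmem : ∀ z, productMap c₁ c₂ f₁ f₂ z ∈ R) (x : M₁) (y : M₂) (v : E₁) (w : E₂)
    (hv : (tangentSubspace I₁ f₁ x).starProjection v ≠ 0)
    (hw : (tangentSubspace I₂ f₂ y).starProjection w ≠ 0) :
    sffAmbient (hf₁.immersion x) v v = 0 ∧ sffAmbient (hf₂.immersion y) w w = 0 := by
  set T₁ := tangentSubspace I₁ f₁ x
  set T₂ := tangentSubspace I₂ f₂ y
  set q₁ := ⟪T₁.starProjection v, v⟫ with hq₁
  set q₂ := ⟪T₂.starProjection w, w⟫ with hq₂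
  have hq₁0 : q₁ ≠ 0 := inner_starProjection_self_ne_zero hv
  have hq₂0 : q₂ ≠ 0 := inner_starProjection_self_ne_zero hw
  set h₁ := sffAmbient (hf₁.immersion x) v v with hh₁
  set h₂ := sffAmbient (hf₂.immersion y) w w with hh₂
  -- A linear relation satisfied by the product separates the variables, so each factor has a
  -- constant component. By `inner_sff_of_inner_const` this determines that component of its second
  -- fundamental form.
  have horth : ∀ z ∈ Rᗮ, ∀ x' y', c₁ * ⟪f₁ x', (WithLp.ofLp z).1⟫ +
      c₂ * ⟪f₂ y', (WithLp.ofLp z).2⟫ = 0 := fun z hz x' y' => by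
    have h := (Submodule.mem_orthogonal _ _).1 hz _ (hmem (x', y'))
    rw [WithLp.prod_inner_apply] at h
    change ⟪c₁ • f₁ x', _⟫ + ⟪c₂ • f₂ y', _⟫ = 0 at h
    rwa [real_inner_smul_left, real_inner_smul_left] at h
  have hconst₁ : ∀ z ∈ Rᗮ, ∀ x', ⟪f₁ x', (WithLp.ofLp z).1⟫ = ⟪f₁ x, (WithLp.ofLp z).1⟫ :=
    fun z hz x' => by
      have h1 := horth z hz x' y
      have h2 := horth z hz x y
      exact mul_left_cancel₀ hc₁ (by linarith)
  have hconst₂ : ∀ z ∈ Rᗮ, ∀ y', ⟪f₂ y', (WithLp.ofLp z).2⟫ = ⟪f₂ y, (WithLp.ofLp z).2⟫ :=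
    fun z hz y' => by
      have h1 := horth z hz x y'
      have h2 := horth z hz x y
      exact mul_left_cancel₀ hc₂ (by linarith)
  -- The space `R` contains the tangent vectors, the position vector (coefficient `l`), and the
  -- second derivatives `h - q • f` of either factor (coefficients `m` and `k`).
  have hin : ∀ (a : E₁) (b : E₂) (l m k : ℝ), a ∈ T₁ → b ∈ T₂ →
      WithLp.toLp 2 (a + (l * c₁ - m * q₁) • f₁ x + m • h₁,
        b + (l * c₂ - k * q₂) • f₂ y + k • h₂) ∈ R := by
    intro a b l m k ha hb
    rw [← Submodule.orthogonal_orthogonal R, Submodule.mem_orthogonal']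
    intro z hz
    have s1 := (inner_sff_of_inner_const hf₁ (hconst₁ z hz) x v v).1
    have s2 := (inner_sff_of_inner_const hf₂ (hconst₂ z hz) y w w).1
    have s3 := (inner_sff_of_inner_const hf₁ (hconst₁ z hz) x a a).2
    have s4 := (inner_sff_of_inner_const hf₂ (hconst₂ z hz) y b b).2
    rw [Submodule.starProjection_eq_self_iff.2 ha] at s3
    rw [Submodule.starProjection_eq_self_iff.2 hb] at s4
    rw [← hh₁, ← hq₁] at s1
    rw [← hh₂, ← hq₂] at s2
    rw [WithLp.prod_inner_apply]
    change ⟪a + (l * c₁ - m * q₁) • f₁ x + m • h₁, _⟫ +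
      ⟪b + (l * c₂ - k * q₂) • f₂ y + k • h₂, _⟫ = 0
    simp only [inner_add_left, real_inner_smul_left, s1, s2, s3, s4]
    linear_combination l * horth z hz x y
  set L : (T₁ × T₂) × (ℝ × ℝ × ℝ) →ₗ[ℝ] R :=
    { toFun := fun z => ⟨_, hin z.1.1 z.1.2 z.2.1 z.2.2.1 z.2.2.2 z.1.1.2 z.1.2.2⟩
      map_add' := fun z z' => by
        ext1
        simp only [Prod.fst_add, Prod.snd_add, Submodule.coe_add, ← WithLp.toLp_add,
          Prod.mk_add_mk]
        congr 2 <;> module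
      map_smul' := fun r z => by
        ext1
        simp only [Prod.smul_fst, Prod.smul_snd, Submodule.coe_smul, ← WithLp.toLp_smul,
          Prod.smul_mk, smul_eq_mul, RingHom.id_apply]
        congr 2 <;> module } with hL
  -- The source has dimension `n₁ + n₂ + 3`, one more than `R` can hold. In a nontrivial relation
  -- none of `l`, `m`, `k` can vanish, so both `m • h₁ = 0` and `k • h₂ = 0` are informative.
  have hker : LinearMap.ker L ≠ ⊥ := by
    apply LinearMap.ker_ne_bot_of_finrank_lt
    have e1 : Module.finrank ℝ T₁ = Module.finrank ℝ V₁ := finrank_tangentSubspace (hf₁.immersion x)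
    have e2 : Module.finrank ℝ T₂ = Module.finrank ℝ V₂ := finrank_tangentSubspace (hf₂.immersion y)
    simp only [Module.finrank_prod, Module.finrank_self, e1, e2]
    omega
  obtain ⟨⟨⟨a, b⟩, l, m, k⟩, hz, hz0⟩ := Submodule.exists_mem_ne_zero_of_ne_bot hker
  have hz1 := congrArg (fun r : R => WithLp.ofLp (r : WithLp 2 (E₁ × E₂))) (LinearMap.mem_ker.1 hz)
  have hA : (a : E₁) + (l * c₁ - m * q₁) • f₁ x + m • h₁ = 0 := congrArg Prod.fst hz1
  have hB : (b : E₂) + (l * c₂ - k * q₂) • f₂ y + k • h₂ = 0 := congrArg Prod.snd hz1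
  obtain ⟨a0, r0, m0⟩ := decompose_eq_zero hf₁ x a.2 v _ _ hA
  obtain ⟨b0, s0, k0⟩ := decompose_eq_zero hf₂ y b.2 w _ _ hB
  have hl : l ≠ 0 := by
    rintro rfl
    have hm : m = 0 := by
      rw [zero_mul, zero_sub, neg_eq_zero] at r0
      exact (mul_eq_zero.1 r0).resolve_right hq₁0
    have hk : k = 0 := by
      rw [zero_mul, zero_sub, neg_eq_zero] at s0
      exact (mul_eq_zero.1 s0).resolve_right hq₂0
    refine hz0 ?_
    rw [hm, hk, Submodule.coe_eq_zero.1 a0, Submodule.coe_eq_zero.1 b0]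
    rfl
  have hm : m ≠ 0 := by
    rintro rfl
    rw [zero_mul, sub_zero] at r0
    exact (mul_ne_zero hl hc₁) r0
  have hk : k ≠ 0 := by
    rintro rfl
    rw [zero_mul, sub_zero] at s0
    exact (mul_ne_zero hl hc₂) s0
  exact ⟨(smul_eq_zero.1 m0).resolve_left hm, (smul_eq_zero.1 k0).resolve_left hk⟩

/-- Congruence compares images only, so no information about derivatives is at hand. It does place
the product in the range of an isometry from a space of dimension `n₁ + n₂ + 2`, and that suffices.
-/
theorem squaredLength_eq_zero_of_isCongruentTo_clifford [Nonempty M₁] [Nonempty M₂]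
    [Nontrivial V₁] [Nontrivial V₂] (hf₁ : IsMinimalSubmanifold I₁ f₁)
    (hf₂ : IsMinimalSubmanifold I₂ f₂) (hc₁ : c₁ ≠ 0) (hc₂ : c₂ ≠ 0)
    (h : IsCongruentTo (productMap c₁ c₂ f₁ f₂)
      (cliffordHypersurface (Module.finrank ℝ V₁) (Module.finrank ℝ V₂))) (x : M₁) (y : M₂) :
    squaredLength I₁ f₁ x = 0 ∧ squaredLength I₂ f₂ y = 0 := by
  obtain ⟨A, hA⟩ := h
  have hmem : ∀ z, productMap c₁ c₂ f₁ f₂ z ∈ LinearMap.range A.toLinearMap := fun z => by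
    have h1 : productMap c₁ c₂ f₁ f₂ z ∈ Set.range (productMap c₁ c₂ f₁ f₂) := ⟨z, rfl⟩
    rw [hA] at h1
    obtain ⟨w, -, hw⟩ := h1
    exact ⟨w, hw⟩
  have hR : Module.finrank ℝ (LinearMap.range A.toLinearMap) ≤
      Module.finrank ℝ V₁ + Module.finrank ℝ V₂ + 2 := by
    refine (LinearMap.finrank_range_le _).trans ?_
    rw [(WithLp.linearEquiv 2 ℝ _).finrank_eq, Module.finrank_prod, finrank_euclideanSpace_fin,
      finrank_euclideanSpace_fin]
    omega
  obtain ⟨v, hv⟩ := exists_starProjection_ne_zero hf₁ x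
  obtain ⟨w, hw⟩ := exists_starProjection_ne_zero hf₂ y
  exact ⟨squaredLength_eq_zero_of_diag hf₁ x fun v hv =>
      (sff_eq_zero_of_finrank_le hf₁ hf₂ hc₁ hc₂ _ hR hmem x y v w hv hw).1,
    squaredLength_eq_zero_of_diag hf₂ y fun w hw =>
      (sff_eq_zero_of_finrank_le hf₁ hf₂ hc₁ hc₂ _ hR hmem x y v w hv hw).2⟩

/-! ### Equations of the Veronese surface -/

theorem exists_eq_mul_of_minors (Y : Fin 3 → Fin 3 → ℝ)
    (hm : ∀ i j k, Y i j * Y i k = Y i i * Y j k) (ht : Y 0 0 + Y 1 1 + Y 2 2 = 1) :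
    ∃ y : Fin 3 → ℝ, ∀ j k, Y j k = y j * y k := by
  have h : ∃ i, 0 < Y i i := by
    by_contra! h
    linarith [h 0, h 1, h 2]
  obtain ⟨i, hi⟩ := h
  refine ⟨fun j => Y i j / √(Y i i), fun j k => ?_⟩
  have hs : √(Y i i) * √(Y i i) = Y i i := Real.mul_self_sqrt hi.le
  rw [div_mul_div_comm, hs, hm, mul_div_cancel_left₀ _ hi.ne']

/-- The quadratic polynomial map defining the Veronese surface. -/
def veronesePoly (y : EuclideanSpace ℝ (Fin 3)) : EuclideanSpace ℝ (Fin 5) :=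
  !₂[√3 * (y 0 * y 1), √3 * (y 0 * y 2), √3 * (y 1 * y 2),
    √3 / 2 * (y 0 ^ 2 - y 1 ^ 2), (y 0 ^ 2 + y 1 ^ 2 - 2 * y 2 ^ 2) / 2]

/-- The symmetric matrix `y yᵀ` recovered from the image `q` of `y` on the Veronese surface. -/
def veroneseMatrix (q : Fin 5 → ℝ) : Fin 3 → Fin 3 → ℝ :=
  ![![(1 + q 4) / 3 + √3 / 3 * q 3, √3 / 3 * q 0, √3 / 3 * q 1],
    ![√3 / 3 * q 0, (1 + q 4) / 3 - √3 / 3 * q 3, √3 / 3 * q 2],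
    ![√3 / 3 * q 1, √3 / 3 * q 2, (1 - 2 * q 4) / 3]]

theorem sq_sqrt_three : √3 ^ 2 = (3 : ℝ) := Real.sq_sqrt (by norm_num)

theorem veroneseMatrix_veronesePoly {y : EuclideanSpace ℝ (Fin 3)} (hy : ‖y‖ = 1) (j k : Fin 3) :
    veroneseMatrix (veronesePoly y) j k = y j * y k := by
  have h : y 0 ^ 2 + y 1 ^ 2 + y 2 ^ 2 = 1 := by
    have := EuclideanSpace.real_norm_sq_eq y
    rw [hy, Fin.sum_univ_three] at this
    linarith
  have h3 := sq_sqrt_three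
  fin_cases j <;> fin_cases k <;> simp [veroneseMatrix, veronesePoly] <;>
    first
      | linear_combination (y 0 * y 1) / 3 * h3
      | linear_combination (y 0 * y 2) / 3 * h3
      | linear_combination (y 1 * y 2) / 3 * h3
      | linear_combination (y 0 ^ 2 - y 1 ^ 2) / 6 * h3 - h / 3
      | linear_combination -(y 0 ^ 2 - y 1 ^ 2) / 6 * h3 - h / 3
      | linear_combination - h / 3

/-- The Veronese surface is the set of points of the unit sphere where the gradient of its cubic
form is radial. -/
theorem exists_veronesePoly_eq (q : Fin 5 → ℝ)
    (e0 : 6 * q 4 ^ 2 + 3 * (q 1 ^ 2 + q 2 ^ 2) - 6 * (q 0 ^ 2 + q 3 ^ 2) = -6 * q 4)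
    (e1 : -6 * q 4 * q 1 + 6 * √3 * (q 1 * q 3 + q 2 * q 0) = 6 * q 1)
    (e2 : -6 * q 4 * q 2 + 6 * √3 * (-(q 2 * q 3) + q 1 * q 0) = 6 * q 2)
    (e3 : 12 * q 4 * q 3 + 3 * √3 * (q 1 ^ 2 - q 2 ^ 2) = 6 * q 3)
    (e4 : 12 * q 4 * q 0 + 6 * √3 * (q 1 * q 2) = 6 * q 0)
    (eN : q 0 ^ 2 + q 1 ^ 2 + q 2 ^ 2 + q 3 ^ 2 + q 4 ^ 2 = 1) :
    ∃ y : EuclideanSpace ℝ (Fin 3), ‖y‖ = 1 ∧ ∀ i, q i = veronesePoly y i := by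
  have h3 := sq_sqrt_three
  set k := √3
  have a1 : q 1 ^ 2 + q 2 ^ 2 = 2 / 3 * (1 - q 4 - 2 * q 4 ^ 2) := by linear_combination (e0 + 6 * eN) / 9
  have a2 : q 0 ^ 2 + q 3 ^ 2 = (1 + q 4) ^ 2 / 3 := by linear_combination eN - a1
  have a3 : k * (q 1 ^ 2 - q 2 ^ 2) = 2 * q 3 * (1 - 2 * q 4) := by linear_combination e3 / 3
  have a3' : q 1 ^ 2 - q 2 ^ 2 = 2 * k / 3 * q 3 * (1 - 2 * q 4) := by
    linear_combination k / 3 * a3 - (q 1 ^ 2 - q 2 ^ 2) / 3 * h3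
  have a4 : k * (q 1 * q 2) = q 0 * (1 - 2 * q 4) := by linear_combination e4 / 6
  have a4' : q 1 * q 2 = k / 3 * q 0 * (1 - 2 * q 4) := by
    linear_combination k / 3 * a4 - (q 1 * q 2) / 3 * h3
  have a5 : k * (q 1 * q 3 + q 2 * q 0) = q 1 * (1 + q 4) := by linear_combination e1 / 6
  have a6 : k * (-(q 2 * q 3) + q 1 * q 0) = q 2 * (1 + q 4) := by linear_combination e2 / 6
  -- The six relations `r` and `s` are the vanishing 2×2 minors of `veroneseMatrix q`. As this
  -- matrix has trace one, it has the form `y yᵀ`.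
  have r01 : k / 3 * q 0 * (k / 3 * q 0) =
      ((1 + q 4) / 3 + k / 3 * q 3) * ((1 + q 4) / 3 - k / 3 * q 3) := by
    linear_combination (q 0 ^ 2 + q 3 ^ 2) / 9 * h3 + a2 / 3
  have r02 : k / 3 * q 1 * (k / 3 * q 1) =
      ((1 + q 4) / 3 + k / 3 * q 3) * ((1 - 2 * q 4) / 3) := by
    linear_combination q 1 ^ 2 / 9 * h3 + (a1 + a3') / 6
  have r12 : k / 3 * q 2 * (k / 3 * q 2) =
      ((1 + q 4) / 3 - k / 3 * q 3) * ((1 - 2 * q 4) / 3) := by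
    linear_combination q 2 ^ 2 / 9 * h3 + (a1 - a3') / 6
  have s0 : k / 3 * q 0 * (k / 3 * q 1) = ((1 + q 4) / 3 + k / 3 * q 3) * (k / 3 * q 2) := by
    linear_combination k / 9 * a6
  have s1 : k / 3 * q 0 * (k / 3 * q 2) = ((1 + q 4) / 3 - k / 3 * q 3) * (k / 3 * q 1) := by
    linear_combination k / 9 * a5
  have s2 : k / 3 * q 1 * (k / 3 * q 2) = (1 - 2 * q 4) / 3 * (k / 3 * q 0) := by
    linear_combination k / 9 * a4
  obtain ⟨y, hy⟩ := exists_eq_mul_of_minors (veroneseMatrix q) (by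
    intro i j l
    fin_cases i <;> fin_cases j <;> fin_cases l <;> simp [veroneseMatrix] <;>
    first
      | ring1
      | linear_combination r01
      | linear_combination r02
      | linear_combination r12
      | linear_combination s0
      | linear_combination s1
      | linear_combination s2) (by
    simp [veroneseMatrix]; ring)
  have h00 : (1 + q 4) / 3 + k / 3 * q 3 = y 0 * y 0 := hy 0 0
  have h01 : k / 3 * q 0 = y 0 * y 1 := hy 0 1
  have h02 : k / 3 * q 1 = y 0 * y 2 := hy 0 2
  have h11 : (1 + q 4) / 3 - k / 3 * q 3 = y 1 * y 1 := hy 1 1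
  have h12 : k / 3 * q 2 = y 1 * y 2 := hy 1 2
  have h22 : (1 - 2 * q 4) / 3 = y 2 * y 2 := hy 2 2
  refine ⟨WithLp.toLp 2 y, ?_, fun i => ?_⟩
  · rw [← sq_eq_sq₀ (norm_nonneg _) zero_le_one, EuclideanSpace.real_norm_sq_eq,
      Fin.sum_univ_three]
    linear_combination -h00 - h11 - h22
  · fin_cases i <;> simp [veronesePoly]
    · linear_combination k * h01 - q 0 / 3 * h3
    · linear_combination k * h02 - q 1 / 3 * h3
    · linear_combination k * h12 - q 2 / 3 * h3
    · linear_combination k / 2 * (h00 - h11) - q 3 / 3 * h3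
    · linear_combination (h00 + h11 - 2 * h22) / 2

/-! ### Recognition of the Veronese surface -/

namespace SphereCalculus

variable {E : Type*} [NormedAddCommGroup E] [InnerProductSpace ℝ E]
    [FiniteDimensional ℝ E] {n : ℕ} {M A : Type*} [CommRing A] [Algebra ℝ A]
    (C : SphereCalculus E n M A)

/-- The directional derivatives of the cubic form at a point of the surface. -/
theorem cubic_gradient (hn : n = 2) (hg : ∀ v a u c, C.gam v a u c = 0)
    (hV : ∀ x, C.VeroneseAt x)
    (hconst : ∀ φ, (∀ v, C.D v φ = 0) → ∀ x y, C.ev x φ = C.ev y φ) (p z : M) (d : E)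
    (e : OrthonormalBasis (Fin 2) ℝ (C.T p)) :
    6 * ⟪C.pt z, d⟫ =
      6 * ⟪C.pt p, C.pt z⟫ ^ 2 * ⟪C.pt p, d⟫
      + 3 * ⟪C.pt p, d⟫ * (⟪(e 0 : E), C.pt z⟫ ^ 2 + ⟪(e 1 : E), C.pt z⟫ ^ 2)
      + 6 * ⟪C.pt p, C.pt z⟫ * (⟪(e 0 : E), C.pt z⟫ * ⟪(e 0 : E), d⟫
        + ⟪(e 1 : E), C.pt z⟫ * ⟪(e 1 : E), d⟫)
      - 18 * ⟪C.pt p, d⟫ * (⟪C.H p (e 0) (e 0), C.pt z⟫ ^ 2 + ⟪C.H p (e 0) (e 1), C.pt z⟫ ^ 2)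
      - 36 * ⟪C.pt p, C.pt z⟫ * (⟪C.H p (e 0) (e 0), C.pt z⟫ * ⟪C.H p (e 0) (e 0), d⟫
        + ⟪C.H p (e 0) (e 1), C.pt z⟫ * ⟪C.H p (e 0) (e 1), d⟫)
      + 9 * ((2 * ⟪(e 0 : E), C.pt z⟫ * ⟪(e 0 : E), d⟫
          - 2 * ⟪(e 1 : E), C.pt z⟫ * ⟪(e 1 : E), d⟫) * ⟪C.H p (e 0) (e 0), C.pt z⟫
        + (⟪(e 0 : E), C.pt z⟫ ^ 2 - ⟪(e 1 : E), C.pt z⟫ ^ 2) * ⟪C.H p (e 0) (e 0), d⟫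
        + 2 * (⟪(e 0 : E), d⟫ * ⟪(e 1 : E), C.pt z⟫ + ⟪(e 0 : E), C.pt z⟫ * ⟪(e 1 : E), d⟫)
          * ⟪C.H p (e 0) (e 1), C.pt z⟫
        + 2 * ⟪(e 0 : E), C.pt z⟫ * ⟪(e 1 : E), C.pt z⟫ * ⟪C.H p (e 0) (e 1), d⟫) := by
  set b := stdOrthonormalBasis ℝ E
  have htr : ∀ c, C.ev p (C.t (e 1 : E) (e 1) c) = -C.ev p (C.t (e 0 : E) (e 0) c) := fun c => by
    have := C.trace_tangent e c
    rw [Fin.sum_univ_two] at this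
    linarith
  have hsy : ∀ c, C.t (e 1 : E) (e 0) c = C.t (e 0 : E) (e 1) c := fun c => C.t_symm _ _ _
  have hp : ∀ a, C.ev p (C.cubic b a) = 2 * ⟪C.pt p, a⟫ ^ 3
      + 3 * ⟪C.pt p, a⟫ * (⟪(e 0 : E), a⟫ ^ 2 + ⟪(e 1 : E), a⟫ ^ 2)
      - 18 * ⟪C.pt p, a⟫ * (⟪C.H p (e 0) (e 0), a⟫ ^ 2 + ⟪C.H p (e 0) (e 1), a⟫ ^ 2)
      + 9 * ((⟪(e 0 : E), a⟫ ^ 2 - ⟪(e 1 : E), a⟫ ^ 2) * ⟪C.H p (e 0) (e 0), a⟫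
        + 2 * ⟪(e 0 : E), a⟫ * ⟪(e 1 : E), a⟫ * ⟪C.H p (e 0) (e 1), a⟫) := fun a => by
    have hK : C.ev p (C.Kn b a a) =
        2 * (⟪C.H p (e 0) (e 0), a⟫ ^ 2 + ⟪C.H p (e 0) (e 1), a⟫ ^ 2) := by
      simp only [Kn, map_sum, map_mul]
      rw [C.sum_t_mul_t_tangent b e]
      simp only [Fin.sum_univ_two, hsy, htr, C.inner_H]
      ring
    have hT := C.ev_t_eq_sum e a a a
    simp only [Fin.sum_univ_two, hsy, htr] at hT
    simp only [cubic, map_add, map_sub, map_smul, map_mul, map_pow, smul_eq_mul, hK, hT, C.ev_F,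
      C.ev_p_eq_sum e a a, Fin.sum_univ_two, C.inner_H]
    ring
  -- Evaluated at `z` itself the cubic has linear coefficient `6 * ⟪pt z, d⟫` in `s`, so its
  -- gradient is radial. Evaluated at `p` it is the explicit polynomial in the frame there.
  have hz : ∀ s : ℝ, C.ev z (C.cubic b (C.pt z + s • d)) =
      2 * (1 + s * ⟪C.pt z, d⟫) ^ 3 + 3 * (1 + s * ⟪C.pt z, d⟫) * (s ^ 2 * C.ev z (C.p d d))
      - 9 * (1 + s * ⟪C.pt z, d⟫) * (s ^ 2 * C.ev z (C.Kn b d d))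
      + 9 * (s ^ 3 * C.ev z (C.t d d d)) := fun s => by
    have k1 : C.ev z (C.Kn b (C.pt z + s • d) (C.pt z + s • d)) = s ^ 2 * C.ev z (C.Kn b d d) := by
      simp only [Kn, map_sum, map_mul, map_add, map_smul, C.t_pt, zero_add, smul_eq_mul,
        Finset.mul_sum]
      exact Finset.sum_congr rfl fun i _ => Finset.sum_congr rfl fun j _ => by ring
    have k2 : C.ev z (C.p (C.pt z + s • d) (C.pt z + s • d)) = s ^ 2 * C.ev z (C.p d d) := by
      have : C.ev z (C.p d (C.pt z)) = 0 := by rw [C.p_symm, C.p_orth z _ (C.pt_mem z)]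
      simp only [map_add, LinearMap.add_apply, map_smul, LinearMap.smul_apply, smul_eq_mul,
        C.p_orth z _ (C.pt_mem z), this]
      ring
    have k3 : C.ev z (C.t (C.pt z + s • d) (C.pt z + s • d) (C.pt z + s • d)) =
        s ^ 3 * C.ev z (C.t d d d) := by
      simp only [map_add, LinearMap.add_apply, map_smul, LinearMap.smul_apply, smul_eq_mul,
        C.t_orth z _ (C.pt_mem z), C.t_orth' z _ (C.pt_mem z), C.t_pt]
      ring
    have k4 : C.ev z (C.F (C.pt z + s • d)) = 1 + s * ⟪C.pt z, d⟫ := by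
      rw [C.ev_F, inner_add_right, real_inner_smul_right, real_inner_self_eq_norm_sq, C.norm_pt,
        one_pow]
    simp only [cubic, map_sub, map_mul, map_pow, smul_eq_mul, k1, k2, k3, k4, map_smul,
      map_add (C.ev z)]
    ring
  have hs : ∀ s : ℝ, _ := fun s => (hz s).symm.trans
    ((hconst _ (fun v => C.D_cubic b hn hg hV v _) z p).trans (hp (C.pt z + s • d)))
  have s1 := hs 1
  have s2 := hs (-1)
  have s3 := hs 2
  have s4 := hs (-2)
  simp only [inner_add_right, real_inner_smul_right] at s1 s2 s3 s4
  -- The five-point difference quotient, exact on cubic polynomials, extracts the coefficient of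
  -- `s`.
  linear_combination (8 * (s1 - s2) - (s3 - s4)) / 12

end SphereCalculus

namespace SphereCalculus

variable {E : Type*} [NormedAddCommGroup E] [InnerProductSpace ℝ E]
    [FiniteDimensional ℝ E] {n : ℕ} {M A : Type*} [CommRing A] [Algebra ℝ A]
    (C : SphereCalculus E n M A)

/-- The first osculating space of the Veronese surface contains the whole surface. -/
theorem inner_pt_eq_zero (hg : ∀ v a u c, C.gam v a u c = 0) (hV : ∀ x, C.VeroneseAt x)
    (hconst : ∀ φ, (∀ v, C.D v φ = 0) → ∀ x y, C.ev x φ = C.ev y φ) {p : M}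
    (e : OrthonormalBasis (Fin 2) ℝ (C.T p)) {c : E} (h0 : ⟪C.pt p, c⟫ = 0)
    (he : ∀ i, ⟪(e i : E), c⟫ = 0) (hH : ∀ i, ⟪C.H p (e 0) (e i), c⟫ = 0) (z : M) :
    ⟪C.pt z, c⟫ = 0 := by
  set b := stdOrthonormalBasis ℝ E
  have htr : C.ev p (C.t (e 1 : E) (e 1) c) = -C.ev p (C.t (e 0 : E) (e 0) c) := by
    have := C.trace_tangent e c
    rw [Fin.sum_univ_two] at this
    linarith
  have hsy : C.t (e 1 : E) (e 0) c = C.t (e 0 : E) (e 1) c := C.t_symm _ _ _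
  simp only [C.inner_H] at hH
  have h1 := hconst _ (fun v => C.D_osculating_eq_zero b hg hV v c c) z p
  have h2 : C.ev p (C.Kn b c c) = 0 := by
    simp only [Kn, map_sum, map_mul]
    rw [C.sum_t_mul_t_tangent b e]
    simp [Fin.sum_univ_two, hsy, htr, hH]
  have h3 : C.ev p (C.p c c) = 0 := by
    rw [C.ev_p_eq_sum e]
    simp [he]
  have h4 : 0 ≤ C.ev z (C.p c c) := by
    rw [C.ev_p]
    exact Submodule.re_inner_starProjection_nonneg (𝕜 := ℝ) _ c
  have h5 : 0 ≤ C.ev z (C.Kn b c c) := by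
    simp only [Kn, map_sum, map_mul]
    exact Finset.sum_nonneg fun i _ => Finset.sum_nonneg fun j _ => mul_self_nonneg _
  simp only [map_add, map_mul, map_smul, smul_eq_mul, C.ev_F, h2, h3, h0] at h1
  nlinarith [mul_self_nonneg ⟪C.pt z, c⟫]

/-- The frame at one point `p` spans the constant osculating space. In these coordinates the radial
gradient of the cubic becomes the system solved by `exists_veronesePoly_eq`. -/
theorem exists_veronese_coords [Nonempty M] (hn : n = 2) (hg : ∀ v a u c, C.gam v a u c = 0)
    (hV : ∀ x, C.VeroneseAt x)
    (hconst : ∀ φ, (∀ v, C.D v φ = 0) → ∀ x y, C.ev x φ = C.ev y φ) :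
    ∃ w : Fin 5 → E, Orthonormal ℝ w ∧
      ∀ z, ∃ y, ‖y‖ = 1 ∧ C.pt z = ∑ i, veronesePoly y i • w i := by
  obtain ⟨p⟩ := ‹Nonempty M›
  set e := C.frame hn p
  have h3 := sq_sqrt_three
  have hee : ∀ i j, ⟪(e i : E), (e j : E)⟫ = if i = j then 1 else 0 := fun i j => by
    rw [← Submodule.coe_inner]
    exact orthonormal_iff_ite.1 e.orthonormal i j
  have hp : ∀ i j, C.ev p (C.p (e i) (e j)) = if i = j then 1 else 0 := fun i j => by
    rw [C.ev_p, Submodule.starProjection_eq_self_iff.2 (e i).2, hee]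
  have g0 : ⟪C.H p (e 0) (e 0), C.H p (e 0) (e 0)⟫ = 1 / 3 := by
    rw [hV p]; simp [hp]
  have g1 : ⟪C.H p (e 0) (e 1), C.H p (e 0) (e 1)⟫ = 1 / 3 := by
    rw [hV p]; simp [hp]
  have g2 : ⟪C.H p (e 0) (e 0), C.H p (e 0) (e 1)⟫ = 0 := by
    rw [hV p]; simp [hp]
  have g2' : ⟪C.H p (e 0) (e 1), C.H p (e 0) (e 0)⟫ = 0 := by
    rw [real_inner_comm, g2]
  have g3 : ∀ i j k, ⟪(e i : E), C.H p (e j) (e k)⟫ = 0 := fun i j k =>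
    (Submodule.mem_orthogonal _ _).1 (C.H_mem p _ _) _ (e i).2
  have g3' : ∀ i j k, ⟪C.H p (e j) (e k), (e i : E)⟫ = 0 := fun i j k => by
    rw [real_inner_comm, g3]
  have g4 : ∀ j k, ⟪C.H p (e j) (e k), C.pt p⟫ = 0 := fun j k => by
    rw [C.inner_H, C.t_pt]
  have g4' : ∀ j k, ⟪C.pt p, C.H p (e j) (e k)⟫ = 0 := fun j k => by
    rw [real_inner_comm, g4]
  have g5 : ∀ i, ⟪(e i : E), C.pt p⟫ = 0 := fun i =>
    (Submodule.mem_orthogonal _ _).1 (C.pt_mem p) _ (e i).2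
  have g5' : ∀ i, ⟪C.pt p, (e i : E)⟫ = 0 := fun i => by rw [real_inner_comm, g5]
  have hpp : ⟪C.pt p, C.pt p⟫ = 1 := by rw [real_inner_self_eq_norm_sq, C.norm_pt, one_pow]
  have hmul : √3 * (√3 * 3⁻¹) = (1 : ℝ) := by linear_combination h3 / 3
  -- The values of `h` on the frame have squared length `1 / 3`, whence the factor `√3`. The sign
  -- makes `p` correspond to the pole, as `veronesePoly` takes `(0, 0, 1)` to minus the last basis
  -- vector.
  set w : Fin 5 → E := ![√3 • C.H p (e 0) (e 1), e 0, e 1, √3 • C.H p (e 0) (e 0), -C.pt p]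
    with hw
  have hwo : Orthonormal ℝ w := by
    rw [orthonormal_iff_ite]
    intro i j
    fin_cases i <;> fin_cases j <;>
      simp [hw, hee, g0, g1, g2, g2', g3, g3', g4, g4', g5, g5', real_inner_smul_left,
        real_inner_smul_right, hmul, hpp,
        -inner_self_eq_norm_sq_to_K]
  refine ⟨w, hwo, fun z => ?_⟩
  have hs0 : √3 ≠ 0 := by positivity
  -- The remainder is orthogonal to the osculating space at `p`, hence to every point of the
  -- surface, hence to itself.
  have hz : C.pt z = ∑ i, ⟪w i, C.pt z⟫ • w i := by
    set c := C.pt z - ∑ i, ⟪w i, C.pt z⟫ • w i with hc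
    have hwc : ∀ i, ⟪w i, c⟫ = 0 := fun i => by
      rw [hc, inner_sub_right, hwo.inner_right_fintype, sub_self]
    have k0 := hwc 0
    have k3 := hwc 3
    have k4 := hwc 4
    simp only [hw, Matrix.cons_val, real_inner_smul_left, mul_eq_zero, hs0, false_or,
      inner_neg_left, neg_eq_zero] at k0 k3 k4
    have h := C.inner_pt_eq_zero hg hV hconst e k4 (fun i => by
      fin_cases i
      · exact hwc 1
      · exact hwc 2) (fun i => by
      fin_cases i
      · exact k3
      · exact k0) z
    have hcc : ⟪c, c⟫ = 0 := by
      nth_rw 1 [hc]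
      rw [inner_sub_left, h, sum_inner]
      simp [real_inner_smul_left, hwc]
    exact sub_eq_zero.1 (inner_self_eq_zero.1 hcc)
  have hN : ∑ i, ⟪w i, C.pt z⟫ ^ 2 = 1 := by
    have h1 : ⟪C.pt z, C.pt z⟫ = 1 := by rw [real_inner_self_eq_norm_sq, C.norm_pt, one_pow]
    nth_rw 1 [hz] at h1
    rw [sum_inner] at h1
    rw [← h1]
    exact Finset.sum_congr rfl fun i _ => by rw [real_inner_smul_left, sq]
  have k0 : ⟪w 0, C.pt z⟫ = √3 * ⟪C.H p (e 0) (e 1), C.pt z⟫ := real_inner_smul_left _ _ _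
  have k3 : ⟪w 3, C.pt z⟫ = √3 * ⟪C.H p (e 0) (e 0), C.pt z⟫ := real_inner_smul_left _ _ _
  have k4 : ⟪w 4, C.pt z⟫ = -⟪C.pt p, C.pt z⟫ := inner_neg_left _ _
  have k1 : ⟪w 1, C.pt z⟫ = ⟪(e 0 : E), C.pt z⟫ := rfl
  have k2 : ⟪w 2, C.pt z⟫ = ⟪(e 1 : E), C.pt z⟫ := rfl
  have d0 := C.cubic_gradient hn hg hV hconst p z (C.H p (e 0) (e 1)) e
  have d1 := C.cubic_gradient hn hg hV hconst p z (e 0) e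
  have d2 := C.cubic_gradient hn hg hV hconst p z (e 1) e
  have d3 := C.cubic_gradient hn hg hV hconst p z (C.H p (e 0) (e 0)) e
  have d4 := C.cubic_gradient hn hg hV hconst p z (C.pt p) e
  rw [real_inner_comm] at d0 d1 d2 d3 d4
  have hee0 := hee 0 0
  have hee1 := hee 1 1
  have hee2 := hee 0 1
  have hee3 := hee 1 0
  simp only [if_true, one_ne_zero, zero_ne_one, if_false] at hee0 hee1 hee2 hee3
  simp only [g0, g1, g2, g2', g3, g3', g4, g4', g5, g5', hpp, hee0, hee1, hee2, hee3] at d0 d1 d2 d3 d4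
  obtain ⟨y, hy, hq⟩ := exists_veronesePoly_eq (fun i => ⟪w i, C.pt z⟫)
    (by
      simp only [k0, k1, k2, k3, k4]
      linear_combination -d4 - 6 * (⟪C.H p (e 0) (e 0), C.pt z⟫ ^ 2 + ⟪C.H p (e 0) (e 1), C.pt z⟫ ^ 2) * h3)
    (by
      simp only [k0, k1, k2, k3, k4]
      linear_combination -d1 + 6 * (⟪(e 0 : E), C.pt z⟫ * ⟪C.H p (e 0) (e 0), C.pt z⟫ +
        ⟪(e 1 : E), C.pt z⟫ * ⟪C.H p (e 0) (e 1), C.pt z⟫) * h3)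
    (by
      simp only [k0, k1, k2, k3, k4]
      linear_combination -d2 + 6 * (-⟪(e 1 : E), C.pt z⟫ * ⟪C.H p (e 0) (e 0), C.pt z⟫ +
        ⟪(e 0 : E), C.pt z⟫ * ⟪C.H p (e 0) (e 1), C.pt z⟫) * h3)
    (by
      simp only [k1, k2, k3, k4]
      linear_combination -√3 * d3)
    (by
      simp only [k0, k1, k2, k4]
      linear_combination -√3 * d0)
    (by rw [← hN, Fin.sum_univ_five])
  refine ⟨y, hy, ?_⟩
  simp_rw [← hq]
  exact hz

end SphereCalculus

/-! ### Covering the Veronese surface -/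

theorem continuous_veronesePoly : Continuous veronesePoly := by
  unfold veronesePoly
  fun_prop

theorem differentiable_veronesePoly : Differentiable ℝ veronesePoly := by
  rw [differentiable_euclidean]
  intro i
  fin_cases i <;> simp [veronesePoly] <;> fun_prop

theorem veronesePoly_smul {s : ℝ} (hs : s ^ 2 = 1) (y : EuclideanSpace ℝ (Fin 3)) :
    veronesePoly (s • y) = veronesePoly y := by
  rcases eq_or_eq_neg_of_sq_eq_sq s 1 (by rw [hs, one_pow]) with rfl | rfl
  · rw [one_smul]
  · ext i
    fin_cases i <;> simp [veronesePoly]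

theorem contDiff_veroneseMatrix_mulVec {E : Type*} [NormedAddCommGroup E] [InnerProductSpace ℝ E]
    (w : Fin 5 → E) (y₀ : EuclideanSpace ℝ (Fin 3)) :
    ContDiff ℝ ∞ fun a : E => WithLp.toLp 2 fun j =>
      ∑ k, veroneseMatrix (fun i => ⟪w i, a⟫) j k * y₀ k := by
  have h : ∀ i, ContDiff ℝ ∞ fun a : E => ⟪w i, a⟫ := fun i => contDiff_const.inner ℝ contDiff_id
  rw [contDiff_euclidean]
  intro j
  fin_cases j <;> simp [veroneseMatrix, Fin.sum_univ_three] <;> fun_prop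

namespace IsMinimalSubmanifold

variable {V : Type*} [NormedAddCommGroup V] [InnerProductSpace ℝ V] [FiniteDimensional ℝ V]
  {H : Type*} [TopologicalSpace H] {I : ModelWithCorners ℝ V H} [I.Boundaryless]
  {M : Type*} [TopologicalSpace M] [ChartedSpace H M] [IsManifold I ∞ M]
  {E : Type*} [NormedAddCommGroup E] [InnerProductSpace ℝ E] [FiniteDimensional ℝ E]
  {f : M → E}

/-- A closed minimal surface which factors locally through the Veronese surface covers it. -/
theorem exists_eq_veronesePoly (hf : IsMinimalSubmanifold I f) [CompactSpace M] [Nonempty M]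
    (hn : Module.finrank ℝ V = 2) {w : Fin 5 → E} (hwo : Orthonormal ℝ w)
    (hw : ∀ x, ∃ y, ‖y‖ = 1 ∧ f x = ∑ i, veronesePoly y i • w i)
    {y : EuclideanSpace ℝ (Fin 3)} (hy : ‖y‖ = 1) : ∃ x, f x = ∑ i, veronesePoly y i • w i := by
  set B : EuclideanSpace ℝ (Fin 3) → E := fun y => ∑ i, veronesePoly y i • w i with hB
  have hBc : Continuous B := by
    have h := continuous_veronesePoly
    refine continuous_finsetSum _ fun i _ => Continuous.smul ?_ continuous_const
    fun_prop
  have hBd : Differentiable ℝ B := by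
    have h := differentiable_veronesePoly
    rw [differentiable_euclidean] at h
    exact Differentiable.fun_sum fun i _ => (h i).smul_const _
  set S : Set (EuclideanSpace ℝ (Fin 3)) := B ⁻¹' Set.range f with hS
  have hSc : IsClosed S := (isCompact_range hf.contMDiff.continuous).isClosed.preimage hBc
  suffices y ∈ S from this
  obtain ⟨x₁⟩ := ‹Nonempty M›
  obtain ⟨y₁, hy₁, hfy₁⟩ := hw x₁
  refine sphere_subset (by simp) hSc ⟨y₁, ⟨x₁, hfy₁⟩, hy₁⟩ ?_ hy
  rintro y₀ ⟨x₀, hx₀⟩ hy₀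
  -- `P` applies the matrix `y yᵀ` recovered from a point of the surface to `y₀`, which yields `⟪y₀,
  -- y⟫ • y`. Normalized, this is a smooth local lift of `f` to the sphere, with the sign of `y`
  -- fixed by `y₀`.
  set P : E → EuclideanSpace ℝ (Fin 3) := fun a => WithLp.toLp 2 fun j =>
      ∑ k, veroneseMatrix (fun i => ⟪w i, a⟫) j k * y₀ k with hP
  have hPc : ContDiff ℝ ∞ P := contDiff_veroneseMatrix_mulVec w y₀
  have hPB : ∀ y, ‖y‖ = 1 → P (B y) = ⟪y₀, y⟫ • y := fun y hy => by
    have h : (fun i => ⟪w i, B y⟫) = veronesePoly y := by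
      funext i
      rw [hB, hwo.inner_right_fintype]
    ext j
    simp only [hP, h, veroneseMatrix_veronesePoly hy, PiLp.smul_apply, smul_eq_mul,
      PiLp.inner_apply, Finset.sum_mul]
    exact Finset.sum_congr rfl fun k _ => by
      simp
      ring
  have hPx₀ : P (f x₀) = y₀ := by
    rw [hx₀, hPB y₀ hy₀, real_inner_self_eq_norm_sq, hy₀, one_pow, one_smul]
  set l : EuclideanSpace ℝ (Fin 3) → EuclideanSpace ℝ (Fin 3) := fun z => ‖z‖⁻¹ • z with hl
  have hlP : ∀ x, P (f x) ≠ 0 → ‖l (P (f x))‖ = 1 ∧ f x = B (l (P (f x))) := fun x hx => by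
    refine ⟨norm_smul_inv_norm (𝕜 := ℝ) hx, ?_⟩
    obtain ⟨y, hy, hfy⟩ := hw x
    change f x = B y at hfy
    rw [hfy, hPB y hy] at hx ⊢
    simp only [hl, norm_smul, hy, mul_one, smul_smul, Real.norm_eq_abs, hB]
    rw [veronesePoly_smul]
    have : ⟪y₀, y⟫ ≠ 0 := fun h => by simp [h] at hx
    rw [mul_pow, inv_pow, sq_abs, inv_mul_cancel₀ (pow_ne_zero 2 this)]
  set u₀ := extChartAt I x₀ x₀
  set F : V → E := f ∘ (extChartAt I x₀).symm with hF
  have hFu₀ : F u₀ = f x₀ := by rw [hF, Function.comp_apply, extChartAt_to_inv]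
  have hFs : ContDiffAt ℝ ∞ F u₀ := contDiffAt_comp_symm I hf.contMDiff (mem_extChartAt_source x₀)
  have hPF : ContDiffAt ℝ ∞ (fun u => P (F u)) u₀ := hPc.contDiffAt.comp u₀ hFs
  have hy0 : y₀ ≠ 0 := fun h => by simp [h] at hy₀
  have hPF0 : P (F u₀) ≠ 0 := by rwa [hFu₀, hPx₀]
  have hg : ContDiffAt ℝ ∞ (fun u => l (P (F u))) u₀ :=
    ((hPF.norm ℝ hPF0).inv (norm_ne_zero_iff.2 hPF0)).smul hPF
  have hev : ∀ᶠ u in 𝓝 u₀, ‖l (P (F u))‖ = 1 ∧ F u = B (l (P (F u))) := by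
    filter_upwards [hPF.continuousAt.eventually (isOpen_ne.mem_nhds hPF0)] with u hu
    exact hlP _ hu
  have hgu₀ : l (P (F u₀)) = y₀ := by simp only [hFu₀, hPx₀, hl, hy₀, inv_one, one_smul]
  -- Locally `f` is `B` composed with the lift, so the lift inherits injectivity of the differential
  -- and its cone fills a neighbourhood of `y₀`.
  have hinj : Function.Injective (fderiv ℝ (fun u => l (P (F u))) u₀) := by
    have h1 := injective_fderiv_comp_symm hf.contMDiff (x := x₀) (hf.immersion x₀)
    have h2 : fderiv ℝ F u₀ = fderiv ℝ (B ∘ fun u => l (P (F u))) u₀ :=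
      Filter.EventuallyEq.fderiv_eq (hev.mono fun u hu => hu.2)
    rw [fderiv_comp _ (hBd _) (hg.differentiableAt (by simp))] at h2
    change Function.Injective (fderiv ℝ F u₀) at h1
    rw [h2, ContinuousLinearMap.coe_comp] at h1
    exact h1.of_comp
  have hcone := eventually_mem_cone (by simp [hn]) hg (hev.mono fun u hu => hu.1) hinj hev
  rw [hgu₀] at hcone
  filter_upwards [hcone] with v hv
  obtain ⟨u, ⟨hu1, hu2⟩, r, hr, rfl⟩ := hv
  rw [norm_smul, hu1, mul_one, Real.norm_of_nonneg hr.le, smul_smul, inv_mul_cancel₀ hr.ne',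
    one_smul]
  exact ⟨_, hu2⟩

/-- A closed minimal surface with the infinitesimal invariants of the Veronese surface is the
Veronese surface. -/
theorem isCongruentTo_veroneseSurface (hf : IsMinimalSubmanifold I f) [CompactSpace M]
    [ConnectedSpace M] (hn : Module.finrank ℝ V = 2)
    (hg : ∀ v a u c, (hf.sphereCalculus hn).gam v a u c = 0)
    (hV : ∀ x, (hf.sphereCalculus hn).VeroneseAt x) : IsCongruentTo f veroneseSurface := by
  obtain ⟨w, hwo, hw⟩ := (hf.sphereCalculus hn).exists_veronese_coords rfl hg hV
    fun φ h x y => hf.eq_of_derivation_eq_zero φ h x y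
  change ∀ x, ∃ y, ‖y‖ = 1 ∧ f x = _ at hw
  refine ⟨⟨(Fintype.linearCombination ℝ w).comp
    (WithLp.linearEquiv 2 ℝ (Fin 5 → ℝ)).toLinearMap, fun q => ?_⟩, ?_⟩
  · rw [← sq_eq_sq₀ (norm_nonneg _) (norm_nonneg _), EuclideanSpace.real_norm_sq_eq,
      ← real_inner_self_eq_norm_sq]
    have := hwo.inner_sum (fun i => q i) (fun i => q i) Finset.univ
    simp only [LinearMap.comp_apply, Fintype.linearCombination_apply]
    refine this.trans ?_
    exact Finset.sum_congr rfl fun i _ => by simp [sq]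
  · ext a
    constructor
    · rintro ⟨x, rfl⟩
      obtain ⟨y, hy, hfy⟩ := hw x
      exact ⟨_, ⟨⟨y, by simpa using hy⟩, rfl⟩, hfy.symm⟩
    · rintro ⟨_, ⟨⟨y, hy⟩, rfl⟩, rfl⟩
      obtain ⟨x, hx⟩ := hf.exists_eq_veronesePoly hn hwo hw (y := y) (by simpa using hy)
      exact ⟨x, hx⟩

end IsMinimalSubmanifold

/-! ### Congruence of products -/

section Congruence

variable {E₁ E₂ E₁' E₂' : Type*} [NormedAddCommGroup E₁] [InnerProductSpace ℝ E₁]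
  [NormedAddCommGroup E₂] [InnerProductSpace ℝ E₂] [NormedAddCommGroup E₁']
  [InnerProductSpace ℝ E₁'] [NormedAddCommGroup E₂'] [InnerProductSpace ℝ E₂']
  {M₁ M₂ M₁' M₂' : Type*} {f₁ : M₁ → E₁} {f₂ : M₂ → E₂} {g₁ : M₁' → E₁'} {g₂ : M₂' → E₂'}

/-- Minimality determines the weights only up to sign, and the sign is absorbed into the isometry.
-/
theorem exists_linearIsometry_smul (A : E₁' →ₗᵢ[ℝ] E₁) {c d : ℝ} (h : c ^ 2 = d ^ 2) :
    ∃ B : E₁' →ₗᵢ[ℝ] E₁, ∀ x, c • A x = B (d • x) := by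
  rcases sq_eq_sq_iff_eq_or_eq_neg.1 h with rfl | rfl
  · exact ⟨A, fun x => (map_smul A _ x).symm⟩
  · exact ⟨(LinearIsometryEquiv.neg ℝ).toLinearIsometry.comp A, fun x => by simp⟩

theorem exists_linearIsometry_prod (A₁ : E₁' →ₗᵢ[ℝ] E₁) (A₂ : E₂' →ₗᵢ[ℝ] E₂) :
    ∃ A : WithLp 2 (E₁' × E₂') →ₗᵢ[ℝ] WithLp 2 (E₁ × E₂),
      ∀ x y, A (WithLp.toLp 2 (x, y)) = WithLp.toLp 2 (A₁ x, A₂ y) := by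
  refine ⟨⟨(WithLp.linearEquiv 2 ℝ (E₁ × E₂)).symm.toLinearMap.comp
    ((A₁.toLinearMap.prodMap A₂.toLinearMap).comp
      (WithLp.linearEquiv 2 ℝ (E₁' × E₂')).toLinearMap), fun z => ?_⟩, fun x y => rfl⟩
  rw [← sq_eq_sq₀ (norm_nonneg _) (norm_nonneg _), WithLp.prod_norm_sq_eq_of_L2,
    WithLp.prod_norm_sq_eq_of_L2]
  exact congrArg₂ _ (by rw [← A₁.norm_map z.fst]; rfl) (by rw [← A₂.norm_map z.snd]; rfl)

/-- Products of congruent submanifolds with weights of the same absolute values are congruent. -/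
theorem IsCongruentTo.productMap (h₁ : IsCongruentTo f₁ g₁) (h₂ : IsCongruentTo f₂ g₂)
    {c₁ c₂ d₁ d₂ : ℝ} (hc₁ : c₁ ^ 2 = d₁ ^ 2) (hc₂ : c₂ ^ 2 = d₂ ^ 2) :
    IsCongruentTo (productMap c₁ c₂ f₁ f₂) (productMap d₁ d₂ g₁ g₂) := by
  obtain ⟨A₁, hA₁⟩ := h₁
  obtain ⟨A₂, hA₂⟩ := h₂
  obtain ⟨B₁, hB₁⟩ := exists_linearIsometry_smul A₁ hc₁
  obtain ⟨B₂, hB₂⟩ := exists_linearIsometry_smul A₂ hc₂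
  obtain ⟨A, hA⟩ := exists_linearIsometry_prod B₁ B₂
  refine ⟨A, Set.ext fun z => ⟨?_, ?_⟩⟩
  · rintro ⟨⟨x, y⟩, rfl⟩
    obtain ⟨_, ⟨x', rfl⟩, hx⟩ := hA₁.subset ⟨x, rfl⟩
    obtain ⟨_, ⟨y', rfl⟩, hy⟩ := hA₂.subset ⟨y, rfl⟩
    refine ⟨_, ⟨(x', y'), rfl⟩, ?_⟩
    simp only [MinimalProducts.productMap, hA, ← hB₁, ← hB₂, hx, hy]
  · rintro ⟨_, ⟨⟨x', y'⟩, rfl⟩, rfl⟩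
    obtain ⟨x, hx⟩ := hA₁.superset ⟨_, ⟨x', rfl⟩, rfl⟩
    obtain ⟨y, hy⟩ := hA₂.superset ⟨_, ⟨y', rfl⟩, rfl⟩
    refine ⟨(x, y), ?_⟩
    simp only [MinimalProducts.productMap, hA, ← hB₁, ← hB₂, hx, hy]

theorem exists_linearIsometry_swap : ∃ A : WithLp 2 (E₂ × E₁) →ₗᵢ[ℝ] WithLp 2 (E₁ × E₂),
    ∀ x y, A (WithLp.toLp 2 (y, x)) = WithLp.toLp 2 (x, y) := by
  refine ⟨⟨(WithLp.linearEquiv 2 ℝ (E₁ × E₂)).symm.toLinearMap.comp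
    ((LinearEquiv.prodComm ℝ E₂ E₁).toLinearMap.comp
      (WithLp.linearEquiv 2 ℝ (E₂ × E₁)).toLinearMap), fun z => ?_⟩, fun x y => rfl⟩
  rw [← sq_eq_sq₀ (norm_nonneg _) (norm_nonneg _), WithLp.prod_norm_sq_eq_of_L2,
    WithLp.prod_norm_sq_eq_of_L2]
  exact add_comm _ _

theorem IsCongruentTo.swap {M E : Type*} [NormedAddCommGroup E] [InnerProductSpace ℝ E] {g : M → E}
    {c₁ c₂ : ℝ} (h : IsCongruentTo (MinimalProducts.productMap c₂ c₁ f₂ f₁) g) :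
    IsCongruentTo (MinimalProducts.productMap c₁ c₂ f₁ f₂) g := by
  obtain ⟨A, hA⟩ := h
  obtain ⟨B, hB⟩ := exists_linearIsometry_swap (E₁ := E₁) (E₂ := E₂)
  refine ⟨B.comp A, ?_⟩
  rw [LinearIsometry.coe_comp, Set.image_comp, ← hA, ← Set.range_comp]
  ext z
  constructor
  · rintro ⟨⟨x, y⟩, rfl⟩
    exact ⟨(y, x), hB _ _⟩
  · rintro ⟨⟨y, x⟩, rfl⟩
    exact ⟨(x, y), (hB _ _).symm⟩

end Congruence

/-- The classification of closed minimal submanifolds of dimension `n` of the sphere with constant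
`S ≤ 2n/3`. -/
theorem IsMinimalSubmanifold.eq_zero_or_eq_of_le {V : Type*} [NormedAddCommGroup V]
    [InnerProductSpace ℝ V] [FiniteDimensional ℝ V] {H : Type*} [TopologicalSpace H]
    {I : ModelWithCorners ℝ V H} [I.Boundaryless] {M : Type*} [TopologicalSpace M]
    [ChartedSpace H M] [IsManifold I ∞ M] [CompactSpace M] [ConnectedSpace M]
    {E : Type*} [NormedAddCommGroup E] [InnerProductSpace ℝ E] [FiniteDimensional ℝ E] {f : M → E}
    (hf : IsMinimalSubmanifold I f) {n : ℕ} (hn : Module.finrank ℝ V = n) (hn0 : 0 < n) {s : ℝ}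
    (hs : ∀ x, squaredLength I f x = s) (hsn : s ≤ 2 / 3 * n) :
    (s = 0 ∧ IsCongruentTo f (standardSphere n)) ∨
      (s = 2 / 3 * n ∧ n = 2 ∧ IsCongruentTo f veroneseSurface) := by
  obtain ⟨x₀⟩ := (inferInstance : Nonempty M)
  have h0 : 0 ≤ s := hs x₀ ▸ squaredLength_nonneg x₀
  rcases h0.eq_or_lt with rfl | h0
  · exact .inl ⟨rfl, hf.isCongruentTo_standardSphere hn hn0 hs⟩
  · obtain ⟨h1, rfl, hg, hV⟩ := (hf.sphereCalculus hn).gap (stdOrthonormalBasis ℝ E) h0 hsn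
      (hf.sum_second_sq_eq_algebraMap _ hs)
    exact .inr ⟨h1, rfl, hf.isCongruentTo_veroneseSurface hn hg hV⟩

end MinimalProducts

end

/-! ### The main theorem -/

theorem theorem5p2 (n₁ p₁ n₂ p₂ : ℕ) (hn₁ : 0 < n₁) (hn₂ : 0 < n₂)
    {M₁ : Type*} [TopologicalSpace M₁] [T2Space M₁] [CompactSpace M₁] [ConnectedSpace M₁]
    [ChartedSpace (EuclideanSpace ℝ (Fin n₁)) M₁] [IsManifold (𝓡 n₁) ∞ M₁]
    {M₂ : Type*} [TopologicalSpace M₂] [T2Space M₂] [CompactSpace M₂] [ConnectedSpace M₂]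
    [ChartedSpace (EuclideanSpace ℝ (Fin n₂)) M₂] [IsManifold (𝓡 n₂) ∞ M₂]
    (f₁ : M₁ → EuclideanSpace ℝ (Fin (n₁ + p₁ + 1)))
    (f₂ : M₂ → EuclideanSpace ℝ (Fin (n₂ + p₂ + 1)))
    (hf₁ : MinimalProducts.IsMinimalSubmanifold (𝓡 n₁) f₁)
    (hf₂ : MinimalProducts.IsMinimalSubmanifold (𝓡 n₂) f₂)
    (c₁ c₂ : ℝ) (hc : c₁ ^ 2 + c₂ ^ 2 = 1) (hc_ne : c₁ * c₂ ≠ 0)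
    (f : M₁ × M₂ →
      WithLp 2 (EuclideanSpace ℝ (Fin (n₁ + p₁ + 1)) × EuclideanSpace ℝ (Fin (n₂ + p₂ + 1))))
    (hf_eq : f = MinimalProducts.productMap c₁ c₂ f₁ f₂)
    (hf : MinimalProducts.IsMinimalSubmanifold ((𝓡 n₁).prod (𝓡 n₂)) f) :
    -- `S` is constant iff the two factors have constant squared length
    ((∃ s : ℝ, ∀ z, MinimalProducts.squaredLength ((𝓡 n₁).prod (𝓡 n₂)) f z = s) ↔
      (∃ s₁ : ℝ, ∀ x, MinimalProducts.squaredLength (𝓡 n₁) f₁ x = s₁) ∧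
      (∃ s₂ : ℝ, ∀ y, MinimalProducts.squaredLength (𝓡 n₂) f₂ y = s₂)) ∧
    -- a constant `S` is at least `n`, with equality exactly for the Clifford hypersurface
    (∀ s : ℝ, (∀ z, MinimalProducts.squaredLength ((𝓡 n₁).prod (𝓡 n₂)) f z = s) →
      (n₁ + n₂ : ℝ) ≤ s ∧
      (s = (n₁ + n₂ : ℝ) ↔
        MinimalProducts.IsCongruentTo f (MinimalProducts.cliffordHypersurface n₁ n₂))) ∧
    -- the gap between `n` and `5n/3`
    (∀ s : ℝ, (∀ z, MinimalProducts.squaredLength ((𝓡 n₁).prod (𝓡 n₂)) f z = s) →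
      (n₁ + n₂ : ℝ) < s → s ≤ 5 / 3 * (n₁ + n₂ : ℝ) →
      s = 5 / 3 * (n₁ + n₂ : ℝ) ∧
      ∃ m : ℕ, 0 < m ∧ m + 2 = n₁ + n₂ ∧
        MinimalProducts.IsCongruentTo f (MinimalProducts.sphereVeroneseProduct m)) := by
  subst hf_eq
  have hd₁ : Module.finrank ℝ (EuclideanSpace ℝ (Fin n₁)) = n₁ := finrank_euclideanSpace_fin
  have hd₂ : Module.finrank ℝ (EuclideanSpace ℝ (Fin n₂)) = n₂ := finrank_euclideanSpace_fin
  have : Nontrivial (EuclideanSpace ℝ (Fin n₁)) :=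
    Module.nontrivial_of_finrank_pos (R := ℝ) (by rwa [hd₁])
  have : Nontrivial (EuclideanSpace ℝ (Fin n₂)) :=
    Module.nontrivial_of_finrank_pos (R := ℝ) (by rwa [hd₂])
  have hc₁ : c₁ ≠ 0 := left_ne_zero_of_mul hc_ne
  have hc₂ : c₂ ≠ 0 := right_ne_zero_of_mul hc_ne
  obtain ⟨x₀⟩ := (inferInstance : Nonempty M₁)
  obtain ⟨y₀⟩ := (inferInstance : Nonempty M₂)
  have h₁ : (0 : ℝ) < n₁ := Nat.cast_pos.2 hn₁
  have h₂ : (0 : ℝ) < n₂ := Nat.cast_pos.2 hn₂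
  have hw := MinimalProducts.weight_sq hf₁ hf₂ hf hc₁ hc₂ (x₀, y₀)
  rw [hd₁, hd₂] at hw
  have hw₁ : c₁ ^ 2 = n₁ / ((n₁ : ℝ) + n₂) := by
    rw [eq_div_iff (by positivity), mul_comm, hw.1]
  have hw₂ : c₂ ^ 2 = n₂ / ((n₁ : ℝ) + n₂) := by
    rw [eq_div_iff (by positivity), mul_comm, hw.2]
  have hS : ∀ z, MinimalProducts.squaredLength ((𝓡 n₁).prod (𝓡 n₂))
      (MinimalProducts.productMap c₁ c₂ f₁ f₂) z =
      (n₁ + n₂) * (1 + MinimalProducts.squaredLength (𝓡 n₁) f₁ z.1 / n₁ +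
        MinimalProducts.squaredLength (𝓡 n₂) f₂ z.2 / n₂) := fun z => by
    rw [MinimalProducts.squaredLength_productMap hf₁ hf₂ hf hc₁ hc₂ hc, hd₁, hd₂, hw₁, hw₂]
    field_simp
    ring
  -- Freezing one variable at `x₀` or `y₀` in the formula `hS` isolates the squared length of the
  -- other factor.
  have hconst : ∀ s : ℝ, (∀ z, MinimalProducts.squaredLength ((𝓡 n₁).prod (𝓡 n₂))
      (MinimalProducts.productMap c₁ c₂ f₁ f₂) z = s) →
      ∃ s₁ s₂ : ℝ, (∀ x, MinimalProducts.squaredLength (𝓡 n₁) f₁ x = s₁) ∧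
        (∀ y, MinimalProducts.squaredLength (𝓡 n₂) f₂ y = s₂) ∧ 0 ≤ s₁ ∧ 0 ≤ s₂ ∧
        s = (n₁ + n₂) * (1 + s₁ / n₁ + s₂ / n₂) := fun s hs => by
    have hs' : ∀ x y, s = (n₁ + n₂) * (1 + MinimalProducts.squaredLength (𝓡 n₁) f₁ x / n₁ +
        MinimalProducts.squaredLength (𝓡 n₂) f₂ y / n₂) := fun x y => by
      rw [← hs (x, y), hS]
    refine ⟨_, _, fun x => ?_, fun y => ?_,
      MinimalProducts.IsMinimalSubmanifold.squaredLength_nonneg x₀,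
      MinimalProducts.IsMinimalSubmanifold.squaredLength_nonneg y₀, hs' x₀ y₀⟩
    · have h := (hs' x y₀).symm.trans (hs' x₀ y₀)
      rw [mul_right_inj' (by positivity), add_left_inj, add_right_inj, div_left_inj' h₁.ne'] at h
      exact h
    · have h := (hs' x₀ y).symm.trans (hs' x₀ y₀)
      rw [mul_right_inj' (by positivity), add_right_inj, div_left_inj' h₂.ne'] at h
      exact h
  refine ⟨⟨?_, ?_⟩, fun s hs => ?_, fun s hs hlt hle => ?_⟩
  · rintro ⟨s, hs⟩
    obtain ⟨s₁, s₂, hs₁, hs₂, -⟩ := hconst s hs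
    exact ⟨⟨s₁, hs₁⟩, ⟨s₂, hs₂⟩⟩
  · rintro ⟨⟨s₁, hs₁⟩, ⟨s₂, hs₂⟩⟩
    exact ⟨_, fun z => by rw [hS, hs₁, hs₂]⟩
  · obtain ⟨s₁, s₂, hs₁, hs₂, hp₁, hp₂, rfl⟩ := hconst s hs
    refine ⟨?_, fun h => ?_, fun h => ?_⟩
    · exact le_mul_of_one_le_right (by positivity)
        (by rw [add_assoc]; exact le_add_of_nonneg_right (by positivity))
    · have h' : s₁ / n₁ + s₂ / n₂ = 0 := by
        have := mul_left_cancel₀ (b := 1 + s₁ / n₁ + s₂ / n₂) (c := 1)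
          (by positivity : (n₁ + n₂ : ℝ) ≠ 0) (by rw [h, mul_one])
        linarith
      obtain ⟨e₁, e₂⟩ := (add_eq_zero_iff_of_nonneg (by positivity) (by positivity)).1 h'
      have k₁ : s₁ = 0 := by simpa [h₁.ne'] using e₁
      have k₂ : s₂ = 0 := by simpa [h₂.ne'] using e₂
      subst k₁ k₂
      refine (hf₁.isCongruentTo_standardSphere hd₁ hn₁ hs₁).productMap
        (hf₂.isCongruentTo_standardSphere hd₂ hn₂ hs₂) ?_ ?_
      · rw [Real.sq_sqrt (by positivity), hw₁]
      · rw [Real.sq_sqrt (by positivity), hw₂]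
    · have k := MinimalProducts.squaredLength_eq_zero_of_isCongruentTo_clifford
        hf₁ hf₂ hc₁ hc₂ (by rwa [hd₁, hd₂]) x₀ y₀
      rw [hs₁, hs₂] at k
      rw [k.1, k.2]
      ring
  · obtain ⟨s₁, s₂, hs₁, hs₂, hp₁, hp₂, rfl⟩ := hconst s hs
    -- Both summands are nonnegative, so each factor separately satisfies the hypothesis of the gap
    -- theorem.
    have hle' : s₁ / n₁ + s₂ / n₂ ≤ 2 / 3 := by
      rw [mul_comm (5 / 3 : ℝ), mul_le_mul_iff_right₀ (by positivity)] at hle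
      linarith
    have hp₁' : 0 ≤ s₁ / n₁ := by positivity
    have hp₂' : 0 ≤ s₂ / n₂ := by positivity
    -- Of the four combinations, two great spheres give `s = n`, contrary to `hlt`, and two Veronese
    -- surfaces give the sum `4 / 3`, contrary to `hle'`. In the mixed cases `m` is the dimension of
    -- the great sphere.
    rcases hf₁.eq_zero_or_eq_of_le hd₁ hn₁ hs₁
      ((div_le_iff₀ h₁).1 (by linarith)) with ⟨k₁, g₁⟩ | ⟨k₁, rfl, g₁⟩ <;>
    rcases hf₂.eq_zero_or_eq_of_le hd₂ hn₂ hs₂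
      ((div_le_iff₀ h₂).1 (by linarith)) with ⟨k₂, g₂⟩ | ⟨k₂, rfl, g₂⟩
    · rw [k₁, k₂] at hlt
      norm_num at hlt
    · refine ⟨?_, n₁, hn₁, rfl, g₁.productMap g₂ ?_ ?_⟩
      · rw [k₁, k₂]
        field_simp
        ring
      · rw [Real.sq_sqrt (by positivity), hw₁, Nat.cast_ofNat]
      · rw [Real.sq_sqrt (by positivity), hw₂, Nat.cast_ofNat]
    · refine ⟨?_, n₂, hn₂, add_comm _ _, (g₂.productMap g₁ ?_ ?_).swap⟩
      · rw [k₁, k₂]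
        field_simp
        ring
      · rw [Real.sq_sqrt (by positivity), hw₂, Nat.cast_ofNat, add_comm]
      · rw [Real.sq_sqrt (by positivity), hw₁, Nat.cast_ofNat, add_comm]
    · rw [k₁, k₂, mul_div_cancel_right₀ _ h₁.ne'] at hle'
      norm_num at hle'
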